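/- **Setting.** Let $d\in\mathbb N$, $p\in(1,\infty)$, $\gamma\in[0,1)$. Let $(\Omega,\mathcal F,P)$ be a separable probability space with expectation $\langle\cdot\rangle$ and with measurable, measure preserving maps $T_x:\Omega\to\Omega$, $x\in\mathbb Z^d$, satisfying $T_0=\mathrm{Id}$ and $T_{x+y}=T_x\circ T_y$. Assume ergodicity: if $A\in\mathcal F$ and $T_xA=A$ for all $x\in\mathbb Z^d$, then $P(A)\in\{0,1\}$. Let $m_\varepsilon=\varepsilon^d\sum_{x\in\varepsilon\mathbb Z^d}\delta_x$. For $u:\Omega\times\varepsilon\mathbb Z^d\to\mathbb R$ let $\nabla^\varepsilon_iu(\omega,x)=\varepsilon^{-1}(u(\omega,x+\varepsilon e_i)-u(\omega,x))$ and $\nabla^\varepsilon u=(\nabla^\varepsilon_iu)_{i\le d}$. For $x\in\mathbb R^d$ let $\lfloor x\rfloor_\varepsilon\in\varepsilon\mathbb Z^d$ be the point with $x-\lfloor x\rfloor_\varepsilon\in\varepsilon[-\tfrac12,\tfrac12)^d$. The piecewise constant interpolation of $v:\varepsilon\mathbb Z^d\to\mathbb R$ is $\overline v(x)=v(\lfloor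 x\rfloor_\varepsilon)$, and the unfolding of $u$ is $\mathcal T_\varepsilon u(\omega,x)=u(T_{-\lfloor x\rfloor_\varepsilon/\varepsilon}\,\omega,\lfloor x\rfloor_\varepsilon)$. **Convergence.** Let $\varepsilon_n>0$, $\varepsilon_n\to0$; the index $n$ is suppressed below. - $u_\varepsilon\overset{2}{\rightharpoonup}U$ (resp. $u_\varepsilon\overset{2}{\to}U$) in $L^p(\Omega\times\mathbb R^d)$ means that $\mathcal T_\varepsilon u_\varepsilon\to U$ weakly (resp. strongly) in $L^p(\Omega\times\mathbb R^d)$. - For $v_\varepsilon\in L^p(\varepsilon\mathbb Z^d)$ and $V\in L^p(\mathbb R^d)$, $v_\varepsilon\rightharpoonup V$ in $L^p(\mathbb R^d)$ means $\limsup\|v_\varepsilon\|_{L^p(\varepsilon\mathbb Z^d)}<\infty$ and $\int v_\varepsilon\eta\,dm_\varepsilon\to\int_{\mathbb R^d}V\eta\,dx$ for all $\eta\in C_c^\infty(\mathbb R^d)$; $v_\varepsilon\to V$ means that in addition $\|v_\varepsilon\|_{L^p(\varepsilon\mathbb Z^d)}\to\|V\|_{L^p(\mathbb R^d)}$. - For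 vectors both notions are componentwise. **Spaces.** $L^p_{\rm inv}(\Omega)$ is the set of $\varphi\in L^p(\Omega)$ with $\varphi\circ T_x=\varphi$ a.s. for all $x$. $\mathbf L^p_{\rm pot}(\Omega)$ is the closure in $L^p(\Omega)^d$ of $\{(\varphi\circ T_{e_i}-\varphi)_{i\le d}:\varphi\in L^p(\Omega)\}$. The symbol $\otimes$ denotes the closure of the algebraic tensor product in $L^p(\Omega\times\mathbb R^d)$ (in $L^p(\Omega\times\mathbb R^d)^d$ for $\mathbf L^p_{\rm pot}(\Omega)\otimes L^p(\mathbb R^d)$, in $L^p(\Omega,W^{1,p}(\mathbb R^d))$ for $L^p_{\rm inv}(\Omega)\otimes W^{1,p}(\mathbb R^d)$). **Statement.** Let $u_\varepsilon\in L^p(\Omega\times\varepsilon\mathbb Z^d)$ satisfy $$\limsup_{\varepsilon\to0}\Big\langle\int_{\varepsilon\mathbb Z^d}|u_\varepsilon|^p+\varepsilon^{\gamma p}|\nabla^\varepsilon u_\varepsilon|^p\,dm_\varepsilon\Big\rangle<\infty.$$ (a) Suppose $\gamma=0$. There are a subsequence, $U\in L^p_{\rm inv}(\Omega)\otimes W^{1,p}(\mathbb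 R^d)$ and $\chi\in\mathbf L^p_{\rm pot}(\Omega)\otimes L^p(\mathbb R^d)$ such that along it $u_\varepsilon\overset{2}{\rightharpoonup}U$ and $\nabla^\varepsilon u_\varepsilon\overset{2}{\rightharpoonup}\nabla U+\chi$. For every subsequence and every such $U,\chi$ for which these convergences hold, $U$ is deterministic, i.e. (a.e.) $U(\omega,x)=U(x)$ with $U\in W^{1,p}(\mathbb R^d)$, and along that subsequence $$\langle u_\varepsilon\rangle\rightharpoonup U\text{ in }L^p(\mathbb R^d),\qquad\langle\nabla^\varepsilon u_\varepsilon\rangle\rightharpoonup\nabla U\text{ in }L^p(\mathbb R^d)^d,\qquad u_\varepsilon-\langle u_\varepsilon\rangle\overset{2}{\rightharpoonup}0\text{ in }L^p(\Omega\times\mathbb R^d);$$ moreover $\overline{\langle u_\varepsilon\rangle}\to U$ strongly in $L^p(Q)$ for every open bounded $Q\subset\mathbb R^d$ with Lipschitz boundary. (b) Suppose $\gamma\in(0,1)$. There are a subsequence, $U\in L^p_{\rm inv}(\Omega)\otimes L^p(\mathbb R^d)$ and $\chi\in\mathbf L^p_{\rm pot}(\Omega)\otimes L^p(\mathbb R^d)$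 such that along it $u_\varepsilon\overset{2}{\rightharpoonup}U$ and $\varepsilon^\gamma\nabla^\varepsilon u_\varepsilon\overset{2}{\rightharpoonup}\chi$. For every subsequence and every such $U,\chi$ for which these convergences hold, $U$ is deterministic, $U(\omega,x)=U(x)$ a.e., and along that subsequence $$\langle u_\varepsilon\rangle\rightharpoonup U\text{ in }L^p(\mathbb R^d),\qquad\langle\varepsilon^\gamma\nabla^\varepsilon u_\varepsilon\rangle\rightharpoonup0\text{ in }L^p(\mathbb R^d)^d,\qquad u_\varepsilon-\langle u_\varepsilon\rangle\overset{2}{\rightharpoonup}0\text{ in }L^p(\Omega\times\mathbb R^d).$$ (c) Let $\gamma\in[0,1)$. If along some subsequence $u_\varepsilon\overset{2}{\to}U$ in $L^p(\Omega\times\mathbb R^d)$, then $U$ is deterministic, and along that subsequence $\langle u_\varepsilon\varphi\rangle\to\langle\varphi\rangle U$ strongly in $L^p(\mathbb R^d)$ for every $\varphi\in L^\infty(\Omega)$. -/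

import Mathlib

open MeasureTheory Filter Topology Set
open scoped ENNReal

noncomputable section

namespace StochUnfold

/-- Euclidean space `ℝ^d`. -/
abbrev Space (d : ℕ) : Type := EuclideanSpace ℝ (Fin d)

/-- The lattice `ℤ^d`. A function on `εℤ^d` is written as a function of `z ∈ ℤ^d`, the lattice point
being `ε z`; for `ε > 0` this is a bijective relabelling. -/
abbrev Lattice (d : ℕ) : Type := Fin d → ℤ

/-- The `i`-th standard basis vector `e_i` of `ℤ^d`. -/
def latticeBasis {d : ℕ} (i : Fin d) : Lattice d := Pi.single i 1

/-- The point `ε z ∈ εℤ^d ⊆ ℝ^d`. -/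
def latticePoint {d : ℕ} (ε : ℝ) (z : Lattice d) : Space d :=
  WithLp.toLp 2 (fun i => ε * (z i : ℝ))

/-- The measure `m_ε = ε^d ∑_{x ∈ εℤ^d} δ_x`. -/
def latticeMeasure (d : ℕ) (ε : ℝ) : Measure (Lattice d) :=
  ENNReal.ofReal (ε ^ d) • Measure.count

/-- The lattice cell of `x`: the unique `z` with `x - ε z ∈ ε [-1/2, 1/2)^d`. -/
def cell {d : ℕ} (ε : ℝ) (x : Space d) : Lattice d := fun i => ⌊x i / ε + 1 / 2⌋

/-- Piecewise constant interpolation of a lattice function. -/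
def interp {d : ℕ} (ε : ℝ) (v : Lattice d → ℝ) (x : Space d) : ℝ := v (cell ε x)

/-- Smooth compactly supported test functions on `ℝ^d`. -/
def IsTestFunction {d : ℕ} (η : Space d → ℝ) : Prop :=
  ContDiff ℝ ((⊤ : ℕ∞) : WithTop ℕ∞) η ∧ HasCompactSupport η

/-- `U ∈ W^{1,p}(ℝ^d)` with weak gradient `G`. -/
structure HasSobolevGradient {d : ℕ} (p : ℝ≥0∞) (U : Space d → ℝ) (G : Fin d → Space d → ℝ) :
    Prop where
  memLp : MemLp U p volume
  memLp_grad : ∀ i, MemLp (G i) p volume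
  integral_eq : ∀ (i : Fin d) (ζ : Space d → ℝ), IsTestFunction ζ →
    ∫ x, U x * fderiv ℝ ζ x (EuclideanSpace.single i 1) = -∫ x, G i x * ζ x

/-- Weak convergence in `L^p(ℝ^d)` of lattice functions `v_n` on `ε_n ℤ^d`. -/
structure LatticeTendstoWeak {d : ℕ} (p : ℝ≥0∞) (ε : ℕ → ℝ) (v : ℕ → Lattice d → ℝ)
    (U : Space d → ℝ) : Prop where
  memLp : ∀ n, MemLp (v n) p (latticeMeasure d (ε n))
  memLp_limit : MemLp U p volume
  limsup_lt : limsup (fun n => eLpNorm (v n) p (latticeMeasure d (ε n))) atTop < ∞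
  tendsto : ∀ η : Space d → ℝ, IsTestFunction η →
    Tendsto (fun n => ∫ z, v n z * η (latticePoint (ε n) z) ∂(latticeMeasure d (ε n))) atTop
      (𝓝 (∫ x, U x * η x))

/-- Strong convergence in `L^p(ℝ^d)` of lattice functions `v_n` on `ε_n ℤ^d`. -/
structure LatticeTendstoStrong {d : ℕ} (p : ℝ≥0∞) (ε : ℕ → ℝ) (v : ℕ → Lattice d → ℝ)
    (U : Space d → ℝ) : Prop where
  weak : LatticeTendstoWeak p ε v U
  tendsto_norm : Tendsto (fun n => eLpNorm (v n) p (latticeMeasure d (ε n))) atTop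
      (𝓝 (eLpNorm U p volume))

/-- `Q` has Lipschitz boundary: near every boundary point, in suitable orthonormal coordinates,
`Q` is the set of points lying strictly above the graph of a Lipschitz function. Here `e` is the
vertical direction and `y - ⟪e, y⟫ e` is the horizontal part of `y`. -/
def HasLipschitzBoundary {d : ℕ} (Q : Set (Space d)) : Prop :=
  ∀ x ∈ frontier Q, ∃ r > 0, ∃ e : Space d, ‖e‖ = 1 ∧ ∃ (K : NNReal) (g : Space d → ℝ),
    LipschitzWith K g ∧
      ∀ y ∈ Metric.ball x r, y ∈ Q ↔ g (y - inner ℝ e y • e) < inner ℝ e y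

section RandomFields

variable {d : ℕ} {Ω : Type*} [MeasurableSpace Ω] [AddAction (Lattice d) Ω]

/-- Ergodicity of the action `T_x ω = x +ᵥ ω`: every shift invariant event has probability
`0` or `1`. -/
def IsErgodic (d : ℕ) {Ω : Type*} [MeasurableSpace Ω] [AddAction (Lattice d) Ω]
    (P : Measure Ω) : Prop :=
  ∀ A : Set Ω, MeasurableSet A → (∀ x : Lattice d, (fun ω => x +ᵥ ω) '' A = A) →
    P A = 0 ∨ P A = 1

/-- Discrete gradient of a random lattice field. -/
def discreteGrad {d : ℕ} {Ω : Type*} (ε : ℝ) (u : Ω × Lattice d → ℝ) (q : Ω × Lattice d) :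
    Space d :=
  WithLp.toLp 2 (fun i => (u (q.1, q.2 + latticeBasis i) - u q) / ε)

/-- Expectation `⟨u⟩` of a random field, a function of the spatial variable. -/
def expect {Ω X : Type*} [MeasurableSpace Ω] (P : Measure Ω) (u : Ω × X → ℝ) (x : X) : ℝ :=
  ∫ ω, u (ω, x) ∂P

/-- The stochastic unfolding `𝒯_ε u (ω, x) = u (T_{-z} ω, z)`, where `z` is the cell of `x`. -/
def unfold (ε : ℝ) (u : Ω × Lattice d → ℝ) (q : Ω × Space d) : ℝ :=
  u ((-cell ε q.2) +ᵥ q.1, cell ε q.2)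

/-- The energy `⟨∫ |u|^p + ε^{γ p} |∇^ε u|^p dm_ε⟩ ∈ [0, ∞]`. -/
def fieldEnergy {d : ℕ} {Ω : Type*} [MeasurableSpace Ω] (P : Measure Ω) (p : ℝ≥0∞) (γ ε : ℝ)
    (u : Ω × Lattice d → ℝ) : ℝ≥0∞ :=
  ∫⁻ q, ENNReal.ofReal (|u q| ^ p.toReal + ε ^ (γ * p.toReal) * ‖discreteGrad ε u q‖ ^ p.toReal)
    ∂(P.prod (latticeMeasure d ε))

/-- The space `L^p(Ω × ℝ^d)`. -/
abbrev FieldLp (d : ℕ) {Ω : Type*} [MeasurableSpace Ω] (P : Measure Ω) (p : ℝ≥0∞) : Type _ :=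
  Lp ℝ p (P.prod (volume : Measure (Space d)))

/-- Weak two-scale convergence in the mean `u_n ⇀ U`: the unfolded sequence converges in the weak
topology of `L^p(Ω × ℝ^d)`. -/
def TwoScaleWeak (P : Measure Ω) (p : ℝ≥0∞) [Fact (1 ≤ p)] (ε : ℕ → ℝ)
    (u : ℕ → Ω × Lattice d → ℝ) (U : FieldLp d P p) : Prop :=
  ∃ h : ∀ n, MemLp (unfold (ε n) (u n)) p (P.prod volume),
    Tendsto (fun n => toWeakSpace ℝ (FieldLp d P p) ((h n).toLp _)) atTop
      (𝓝 (toWeakSpace ℝ (FieldLp d P p) U))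

/-- Strong two-scale convergence in the mean `u_n → U`: the unfolded sequence converges in the norm
of `L^p(Ω × ℝ^d)`. -/
def TwoScaleStrong (P : Measure Ω) (p : ℝ≥0∞) [Fact (1 ≤ p)] (ε : ℕ → ℝ)
    (u : ℕ → Ω × Lattice d → ℝ) (U : FieldLp d P p) : Prop :=
  ∃ h : ∀ n, MemLp (unfold (ε n) (u n)) p (P.prod volume),
    Tendsto (fun n => ((h n).toLp _ : FieldLp d P p)) atTop (𝓝 U)

/-- The shift invariant functions `L^p_inv(Ω)`. -/
def invSet (d : ℕ) {Ω : Type*} [MeasurableSpace Ω] [AddAction (Lattice d) Ω] (P : Measure Ω)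
    (p : ℝ≥0∞) : Set (Lp ℝ p P) :=
  {φ | ∀ x : Lattice d, (fun ω => φ (x +ᵥ ω)) =ᵐ[P] φ}

/-- `L^p_pot(Ω)`: the closure in `L^p(Ω)^d` of the horizontal derivatives `Dφ`, `φ ∈ L^p(Ω)`,
where `D_i φ (ω) = φ (T_{e_i} ω) - φ ω`. -/
def potSet (d : ℕ) {Ω : Type*} [MeasurableSpace Ω] [AddAction (Lattice d) Ω] (P : Measure Ω)
    (p : ℝ≥0∞) [Fact (1 ≤ p)] : Set (Fin d → Lp ℝ p P) :=
  closure {ψ | ∃ φ : Lp ℝ p P, ∀ i, ψ i =ᵐ[P] fun ω => φ (latticeBasis i +ᵥ ω) - φ ω}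

/-- `L^p_inv(Ω) ⊗ L^p(ℝ^d)`, the closure of the algebraic tensor product in `L^p(Ω × ℝ^d)`. -/
def invTensorLp (d : ℕ) {Ω : Type*} [MeasurableSpace Ω] [AddAction (Lattice d) Ω] (P : Measure Ω)
    (p : ℝ≥0∞) [Fact (1 ≤ p)] : Set (FieldLp d P p) :=
  closure (Submodule.span ℝ {W : FieldLp d P p | ∃ φ ∈ invSet d P p,
    ∃ η : Lp ℝ p (volume : Measure (Space d)),
      W =ᵐ[P.prod volume] fun q => φ q.1 * η q.2} : Submodule ℝ (FieldLp d P p))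

/-- `L^p_inv(Ω) ⊗ W^{1,p}(ℝ^d)`, the closure of the algebraic tensor product in
`L^p(Ω, W^{1,p}(ℝ^d))`. An element is given as the pair `(U, ∇U)`; the identification
`U ↦ (U, ∇U)` is an isomorphism of `L^p(Ω, W^{1,p}(ℝ^d))` onto its image in
`L^p(Ω × ℝ^d) × L^p(Ω × ℝ^d)^d`, which is closed. -/
def invTensorW1p (d : ℕ) {Ω : Type*} [MeasurableSpace Ω] [AddAction (Lattice d) Ω] (P : Measure Ω)
    (p : ℝ≥0∞) [Fact (1 ≤ p)] : Set (FieldLp d P p × (Fin d → FieldLp d P p)) :=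
  closure (Submodule.span ℝ {W : FieldLp d P p × (Fin d → FieldLp d P p) | ∃ φ ∈ invSet d P p,
    ∃ (η : Space d → ℝ) (g : Fin d → Space d → ℝ), HasSobolevGradient p η g ∧
      (W.1 =ᵐ[P.prod volume] fun q => φ q.1 * η q.2) ∧
      ∀ i, W.2 i =ᵐ[P.prod volume] fun q => φ q.1 * g i q.2} :
    Submodule ℝ (FieldLp d P p × (Fin d → FieldLp d P p)))

/-- `L^p_pot(Ω) ⊗ L^p(ℝ^d)`, the closure of the algebraic tensor product in `L^p(Ω × ℝ^d)^d`. -/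
def potTensorLp (d : ℕ) {Ω : Type*} [MeasurableSpace Ω] [AddAction (Lattice d) Ω] (P : Measure Ω)
    (p : ℝ≥0∞) [Fact (1 ≤ p)] : Set (Fin d → FieldLp d P p) :=
  closure (Submodule.span ℝ {W : Fin d → FieldLp d P p | ∃ ψ ∈ potSet d P p,
    ∃ η : Lp ℝ p (volume : Measure (Space d)),
      ∀ i, W i =ᵐ[P.prod volume] fun q => ψ i q.1 * η q.2} :
    Submodule ℝ (Fin d → FieldLp d P p))

/-- Two-scale limits for `γ = 0`: `U ∈ L^p_inv(Ω) ⊗ W^{1,p}(ℝ^d)` with `∇U = G`,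
`χ ∈ L^p_pot(Ω) ⊗ L^p(ℝ^d)`, `u_n ⇀ U` and `∇^ε u_n ⇀ ∇U + χ` weakly two-scale. -/
structure IsLimitZero (P : Measure Ω) (p : ℝ≥0∞) [Fact (1 ≤ p)] (ε : ℕ → ℝ)
    (u : ℕ → Ω × Lattice d → ℝ) (U : FieldLp d P p) (G χ : Fin d → FieldLp d P p) : Prop where
  mem_inv : (U, G) ∈ invTensorW1p d P p
  mem_pot : χ ∈ potTensorLp d P p
  tendsto : TwoScaleWeak P p ε u U
  tendsto_grad : ∀ i, TwoScaleWeak P p ε (fun n q => discreteGrad (ε n) (u n) q i) (G i + χ i)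

/-- Two-scale limits for `0 < γ < 1`: `U ∈ L^p_inv(Ω) ⊗ L^p(ℝ^d)`,
`χ ∈ L^p_pot(Ω) ⊗ L^p(ℝ^d)`, `u_n ⇀ U` and `ε^γ ∇^ε u_n ⇀ χ` weakly two-scale. -/
structure IsLimitPos (P : Measure Ω) (p : ℝ≥0∞) [Fact (1 ≤ p)] (γ : ℝ) (ε : ℕ → ℝ)
    (u : ℕ → Ω × Lattice d → ℝ) (U : FieldLp d P p) (χ : Fin d → FieldLp d P p) : Prop where
  mem_inv : U ∈ invTensorLp d P p
  mem_pot : χ ∈ potTensorLp d P p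
  tendsto : TwoScaleWeak P p ε u U
  tendsto_grad : ∀ i,
    TwoScaleWeak P p ε (fun n q => ε n ^ γ * discreteGrad (ε n) (u n) q i) (χ i)

end RandomFields

end StochUnfold

end

open StochUnfold

/-! Write 𝒯 for unfolding, S_i φ = φ ∘ T_{e_i}, and q for the exponent dual to p. Unfolding is
composition with a measure preserving map, hence isometric, so two-scale convergence is ordinary
weak or norm convergence in L^p(Ω × ℝ^d). All of the analysis rests on one identity. Moving x by
εe_i raises its cell by e_i, and shifting ω by T_{e_i} compensates for this. Integrating in x
against a weight η, one gets (`slice_unfold_grad`) ∫ 𝒯(ε^γ ∇_i u) η dx = ε^(γ-1) (S_i ∫ 𝒯u η(· -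
εe_i) dx - ∫ 𝒯u η dx), an equality in L^p(Ω). For a test function η the quotients (η(· - εe_i) -
η)/ε converge to -∂_i η strongly in L^q, so weak limits may be taken on both sides.

Multiplied by ε^(1-γ), the left side vanishes in the limit, and every spatial slice ∫ U η dx of the
weak limit U is shift invariant (`slice_mem_invSet`). Ergodicity makes the slices constant, and
slices determine a function, so U equals its own expectation (`eq_determL_of_slice_mem_invSet`).

Without that factor, suppose ε^γ → κ, so κ is 1 for γ = 0 and 0 for γ > 0. If V is the weak limit of
the rescaled gradients, then ∫ V_i η dx + κ S_i ∫ U ∂_i η dx is the i-th component of a weak limit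
of horizontal gradients. It lies in L^p_pot by Mazur's theorem (`slice_add_mem_potSubmodule`).
Potential fields have mean zero, so ⟨V⟩ = κ∇⟨U⟩ in the weak sense. For κ = 1 the limit splits as V =
∇U + (V - ⟨V⟩) with the second part potential; for κ = 0 all of V is potential. A field whose slices
lie in a closed subspace K belongs to the closure of K ⊗ L^p, by averaging over small cells in x
(`mem_closure_span_tensor`).

Subsequences come from reflexivity. The duality of L^p and L^q is proved by Radon–Nikodym
(`exists_pairing_eq`), and sequential Banach–Alaoglu applies because L^q(Ω × ℝ^d) is separable.

Expectation commutes with unfolding, since the shifts preserve P: the mean of 𝒯u is the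
interpolation of ⟨u⟩ (`coeFn_meanL_unfold`). Weak convergence of ⟨u⟩, of its gradients and of u -
⟨u⟩ is then the image of the two-scale limits under bounded linear maps. Local strong convergence is
a discrete Rellich argument: bounded gradients control translations, hence the distance to averages
over δ-cells, and these averages turn weak convergence into strong convergence on bounded sets. Part
(c) compares 𝒯(uφ) with U times the unfolded φ, whose mean is exactly ⟨φ⟩U. -/

noncomputable section

set_option linter.unusedSectionVars false

namespace StochUnfold

/-! ### Dominated convergence in L^p along countably generated filters -/

section DominatedConvergence

variable {α : Type*} [MeasurableSpace α] {μ : Measure α} {p : ℝ≥0∞}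

theorem tendsto_eLpNorm_sub_of_dominated {ι : Type*} {l : Filter ι} [l.IsCountablyGenerated]
    (hp0 : p ≠ 0) (hp : p ≠ ∞) {F : ι → α → ℝ} {f : α → ℝ} {b : α → ℝ}
    (hF : ∀ n, AEStronglyMeasurable (F n) μ) (hb : MemLp b p μ)
    (hbound : ∀ᶠ n in l, ∀ᵐ x ∂μ, ‖F n x‖ ≤ b x) (hf : AEStronglyMeasurable f μ)
    (hfb : ∀ᵐ x ∂μ, ‖f x‖ ≤ b x)
    (hlim : ∀ᵐ x ∂μ, Tendsto (fun n => F n x) l (𝓝 (f x))) :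
    Tendsto (fun n => eLpNorm (F n - f) p μ) l (𝓝 0) := by
  have hpr : 0 < p.toReal := ENNReal.toReal_pos hp0 hp
  have key : Tendsto (fun n => ∫⁻ x, ‖F n x - f x‖ₑ ^ p.toReal ∂μ) l (𝓝 (∫⁻ x, (0 : ℝ≥0∞) ∂μ)) := by
    have hm : ∀ n, AEMeasurable (fun x => ‖F n x - f x‖ₑ ^ p.toReal) μ := fun n =>
      (((hF n).sub hf).enorm).pow_const _
    have e1 : ∀ n, ∫⁻ x, ‖F n x - f x‖ₑ ^ p.toReal ∂μ = ∫⁻ x, (hm n).mk _ x ∂μ := fun n =>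
      lintegral_congr_ae (hm n).ae_eq_mk
    simp_rw [e1]
    -- The null sets where the measurable representatives differ can be united only over a countable
    -- index, so convergence is tested along sequences.
    rw [tendsto_iff_seq_tendsto]
    intro s hs
    refine tendsto_lintegral_filter_of_dominated_convergence
      (fun x => ‖2 * b x‖ₑ ^ p.toReal) (Eventually.of_forall fun n => (hm (s n)).measurable_mk) ?_ ?_ ?_
    · filter_upwards [hs.eventually hbound] with n hn
      filter_upwards [hn, hfb, (hm (s n)).ae_eq_mk] with x h1 h2 h3
      rw [← h3]
      refine ENNReal.rpow_le_rpow ?_ hpr.le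
      rw [enorm_le_iff_norm_le, Real.norm_eq_abs, Real.norm_eq_abs]
      have := norm_sub_le (F (s n) x) (f x)
      rw [Real.norm_eq_abs] at this
      calc |F (s n) x - f x| ≤ 2 * b x := by linarith
        _ ≤ |2 * b x| := le_abs_self _
    · exact ((eLpNorm_lt_top_iff_lintegral_rpow_enorm_lt_top hp0 hp).1
        (hb.const_mul 2).eLpNorm_lt_top).ne
    · have : ∀ᵐ x ∂μ, ∀ n, (hm (s n)).mk _ x = ‖F (s n) x - f x‖ₑ ^ p.toReal := by
        rw [ae_all_iff]; intro n
        filter_upwards [(hm (s n)).ae_eq_mk] with x hx using hx.symm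
      filter_upwards [this, hlim] with x hx h
      simp_rw [hx]
      have h1 : Tendsto (fun n => F (s n) x - f x) atTop (𝓝 0) := by
        simpa using (h.comp hs).sub_const (f x)
      have h1e : Tendsto (fun n => ‖F (s n) x - f x‖ₑ) atTop (𝓝 0) := by simpa using h1.enorm
      have h2 := (ENNReal.continuous_rpow_const (y := p.toReal)).tendsto 0 |>.comp h1e
      simpa [ENNReal.zero_rpow_of_pos hpr, Function.comp_def] using h2
  have h3 := (ENNReal.continuous_rpow_const (y := 1 / p.toReal)).tendsto _ |>.comp key
  simpa [eLpNorm_eq_lintegral_rpow_enorm_toReal hp0 hp, Function.comp_def, hpr] using h3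

end DominatedConvergence

/-! ### Weak convergence of sequences in normed spaces -/

section WeakTendsto

/-- Weak convergence of a sequence in a normed space. -/
def WeakTendsto {E : Type*} [NormedAddCommGroup E] [NormedSpace ℝ E] (f : ℕ → E) (x : E) : Prop :=
  ∀ l : StrongDual ℝ E, Tendsto (fun n => l (f n)) atTop (𝓝 (l x))

variable {E F : Type*} [NormedAddCommGroup E] [NormedSpace ℝ E] [NormedAddCommGroup F]
  [NormedSpace ℝ F] {f g : ℕ → E} {x y : E}

theorem weakTendsto_iff : WeakTendsto f x ↔
    Tendsto (fun n => toWeakSpace ℝ E (f n)) atTop (𝓝 (toWeakSpace ℝ E x)) := by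
  have hinj : Function.Injective (topDualPairing ℝ E).flip := by
    intro a b hab
    by_contra hne
    obtain ⟨l, hl⟩ := SeparatingDual.exists_ne_zero (R := ℝ) (sub_ne_zero.2 hne)
    apply hl
    have := LinearMap.congr_fun hab l
    simp only [LinearMap.flip_apply, topDualPairing_apply] at this
    rw [map_sub, this, sub_self]
  exact (WeakBilin.tendsto_iff_forall_eval_tendsto (B := (topDualPairing ℝ E).flip) hinj).symm

theorem WeakTendsto.map (h : WeakTendsto f x) (T : E →L[ℝ] F) :
    WeakTendsto (fun n => T (f n)) (T x) := fun l => h (l ∘L T)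

theorem WeakTendsto.add (h : WeakTendsto f x) (h' : WeakTendsto g y) :
    WeakTendsto (fun n => f n + g n) (x + y) := fun l => by
  simpa using (h l).add (h' l)

theorem WeakTendsto.sub (h : WeakTendsto f x) (h' : WeakTendsto g y) :
    WeakTendsto (fun n => f n - g n) (x - y) := fun l => by
  simpa using (h l).sub (h' l)

theorem _root_.Filter.Tendsto.weakTendsto (h : Tendsto f atTop (𝓝 x)) : WeakTendsto f x :=
  fun l => (l.continuous.tendsto x).comp h

theorem WeakTendsto.comp (h : WeakTendsto f x) {σ : ℕ → ℕ} (hσ : Tendsto σ atTop atTop) :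
    WeakTendsto (fun n => f (σ n)) x := fun l => (h l).comp hσ

theorem WeakTendsto.unique (h : WeakTendsto f x) (h' : WeakTendsto f y) : x = y := by
  by_contra hne
  obtain ⟨l, hl⟩ := SeparatingDual.exists_ne_zero (R := ℝ) (sub_ne_zero.2 hne)
  apply hl
  rw [map_sub, tendsto_nhds_unique (h l) (h' l), sub_self]

/-- Uniform boundedness, applied to the isometric copies of the `f n` in the bidual. -/
theorem WeakTendsto.exists_norm_le (h : WeakTendsto f x) : ∃ C, ∀ n, ‖f n‖ ≤ C := by
  obtain ⟨C, hC⟩ := banach_steinhaus (g := fun n => NormedSpace.inclusionInDoubleDual ℝ E (f n))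
    (fun l => by
      obtain ⟨C, hC⟩ := (h l).norm.bddAbove_range
      exact ⟨C, fun n => hC ⟨n, rfl⟩⟩)
  refine ⟨C, fun n => ?_⟩
  have := hC n
  rwa [show ‖NormedSpace.inclusionInDoubleDual ℝ E (f n)‖ = ‖f n‖ from
    (NormedSpace.inclusionInDoubleDualLi ℝ).norm_map (f n)] at this

theorem WeakTendsto.smul (h : WeakTendsto f x) {c : ℕ → ℝ} {κ : ℝ} (hc : Tendsto c atTop (𝓝 κ)) :
    WeakTendsto (fun n => c n • f n) (κ • x) := fun l => by
  simpa using hc.mul (h l)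

/-- Weak times strong: B(f_n, g_n) = B(f_n, g₀) + B(f_n, g_n - g₀). The first term converges weakly;
the second tends to 0 in norm because weakly convergent sequences are bounded. -/
theorem WeakTendsto.bilin {G : Type*} [NormedAddCommGroup G] [NormedSpace ℝ G]
    (h : WeakTendsto f x) (B : E →L[ℝ] F →L[ℝ] G) {g : ℕ → F} {g₀ : F}
    (hg : Tendsto g atTop (𝓝 g₀)) : WeakTendsto (fun n => B (f n) (g n)) (B x g₀) := by
  obtain ⟨C, hC⟩ := h.exists_norm_le
  have h2 : Tendsto (fun n => B (f n) (g n - g₀)) atTop (𝓝 0) := by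
    have h3 : Tendsto (fun n => ‖B‖ * C * ‖g n - g₀‖) atTop (𝓝 0) := by
      simpa using (tendsto_iff_norm_sub_tendsto_zero.1 hg).const_mul (‖B‖ * C)
    refine squeeze_zero_norm (fun n => (B.le_opNorm₂ (f n) (g n - g₀)).trans ?_) h3
    gcongr
    exact hC n
  have h4 := (h.map (B.flip g₀)).add h2.weakTendsto
  rw [add_zero] at h4
  refine Eq.subst (motive := fun f => WeakTendsto f _) (funext fun n => ?_) h4
  rw [ContinuousLinearMap.flip_apply, map_sub, add_sub_cancel]

/-- Mazur: a subspace is convex, so its norm closure and its weak closure coincide. -/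
theorem WeakTendsto.mem_of_isClosed {K : Submodule ℝ E} (hK : IsClosed (K : Set E))
    (h : WeakTendsto f x) (hf : ∀ n, f n ∈ K) : x ∈ K := by
  have h1 := (K.convex).toWeakSpace_closure (𝕜 := ℝ)
  rw [hK.closure_eq] at h1
  have h2 : toWeakSpace ℝ E x ∈ toWeakSpace ℝ E '' (K : Set E) := by
    rw [h1]
    exact mem_closure_of_tendsto (weakTendsto_iff.1 h)
      (Eventually.of_forall fun n => ⟨f n, hf n, rfl⟩)
  obtain ⟨z, hz, hzx⟩ := h2
  exact (toWeakSpace ℝ E).injective hzx ▸ hz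

theorem WeakTendsto.pi {ι : Type*} [Fintype ι] {f : ℕ → ι → E} {x : ι → E}
    (h : ∀ i, WeakTendsto (fun n => f n i) (x i)) : WeakTendsto f x := by
  classical
  intro l
  have key : ∀ z : ι → E, l z = ∑ i, (l ∘L ContinuousLinearMap.single ℝ (fun _ : ι => E) i) (z i) := by
    intro z
    conv_lhs => rw [← Finset.univ_sum_single z]
    simp [map_sum]
  simp_rw [key]
  exact tendsto_finsetSum _ fun i _ => h i _

end WeakTendsto

/-! ### Functionals on L^p as integrals against a density -/

section Riesz

variable {α : Type*} [MeasurableSpace α] {μ : Measure α} {p : ℝ≥0∞}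

/-- A strictly positive weight w in L^p replaces exhaustion by sets of finite measure: every bounded
multiple of w is in L^p, so a functional can be studied through φ ↦ l(φw) with φ bounded. -/
theorem exists_pos_memLp (μ : Measure α) [SigmaFinite μ] (hp0 : p ≠ 0) (hp : p ≠ ∞) :
    ∃ w : α → ℝ, (∀ x, 0 < w x) ∧ Measurable w ∧ MemLp w p μ := by
  obtain ⟨g, hg0, hgm, hgi⟩ := exists_pos_lintegral_lt_of_sigmaFinite μ (ε := 1) one_ne_zero
  have hpr : 0 < p.toReal := ENNReal.toReal_pos hp0 hp
  have hm : Measurable fun x => ((g x : ℝ)) ^ (1 / p.toReal) := by fun_prop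
  refine ⟨fun x => (g x : ℝ) ^ (1 / p.toReal), fun x => Real.rpow_pos_of_pos (hg0 x) _, hm,
    hm.aestronglyMeasurable, ?_⟩
  rw [eLpNorm_lt_top_iff_lintegral_rpow_enorm_lt_top hp0 hp]
  refine lt_of_le_of_lt (le_of_eq (lintegral_congr fun x => ?_)) (hgi.trans ENNReal.one_lt_top)
  rw [Real.enorm_of_nonneg (by positivity), ENNReal.ofReal_rpow_of_nonneg (by positivity) hpr.le,
    ← Real.rpow_mul (by positivity)]
  simp [hpr.ne']

variable [Fact (1 ≤ p)]

open Classical in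
/-- The element `1_A w` of `L^p`. -/
def cutLp {w : α → ℝ} (hw : MemLp w p μ) (A : Set α) : Lp ℝ p μ :=
  if h : MeasurableSet A then (hw.indicator h).toLp _ else 0

omit [Fact (1 ≤ p)] in
theorem cutLp_of_measurableSet {w : α → ℝ} (hw : MemLp w p μ) {A : Set α} (hA : MeasurableSet A) :
    cutLp hw A = (hw.indicator hA).toLp _ := dif_pos hA

omit [Fact (1 ≤ p)] in
theorem cutLp_eq_zero {w : α → ℝ} (hw : MemLp w p μ) {A : Set α} (hA0 : μ A = 0) :
    cutLp hw A = 0 := by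
  by_cases hA : MeasurableSet A
  · rw [cutLp_of_measurableSet hw hA, ← MemLp.toLp_zero (E := ℝ) (p := p) (μ := μ) MemLp.zero]
    refine MemLp.toLp_congr _ _ ?_
    filter_upwards [measure_eq_zero_iff_ae_notMem.1 hA0] with x h3
    rw [indicator_of_notMem h3, Pi.zero_apply]
  · exact dif_neg hA

omit [Fact (1 ≤ p)] in
theorem sum_cutLp {w : α → ℝ} (hw : MemLp w p μ) {A : ℕ → Set α} (hA : ∀ i, MeasurableSet (A i))
    (hd : Pairwise (Function.onFun Disjoint A)) (s : Finset ℕ) :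
    ∑ i ∈ s, cutLp hw (A i) = cutLp hw (⋃ i ∈ s, A i) := by
  have hB : ∀ s : Finset ℕ, MeasurableSet (⋃ i ∈ s, A i) := fun s =>
    s.measurableSet_biUnion fun i _ => hA i
  induction s using Finset.induction_on with
  | empty => simp [cutLp_eq_zero]
  | insert a s has ih =>
    rw [Finset.sum_insert has, ih, cutLp_of_measurableSet hw (hA a), cutLp_of_measurableSet hw (hB s),
      cutLp_of_measurableSet hw (hB _), ← MemLp.toLp_add]
    congr 1
    rw [Finset.set_biUnion_insert]
    refine (Set.indicator_union_of_disjoint ?_ w).symm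
    exact Set.disjoint_iUnion₂_right.2 fun i hi => hd (fun h => has (h ▸ hi))

/-- Dominated convergence along the finite subsets of the index set, with majorant |w|; this is
where p < ∞ enters the duality. -/
theorem hasSum_cutLp (hp : p ≠ ∞) {w : α → ℝ} (hw : MemLp w p μ) {A : ℕ → Set α}
    (hA : ∀ i, MeasurableSet (A i)) (hd : Pairwise (Function.onFun Disjoint A)) :
    HasSum (fun i => cutLp hw (A i)) (cutLp hw (⋃ i, A i)) := by
  have hp0 : p ≠ 0 := (zero_lt_one.trans_le (Fact.out : 1 ≤ p)).ne'
  have hU := MeasurableSet.iUnion hA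
  have hB : ∀ s : Finset ℕ, MeasurableSet (⋃ i ∈ s, A i) := fun s =>
    s.measurableSet_biUnion fun i _ => hA i
  rw [HasSum, SummationFilter.unconditional_filter]
  simp_rw [sum_cutLp hw hA hd, cutLp_of_measurableSet hw (hB _), cutLp_of_measurableSet hw hU]
  rw [Lp.tendsto_Lp_iff_tendsto_eLpNorm'']
  refine tendsto_eLpNorm_sub_of_dominated (b := fun x => ‖w x‖) hp0 hp
    (fun s => (hw.indicator (hB s)).1) hw.norm ?_ (hw.indicator hU).1 ?_ ?_
  · exact Eventually.of_forall fun s => Eventually.of_forall fun x =>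
      norm_indicator_le_norm_self _ _
  · exact Eventually.of_forall fun x => norm_indicator_le_norm_self _ _
  · refine Eventually.of_forall fun x => ?_
    by_cases hx : x ∈ ⋃ i, A i
    · obtain ⟨i, hi⟩ := mem_iUnion.1 hx
      refine tendsto_const_nhds.congr' ?_
      filter_upwards [eventually_ge_atTop {i}] with s hs
      have : x ∈ ⋃ i ∈ s, A i := mem_biUnion (hs (Finset.mem_singleton_self i)) hi
      rw [indicator_of_mem hx, indicator_of_mem this]
    · have : ∀ s : Finset ℕ, x ∉ ⋃ i ∈ s, A i := fun s h => by
        obtain ⟨i, -, hi⟩ := mem_iUnion₂.1 h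
        exact hx (mem_iUnion.2 ⟨i, hi⟩)
      simp only [indicator_of_notMem hx, indicator_of_notMem (this _)]
      exact tendsto_const_nhds

/-- The signed measure `A ↦ l (1_A w)` of a functional `l` on `L^p` and `w ∈ L^p`. -/
def dualMeasure (hp : p ≠ ∞) (l : StrongDual ℝ (Lp ℝ p μ)) {w : α → ℝ} (hw : MemLp w p μ) :
    SignedMeasure α where
  measureOf' := fun A => l (cutLp hw A)
  empty' := by rw [cutLp_eq_zero hw measure_empty, map_zero]
  -- This field is the reason for the default value 0 of `cutLp` on nonmeasurable sets.
  not_measurable' := fun A hA => by rw [cutLp, dif_neg hA, map_zero]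
  m_iUnion' := fun A hA hd => (hasSum_cutLp hp hw hA hd).mapL l

theorem dualMeasure_apply (hp : p ≠ ∞) (l : StrongDual ℝ (Lp ℝ p μ)) {w : α → ℝ} (hw : MemLp w p μ)
    (A : Set α) : dualMeasure hp l hw A = l (cutLp hw A) := rfl

omit [Fact (1 ≤ p)] in
theorem memLp_mul_of_bound {w φ : α → ℝ} (hw : MemLp w p μ) (hφ : StronglyMeasurable φ) {C : ℝ}
    (hC : ∀ x, ‖φ x‖ ≤ C) : MemLp (fun x => φ x * w x) p μ := by
  refine (hw.const_mul C).mono (hφ.aestronglyMeasurable.mul hw.1) (Eventually.of_forall fun x => ?_)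
  rw [norm_mul, norm_mul]
  exact mul_le_mul_of_nonneg_right ((hC x).trans (le_abs_self C)) (norm_nonneg _)

/-- The signed measure A ↦ l(1_A w) is absolutely continuous, and h is its Radon–Nikodym derivative.
The formula passes from indicators to simple functions by linearity, and to bounded functions by
dominated convergence on both sides. -/
theorem exists_density_bounded (hp : p ≠ ∞) [SigmaFinite μ] (l : StrongDual ℝ (Lp ℝ p μ))
    {w : α → ℝ} (hw : MemLp w p μ) :
    ∃ h : α → ℝ, Measurable h ∧ Integrable h μ ∧ ∀ (φ : α → ℝ) (hφ : StronglyMeasurable φ) (C : ℝ)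
      (hC : ∀ x, ‖φ x‖ ≤ C),
      l ((memLp_mul_of_bound hw hφ hC).toLp _) = ∫ x, φ x * h x ∂μ := by
  have hp0 : p ≠ 0 := (zero_lt_one.trans_le (Fact.out : 1 ≤ p)).ne'
  set s := dualMeasure hp l hw with hs
  have hac : s ≪ᵥ μ.toENNRealVectorMeasure := by
    refine VectorMeasure.AbsolutelyContinuous.mk fun A hA hA0 => ?_
    rw [Measure.toENNRealVectorMeasure_apply_measurable hA] at hA0
    rw [hs, dualMeasure_apply, cutLp_eq_zero hw hA0, map_zero]
  have hint := SignedMeasure.integrable_rnDeriv s μ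
  refine ⟨s.rnDeriv μ, SignedMeasure.measurable_rnDeriv s μ, hint, ?_⟩
  have hsA : ∀ A, MeasurableSet A → l (cutLp hw A) = ∫ x in A, s.rnDeriv μ x ∂μ := by
    intro A hA
    rw [← withDensityᵥ_apply hint hA, SignedMeasure.withDensityᵥ_rnDeriv_eq s μ hac, hs,
      dualMeasure_apply]
  have hsimple : ∀ (φ : SimpleFunc α ℝ) (C : ℝ) (hC : ∀ x, ‖φ x‖ ≤ C),
      l ((memLp_mul_of_bound hw φ.stronglyMeasurable hC).toLp _) = ∫ x, φ x * s.rnDeriv μ x ∂μ := by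
    intro φ
    induction φ using SimpleFunc.induction with
    | const c hA =>
      intro C hC
      rename_i A
      have : (memLp_mul_of_bound hw (SimpleFunc.stronglyMeasurable _) hC).toLp _
          = c • cutLp hw A := by
        rw [cutLp_of_measurableSet hw hA, ← MemLp.toLp_const_smul]
        congr 1
        ext x
        by_cases hx : x ∈ A <;> simp [hx]
      rw [this, map_smul, hsA A hA, smul_eq_mul, ← integral_const_mul, ← integral_indicator hA]
      congr 1
      ext x
      by_cases hx : x ∈ A <;> simp [hx]
    | @add f g _ hf hg =>
      intro C hC
      obtain ⟨Cf, hCf⟩ := f.exists_forall_norm_le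
      obtain ⟨Cg, hCg⟩ := g.exists_forall_norm_le
      have : (memLp_mul_of_bound hw (SimpleFunc.stronglyMeasurable _) hC).toLp _
          = ((memLp_mul_of_bound hw f.stronglyMeasurable hCf).toLp _ : Lp ℝ p μ)
            + (memLp_mul_of_bound hw g.stronglyMeasurable hCg).toLp _ := by
        rw [← MemLp.toLp_add]
        congr 1
        ext x
        simp [add_mul]
      rw [this, map_add, hf Cf hCf, hg Cg hCg, ← integral_add]
      · congr 1
        ext x
        simp [add_mul]
      · exact hint.bdd_mul f.stronglyMeasurable.aestronglyMeasurable (Eventually.of_forall hCf)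
      · exact hint.bdd_mul g.stronglyMeasurable.aestronglyMeasurable (Eventually.of_forall hCg)
  intro φ hφ C hC
  -- Approximation by bounded simple functions needs 0 ≤ C, which is read off at a point of α.
  by_cases hα : IsEmpty α
  · have : μ = 0 := Measure.eq_zero_of_isEmpty μ
    subst this
    rw [integral_zero_measure]
    have : (memLp_mul_of_bound hw hφ hC).toLp _ = (0 : Lp ℝ p (0 : Measure α)) := by
      rw [Lp.eq_zero_iff_ae_eq_zero, ae_zero]; exact eventually_bot
    rw [this, map_zero]
  rw [not_isEmpty_iff] at hα
  have hC0 : 0 ≤ C := (norm_nonneg _).trans (hC hα.some)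
  have hb := fun n x => StronglyMeasurable.norm_approxBounded_le hφ hC0 n x
  have ht := fun x => StronglyMeasurable.tendsto_approxBounded_of_norm_le hφ (hC x)
  have h1 : Tendsto (fun n => l ((memLp_mul_of_bound hw
      (hφ.approxBounded C n).stronglyMeasurable (hb n)).toLp _)) atTop
      (𝓝 (l ((memLp_mul_of_bound hw hφ hC).toLp _))) := by
    refine (l.continuous.tendsto _).comp ?_
    rw [Lp.tendsto_Lp_iff_tendsto_eLpNorm'']
    refine tendsto_eLpNorm_sub_of_dominated (b := fun x => C * ‖w x‖) hp0 hp
      (fun n => (memLp_mul_of_bound hw (hφ.approxBounded C n).stronglyMeasurable (hb n)).1)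
      (hw.norm.const_mul C) ?_ (memLp_mul_of_bound hw hφ hC).1 ?_ ?_
    · refine Eventually.of_forall fun n => Eventually.of_forall fun x => ?_
      rw [norm_mul]
      exact mul_le_mul_of_nonneg_right (hb n x) (norm_nonneg _)
    · refine Eventually.of_forall fun x => ?_
      rw [norm_mul]
      exact mul_le_mul_of_nonneg_right (hC x) (norm_nonneg _)
    · exact Eventually.of_forall fun x => (ht x).mul_const _
  have h2 : Tendsto (fun n => ∫ x, hφ.approxBounded C n x * s.rnDeriv μ x ∂μ) atTop
      (𝓝 (∫ x, φ x * s.rnDeriv μ x ∂μ)) := by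
    refine tendsto_integral_of_dominated_convergence (fun x => C * ‖s.rnDeriv μ x‖) ?_ ?_ ?_ ?_
    · exact fun n => (hφ.approxBounded C n).stronglyMeasurable.aestronglyMeasurable.mul hint.1
    · exact hint.norm.const_mul C
    · refine fun n => Eventually.of_forall fun x => ?_
      rw [norm_mul]
      exact mul_le_mul_of_nonneg_right (hb n x) (norm_nonneg _)
    · exact Eventually.of_forall fun x => (ht x).mul_const _
  refine tendsto_nhds_unique h1 (h2.congr fun n => ?_)
  exact (hsimple _ C (hb n)).symm

end Riesz

/-! ### Duality of L^p and L^q, and weak sequential compactness -/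

section Riesz

variable {α : Type*} [MeasurableSpace α] {μ : Measure α} {p q : ℝ≥0∞}

/-- The converse of Hölder. With g = h/w, test l on sign(g)|g|^(q-1) cut off to A_n. If I_n is the
integral of |g|^q over A_n, this gives I_n ≤ ‖l‖ I_n^(1/p), hence I_n ≤ ‖l‖^q, and Fatou removes the
cutoff. -/
theorem lintegral_rpow_lt_top_of_dual [Fact (1 ≤ p)] (hpq : p.toReal.HolderConjugate q.toReal)
    (hp0 : p ≠ 0) (hp : p ≠ ∞) (l : StrongDual ℝ (Lp ℝ p μ)) {w h : α → ℝ} (hw0 : ∀ x, 0 < w x)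
    (hwm : Measurable w) (hw : MemLp w p μ) (hm : Measurable h) (hint : Integrable h μ)
    (hrep : ∀ (φ : α → ℝ) (hφ : StronglyMeasurable φ) (C : ℝ) (hC : ∀ x, ‖φ x‖ ≤ C),
      l ((memLp_mul_of_bound hw hφ hC).toLp _) = ∫ x, φ x * h x ∂μ) :
    ∫⁻ x, ‖h x / w x‖ₑ ^ q.toReal ∂μ < ∞ := by
  set r := p.toReal
  set r' := q.toReal
  have hr : 0 < r := hpq.pos
  have hr' : 0 < r' := hpq.symm.pos
  set g : α → ℝ := fun x => h x / w x with hg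
  have hgm : Measurable g := hm.div hwm
  -- On this set the test function divided by w is bounded by n, so the representation for bounded
  -- multiples of w applies; the sets exhaust α because w > 0.
  let A : ℕ → Set α := fun n => {x | |g x| ^ (r' - 1) ≤ n * w x}
  have hA : ∀ n, MeasurableSet (A n) := fun n =>
    measurableSet_le ((hgm.norm).pow_const _) (hwm.const_mul _)
  let φ : ℕ → α → ℝ := fun n => (A n).indicator fun x => SignType.sign (g x) * |g x| ^ (r' - 1) / w x
  have hsign : ∀ x, |((SignType.sign (g x) : SignType) : ℝ)| ≤ 1 := fun x => by
    rcases lt_trichotomy (g x) 0 with h | h | h <;> simp [h]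
  have hφm : ∀ n, StronglyMeasurable (φ n) := fun n => by
    refine Measurable.stronglyMeasurable (Measurable.indicator ?_ (hA n))
    refine ((Measurable.mul ?_ ((hgm.norm).pow_const _)).div hwm)
    have : (fun x => ((SignType.sign (g x) : SignType) : ℝ))
        = fun x => if 0 < g x then 1 else if g x < 0 then -1 else 0 := by
      ext x
      rcases lt_trichotomy (g x) 0 with h | h | h
      · simp [h, h.not_gt]
      · simp [h]
      · simp [h]
    rw [this]
    exact Measurable.ite (measurableSet_lt measurable_const hgm) measurable_const
      (Measurable.ite (measurableSet_lt hgm measurable_const) measurable_const measurable_const)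
  have hφb : ∀ n x, ‖φ n x‖ ≤ n := fun n x => by
    by_cases hx : x ∈ A n
    · simp only [φ, indicator_of_mem hx]
      rw [Real.norm_eq_abs, abs_div, abs_mul, abs_of_pos (hw0 x), div_le_iff₀ (hw0 x),
        abs_of_nonneg (Real.rpow_nonneg (abs_nonneg (g x)) _)]
      calc _ ≤ 1 * |g x| ^ (r' - 1) :=
            mul_le_mul_of_nonneg_right (hsign x) (Real.rpow_nonneg (abs_nonneg _) _)
        _ ≤ n * w x := by rw [one_mul]; exact hx
    · simp [φ, indicator_of_notMem hx]
  have hpow : ∀ x, |g x| ^ (r' - 1) * |g x| = |g x| ^ r' := fun x => by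
    by_cases hx : g x = 0
    · simp [hx, hr'.ne']
    · conv_rhs => rw [show r' = (r' - 1) + 1 by ring, Real.rpow_add (abs_pos.2 hx), Real.rpow_one]
  have hφh : ∀ n x, φ n x * h x = (A n).indicator (fun x => |g x| ^ r') x := fun n x => by
    by_cases hx : x ∈ A n
    · simp only [φ, indicator_of_mem hx]
      have e : h x = g x * w x := by simp [hg, (hw0 x).ne']
      rw [e, ← hpow x]
      have e2 : ((SignType.sign (g x) : SignType) : ℝ) * g x = |g x| := sign_mul_self _
      rw [← e2]
      field_simp [(hw0 x).ne']
    · simp [φ, indicator_of_notMem hx]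
  have hφw : ∀ n x, ‖φ n x * w x‖ₑ ^ r ≤ ENNReal.ofReal ((A n).indicator (fun x => |g x| ^ r') x) :=
    fun n x => by
    rw [← ofReal_norm, ENNReal.ofReal_rpow_of_nonneg (norm_nonneg _) hr.le]
    refine ENNReal.ofReal_le_ofReal ?_
    by_cases hx : x ∈ A n
    · simp only [φ, indicator_of_mem hx]
      rw [div_mul_cancel₀ _ (hw0 x).ne', Real.norm_eq_abs, abs_mul,
        abs_of_nonneg (Real.rpow_nonneg (abs_nonneg (g x)) _)]
      calc _ ≤ (1 * |g x| ^ (r' - 1)) ^ r := by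
            refine Real.rpow_le_rpow (by positivity) ?_ hr.le
            exact mul_le_mul_of_nonneg_right (hsign x) (by positivity)
        _ = |g x| ^ r' := by
          rw [one_mul, ← Real.rpow_mul (abs_nonneg _)]
          congr 1
          have := hpq.symm.mul_eq_add
          linarith [this, mul_comm r' r]
    · simp [φ, indicator_of_notMem hx, hr.ne']
  let I : ℕ → ℝ := fun n => ∫ x, (A n).indicator (fun x => |g x| ^ r') x ∂μ
  have hIint : ∀ n, Integrable (fun x => (A n).indicator (fun x => |g x| ^ r') x) μ := fun n => by
    simp_rw [← hφh]
    exact hint.bdd_mul (hφm n).aestronglyMeasurable (Eventually.of_forall (hφb n))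
  have hI0 : ∀ n, 0 ≤ I n := fun n => integral_nonneg fun x =>
    indicator_nonneg (fun x _ => by positivity) x
  have hIl : ∀ n, ENNReal.ofReal (I n)
      = ∫⁻ x, ENNReal.ofReal ((A n).indicator (fun x => |g x| ^ r') x) ∂μ := fun n =>
    ofReal_integral_eq_lintegral_ofReal (hIint n)
      (Eventually.of_forall fun x => indicator_nonneg (fun x _ => by positivity) x)
  have hIle : ∀ n, I n ≤ ‖l‖ ^ r' := fun n => by
    have h1 : I n ≤ ‖l‖ * (I n) ^ (1 / r) := by
      have e : I n = l ((memLp_mul_of_bound hw (hφm n) (hφb n)).toLp _) := by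
        rw [hrep _ (hφm n) _ (hφb n)]; simp_rw [hφh]; rfl
      have e2 : ‖((memLp_mul_of_bound hw (hφm n) (hφb n)).toLp _ : Lp ℝ p μ)‖ ≤ (I n) ^ (1 / r) := by
        rw [Lp.norm_toLp]
        refine ENNReal.toReal_le_of_le_ofReal (Real.rpow_nonneg (hI0 n) _) ?_
        rw [← ENNReal.ofReal_rpow_of_nonneg (hI0 n) (by positivity),
          eLpNorm_eq_lintegral_rpow_enorm_toReal hp0 hp, hIl]
        exact ENNReal.rpow_le_rpow (lintegral_mono (hφw n)) (by positivity)
      calc I n ≤ ‖l ((memLp_mul_of_bound hw (hφm n) (hφb n)).toLp _)‖ := by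
            rw [← e]; exact le_abs_self _
        _ ≤ ‖l‖ * _ := l.le_opNorm _
        _ ≤ _ := mul_le_mul_of_nonneg_left e2 (norm_nonneg _)
    rcases (hI0 n).eq_or_lt with h0 | h0
    · rw [← h0]; positivity
    · have h2 : (I n) ^ (1 / r') ≤ ‖l‖ := by
        have e : I n = I n ^ (1 / r') * I n ^ (1 / r) := by
          rw [← Real.rpow_add h0]
          have := hpq.inv_add_inv_eq_one
          rw [one_div, one_div, add_comm, this, Real.rpow_one]
        rw [e] at h1
        rw [← e] at h1
        have hpos : 0 < I n ^ (1 / r) := Real.rpow_pos_of_pos h0 _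
        exact le_of_mul_le_mul_right (e ▸ h1) hpos
      calc I n = (I n ^ (1 / r')) ^ r' := by
            rw [← Real.rpow_mul (hI0 n), one_div_mul_cancel hr'.ne', Real.rpow_one]
        _ ≤ _ := Real.rpow_le_rpow (by positivity) h2 hr'.le
  have hlim : ∀ x, ‖g x‖ₑ ^ r'
      ≤ liminf (fun n => ENNReal.ofReal ((A n).indicator (fun x => |g x| ^ r') x)) atTop := fun x => by
    obtain ⟨N, hN⟩ := exists_nat_ge (|g x| ^ (r' - 1) / w x)
    have : ∀ᶠ n : ℕ in atTop, ENNReal.ofReal ((A n).indicator (fun x => |g x| ^ r') x)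
        = ‖g x‖ₑ ^ r' := by
      filter_upwards [eventually_ge_atTop N] with n hn
      have hx : x ∈ A n := by
        change |g x| ^ (r' - 1) ≤ n * w x
        rw [← div_le_iff₀ (hw0 x)]
        exact hN.trans (by exact_mod_cast hn)
      rw [indicator_of_mem hx, ← ofReal_norm,
        ENNReal.ofReal_rpow_of_nonneg (norm_nonneg _) hr'.le, Real.norm_eq_abs]
    rw [liminf_congr this, liminf_const]
  calc ∫⁻ x, ‖g x‖ₑ ^ r' ∂μ
      ≤ ∫⁻ x, liminf (fun n => ENNReal.ofReal ((A n).indicator (fun x => |g x| ^ r') x)) atTop ∂μ :=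
        lintegral_mono hlim
    _ ≤ liminf (fun n => ∫⁻ x, ENNReal.ofReal ((A n).indicator (fun x => |g x| ^ r') x) ∂μ) atTop :=
        lintegral_liminf_le fun n => (((hgm.norm).pow_const _).indicator (hA n)).ennreal_ofReal
    _ ≤ ENNReal.ofReal (‖l‖ ^ r') := by
        simp_rw [← hIl]
        refine (liminf_le_liminf (Eventually.of_forall fun n =>
          ENNReal.ofReal_le_ofReal (hIle n))).trans ?_
        rw [liminf_const]
    _ < ∞ := ENNReal.ofReal_lt_top

/-- The pairing `(f, g) ↦ ∫ f g` between `L^p` and `L^q`. -/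
abbrev pairing (μ : Measure α) (p q : ℝ≥0∞) [Fact (1 ≤ p)] [Fact (1 ≤ q)]
    [ENNReal.HolderConjugate p q] : Lp ℝ p μ →L[ℝ] Lp ℝ q μ →L[ℝ] ℝ :=
  (ContinuousLinearMap.mul ℝ ℝ).lpPairing μ p q

theorem pairing_apply [Fact (1 ≤ p)] [Fact (1 ≤ q)] [ENNReal.HolderConjugate p q]
    (f : Lp ℝ p μ) (g : Lp ℝ q μ) : pairing μ p q f g = ∫ x, f x * g x ∂μ :=
  ContinuousLinearMap.lpPairing_eq_integral _ f g

/-- The density is h/w. Cutting f off where |f| ≤ n w makes it a bounded multiple of w, and both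
sides of the representation converge as n grows. -/
theorem exists_pairing_eq [SigmaFinite μ] [Fact (1 ≤ p)] [Fact (1 ≤ q)]
    [ENNReal.HolderConjugate p q] (hp1 : 1 < p) (hp : p ≠ ∞)
    (l : StrongDual ℝ (Lp ℝ p μ)) : ∃ g : Lp ℝ q μ, ∀ f, l f = pairing μ p q f g := by
  have hp0 : p ≠ 0 := (zero_lt_one.trans hp1).ne'
  have hq0 : q ≠ 0 := ENNReal.HolderConjugate.ne_zero q p
  have hq : q ≠ ∞ := ((ENNReal.HolderConjugate.lt_top_iff_one_lt q p).2 hp1).ne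
  have hpr : 1 < p.toReal := by
    rw [← ENNReal.toReal_one]
    exact (ENNReal.toReal_lt_toReal ENNReal.one_ne_top hp).2 hp1
  have hpq := ENNReal.HolderConjugate.toReal (q := q) hpr
  obtain ⟨w, hw0, hwm, hw⟩ := exists_pos_memLp μ hp0 hp
  obtain ⟨h, hm, hint, hrep⟩ := exists_density_bounded hp l hw
  have hg : MemLp (fun x => h x / w x) q μ := ⟨(hm.div hwm).aestronglyMeasurable,
    (eLpNorm_lt_top_iff_lintegral_rpow_enorm_lt_top hq0 hq).2
      (lintegral_rpow_lt_top_of_dual hpq hp0 hp l hw0 hwm hw hm hint hrep)⟩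
  refine ⟨hg.toLp _, fun f => ?_⟩
  rw [pairing_apply]
  have e : ∫ x, f x * (hg.toLp _ : Lp ℝ q μ) x ∂μ = ∫ x, f x * (h x / w x) ∂μ :=
    integral_congr_ae (by filter_upwards [hg.coeFn_toLp] with x hx; rw [hx])
  rw [e]
  have hfm : StronglyMeasurable f := Lp.stronglyMeasurable f
  let A : ℕ → Set α := fun n => {x | |f x| ≤ n * w x}
  have hA : ∀ n, MeasurableSet (A n) := fun n =>
    measurableSet_le hfm.measurable.norm (hwm.const_mul _)
  let φ : ℕ → α → ℝ := fun n => (A n).indicator fun x => f x / w x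
  have hφm : ∀ n, StronglyMeasurable (φ n) := fun n =>
    ((hfm.measurable.div hwm).indicator (hA n)).stronglyMeasurable
  have hφb : ∀ n x, ‖φ n x‖ ≤ n := fun n x => by
    by_cases hx : x ∈ A n
    · simp only [φ, indicator_of_mem hx]
      rw [Real.norm_eq_abs, abs_div, abs_of_pos (hw0 x), div_le_iff₀ (hw0 x)]
      exact hx
    · simp [φ, indicator_of_notMem hx]
  have hev : ∀ x, ∀ᶠ n : ℕ in atTop, x ∈ A n := fun x => by
    obtain ⟨N, hN⟩ := exists_nat_ge (|f x| / w x)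
    filter_upwards [eventually_ge_atTop N] with n hn
    change |f x| ≤ n * w x
    rw [← div_le_iff₀ (hw0 x)]
    exact hN.trans (by exact_mod_cast hn)
  have hφw : ∀ n x, φ n x * w x = (A n).indicator f x := fun n x => by
    by_cases hx : x ∈ A n
    · simp [φ, indicator_of_mem hx, (hw0 x).ne']
    · simp [φ, indicator_of_notMem hx]
  have hφh : ∀ n x, φ n x * h x = (A n).indicator (fun x => f x * (h x / w x)) x := fun n x => by
    by_cases hx : x ∈ A n
    · simp only [φ, indicator_of_mem hx]; ring
    · simp [φ, indicator_of_notMem hx]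
  have h1 : Tendsto (fun n => l ((memLp_mul_of_bound hw (hφm n) (hφb n)).toLp _)) atTop
      (𝓝 (l f)) := by
    refine (l.continuous.tendsto _).comp ?_
    conv => enter [3, 1]; rw [← Lp.toLp_coeFn f (Lp.memLp f)]
    rw [Lp.tendsto_Lp_iff_tendsto_eLpNorm'']
    refine tendsto_eLpNorm_sub_of_dominated (b := fun x => ‖f x‖) hp0 hp
      (fun n => (memLp_mul_of_bound hw (hφm n) (hφb n)).1) (Lp.memLp f).norm ?_ (Lp.memLp f).1
      (Eventually.of_forall fun x => le_rfl) ?_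
    · refine Eventually.of_forall fun n => Eventually.of_forall fun x => ?_
      rw [hφw]; exact norm_indicator_le_norm_self _ _
    · refine Eventually.of_forall fun x => tendsto_const_nhds.congr' ?_
      filter_upwards [hev x] with n hn
      rw [hφw, indicator_of_mem hn]
  have h2 : Tendsto (fun n => ∫ x, φ n x * h x ∂μ) atTop (𝓝 (∫ x, f x * (h x / w x) ∂μ)) := by
    have hi : Integrable (fun x => f x * (h x / w x)) μ := (Lp.memLp f).integrable_mul hg
    refine tendsto_integral_of_dominated_convergence (fun x => ‖f x * (h x / w x)‖)
      (fun n => (hφm n).aestronglyMeasurable.mul hint.1) hi.norm ?_ ?_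
    · refine fun n => Eventually.of_forall fun x => ?_
      rw [hφh]; exact norm_indicator_le_norm_self _ _
    · refine Eventually.of_forall fun x => tendsto_const_nhds.congr' ?_
      filter_upwards [hev x] with n hn
      rw [hφh, indicator_of_mem hn]
  refine tendsto_nhds_unique h1 (h2.congr fun n => ?_)
  rw [hrep _ (hφm n) _ (hφb n)]

/-- Reflexivity by hand. The f_n act on the separable space L^q, so a subsequence converges weak-*;
duality for q represents the limit by some U in L^p, and duality for p shows that testing against
L^q exhausts all functionals on L^p. -/
theorem exists_weakTendsto_subseq [SigmaFinite μ] [Fact (1 ≤ p)] [Fact (1 ≤ q)]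
    [ENNReal.HolderConjugate p q] (hp1 : 1 < p) (hp : p ≠ ∞)
    [TopologicalSpace.SeparableSpace (Lp ℝ q μ)] {f : ℕ → Lp ℝ p μ} {C : ℝ}
    (hf : ∀ n, ‖f n‖ ≤ C) :
    ∃ σ : ℕ → ℕ, StrictMono σ ∧ ∃ U : Lp ℝ p μ, WeakTendsto (fun n => f (σ n)) U := by
  have hq1 : 1 < q := (ENNReal.HolderConjugate.lt_top_iff_one_lt p q).1 hp.lt_top
  have hq : q ≠ ∞ := ((ENNReal.HolderConjugate.lt_top_iff_one_lt q p).2 hp1).ne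
  have hsc := WeakDual.isSeqCompact_closedBall ℝ (Lp ℝ q μ) 0 (‖pairing μ p q‖ * C)
  obtain ⟨Φ, -, σ, hσ, hΦ⟩ := hsc (x := fun n => StrongDual.toWeakDual (pairing μ p q (f n)))
    (fun n => by
      simp only [mem_preimage, Metric.mem_closedBall, dist_zero_right]
      exact ((pairing μ p q).le_opNorm (f n)).trans
        (mul_le_mul_of_nonneg_left (hf n) (norm_nonneg _)))
  obtain ⟨U, hU⟩ := exists_pairing_eq (p := q) (q := p) hq1 hq (WeakDual.toStrongDual Φ)
  refine ⟨σ, hσ, U, fun l => ?_⟩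
  obtain ⟨g, hg⟩ := exists_pairing_eq (p := p) (q := q) hp1 hp l
  have h1 := tendsto_iff_forall_eval_tendsto_topDualPairing.1 hΦ g
  have h2 : l U = WeakDual.toStrongDual Φ g := by
    rw [hg, hU, pairing_apply, pairing_apply]
    simp_rw [mul_comm]
  rw [h2]
  simp_rw [hg]
  exact h1

theorem exists_weakTendsto_subseq_finite [SigmaFinite μ] [Fact (1 ≤ p)] [Fact (1 ≤ q)]
    [ENNReal.HolderConjugate p q] (hp1 : 1 < p) (hp : p ≠ ∞)
    [TopologicalSpace.SeparableSpace (Lp ℝ q μ)] {ι : Type*} (s : Finset ι)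
    {f : ι → ℕ → Lp ℝ p μ} {C : ι → ℝ} (hf : ∀ i n, ‖f i n‖ ≤ C i) :
    ∃ σ : ℕ → ℕ, StrictMono σ ∧
      ∀ i ∈ s, ∃ U : Lp ℝ p μ, WeakTendsto (fun n => f i (σ n)) U := by
  classical
  induction s using Finset.induction_on with
  | empty => exact ⟨id, strictMono_id, by simp⟩
  | insert a s _ ih =>
    obtain ⟨σ, hσ, h⟩ := ih
    obtain ⟨τ, hτ, U, hU⟩ := exists_weakTendsto_subseq (q := q) hp1 hp (f := fun n => f a (σ n))
      (fun n => hf a (σ n))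
    refine ⟨σ ∘ τ, hσ.comp hτ, fun i hi => ?_⟩
    rcases Finset.mem_insert.1 hi with rfl | hi
    · exact ⟨U, hU⟩
    · obtain ⟨V, hV⟩ := h i hi
      exact ⟨V, hV.comp hτ.tendsto_atTop⟩

end Riesz

/-! ### Spatial slices and tensor products -/

section Slice

variable {A B : Type*} [MeasurableSpace A] [MeasurableSpace B] {μ : Measure A} {ν : Measure B}
  {p q : ℝ≥0∞}

theorem lintegral_rpow_eq_eLpNorm {α : Type*} [MeasurableSpace α] {μ : Measure α} (hp0 : p ≠ 0)
    (hp : p ≠ ∞) (f : α → ℝ) :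
    ∫⁻ x, ‖f x‖ₑ ^ p.toReal ∂μ = eLpNorm f p μ ^ p.toReal := by
  rw [eLpNorm_eq_lintegral_rpow_enorm_toReal hp0 hp, ← ENNReal.rpow_mul, one_div_mul_cancel,
    ENNReal.rpow_one]
  exact (ENNReal.toReal_pos hp0 hp).ne'

theorem eLpNorm_le_of_lintegral_le {α β : Type*} [MeasurableSpace α] [MeasurableSpace β]
    {μ : Measure α} {ν : Measure β} (hp0 : p ≠ 0) (hp : p ≠ ∞) {f : α → ℝ} {g : β → ℝ} {C : ℝ≥0∞}
    (h : ∫⁻ x, ‖f x‖ₑ ^ p.toReal ∂μ ≤ C ^ p.toReal * ∫⁻ x, ‖g x‖ₑ ^ p.toReal ∂ν) :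
    eLpNorm f p μ ≤ C * eLpNorm g p ν := by
  have hpr := ENNReal.toReal_pos hp0 hp
  rw [lintegral_rpow_eq_eLpNorm hp0 hp, lintegral_rpow_eq_eLpNorm hp0 hp,
    ← ENNReal.mul_rpow_of_nonneg _ _ hpr.le] at h
  exact (ENNReal.rpow_le_rpow_iff hpr).1 h

theorem lintegral_eLpNorm_slice [SFinite ν] (hp0 : p ≠ 0) (hp : p ≠ ∞) {f : A × B → ℝ}
    (hf : StronglyMeasurable f) :
    ∫⁻ a, (eLpNorm (fun b => f (a, b)) p ν) ^ p.toReal ∂μ = eLpNorm f p (μ.prod ν) ^ p.toReal := by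
  rw [← lintegral_rpow_eq_eLpNorm hp0 hp, lintegral_prod _
    ((hf.measurable.enorm).pow_const _).aemeasurable]
  simp_rw [← lintegral_rpow_eq_eLpNorm hp0 hp]

theorem ae_memLp_slice [SFinite ν] (hp0 : p ≠ 0) (hp : p ≠ ∞) {f : A × B → ℝ}
    (hf : StronglyMeasurable f) (hfp : MemLp f p (μ.prod ν)) :
    ∀ᵐ a ∂μ, MemLp (fun b => f (a, b)) p ν := by
  have hpr := ENNReal.toReal_pos hp0 hp
  have h : ∫⁻ a, (eLpNorm (fun b => f (a, b)) p ν) ^ p.toReal ∂μ ≠ ∞ := by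
    rw [lintegral_eLpNorm_slice hp0 hp hf]
    exact ENNReal.rpow_ne_top_of_nonneg hpr.le hfp.eLpNorm_ne_top
  have hm : AEMeasurable (fun a => (eLpNorm (fun b => f (a, b)) p ν) ^ p.toReal) μ := by
    simp_rw [← lintegral_rpow_eq_eLpNorm hp0 hp]
    exact (Measurable.lintegral_prod_right' ((hf.measurable.enorm).pow_const _)).aemeasurable
  filter_upwards [ae_lt_top' hm h] with a ha
  refine ⟨(hf.comp_measurable measurable_prodMk_left).aestronglyMeasurable, ?_⟩
  rw [lt_top_iff_ne_top] at ha ⊢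
  intro h'
  rw [h', ENNReal.top_rpow_of_pos hpr] at ha
  exact ha rfl

variable [Fact (1 ≤ p)] [Fact (1 ≤ q)] [ENNReal.HolderConjugate p q]

omit [Fact (1 ≤ q)] in
-- Hölder in b for each fixed a, then Tonelli.
theorem eLpNorm_integral_mul_le [SFinite ν] (hp : p ≠ ∞) {f : A × B → ℝ}
    (hf : StronglyMeasurable f) {g : B → ℝ} (hg : AEStronglyMeasurable g ν) :
    eLpNorm (fun a => ∫ b, f (a, b) * g b ∂ν) p μ
      ≤ eLpNorm g q ν * eLpNorm f p (μ.prod ν) := by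
  have hp0 : p ≠ 0 := (zero_lt_one.trans_le (Fact.out : 1 ≤ p)).ne'
  have hpr := ENNReal.toReal_pos hp0 hp
  refine eLpNorm_le_of_lintegral_le hp0 hp ?_
  rw [lintegral_rpow_eq_eLpNorm hp0 hp f, ← lintegral_eLpNorm_slice hp0 hp hf, ← lintegral_const_mul]
  · refine lintegral_mono fun a => ?_
    rw [← ENNReal.mul_rpow_of_nonneg _ _ hpr.le]
    refine ENNReal.rpow_le_rpow ?_ hpr.le
    have hfa : AEStronglyMeasurable (fun b => f (a, b)) ν :=
      (hf.comp_measurable measurable_prodMk_left).aestronglyMeasurable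
    have h1 := eLpNorm_smul_le_mul_eLpNorm (p := q) (q := p) (r := 1) hfa hg
    refine le_trans ?_ h1
    rw [eLpNorm_one_eq_lintegral_enorm]
    refine (enorm_integral_le_lintegral_enorm _).trans (le_of_eq (lintegral_congr fun b => ?_))
    rw [Pi.smul_apply', smul_eq_mul, mul_comm]
  · simp_rw [← lintegral_rpow_eq_eLpNorm hp0 hp]
    exact (Measurable.lintegral_prod_right' ((hf.measurable.enorm).pow_const _))

omit [Fact (1 ≤ q)] in
theorem memLp_integral_mul [SFinite ν] (hp : p ≠ ∞) {f : A × B → ℝ} (hf : StronglyMeasurable f)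
    (hfp : MemLp f p (μ.prod ν)) {g : B → ℝ} (hg : MemLp g q ν) :
    MemLp (fun a => ∫ b, f (a, b) * g b ∂ν) p μ := by
  refine ⟨?_, (eLpNorm_integral_mul_le (q := q) hp hf hg.1).trans_lt
    (ENNReal.mul_lt_top hg.eLpNorm_lt_top hfp.eLpNorm_lt_top)⟩
  have : ∀ a, ∫ b, f (a, b) * g b ∂ν = ∫ b, f (a, b) * hg.1.mk g b ∂ν := fun a =>
    integral_congr_ae (by filter_upwards [hg.1.ae_eq_mk] with b hb; rw [hb])
  simp_rw [this]
  exact (StronglyMeasurable.integral_prod_right' (ν := ν)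
    (f := fun z : A × B => f z * hg.1.mk g z.2)
    (hf.mul (hg.1.stronglyMeasurable_mk.comp_measurable measurable_snd))).aestronglyMeasurable

omit [Fact (1 ≤ q)] in
theorem ae_integrable_slice [SFinite ν] (hp : p ≠ ∞) (f : Lp ℝ p (μ.prod ν)) (g : Lp ℝ q ν) :
    ∀ᵐ a ∂μ, Integrable (fun b => f (a, b) * g b) ν := by
  have hp0 : p ≠ 0 := (zero_lt_one.trans_le (Fact.out : 1 ≤ p)).ne'
  filter_upwards [ae_memLp_slice hp0 hp (Lp.stronglyMeasurable f) (Lp.memLp f)] with a ha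
  exact ha.integrable_mul (Lp.memLp g)

/-- Integration in the second variable against a weight: `(f, g) ↦ ∫ f(·, b) g(b)`. -/
def slice (μ : Measure A) (ν : Measure B) [SFinite ν] [Fact (p ≠ ∞)] :
    Lp ℝ p (μ.prod ν) →L[ℝ] Lp ℝ q ν →L[ℝ] Lp ℝ p μ :=
  LinearMap.mkContinuous₂
    (LinearMap.mk₂ ℝ (fun f g => (memLp_integral_mul (μ := μ) (q := q) (Fact.out : p ≠ ∞)
        (Lp.stronglyMeasurable f) (Lp.memLp f) (Lp.memLp g)).toLp _)
      (fun f f' g => by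
        rw [← MemLp.toLp_add]
        refine MemLp.toLp_congr _ _ ?_
        filter_upwards [ae_integrable_slice Fact.out f g, ae_integrable_slice Fact.out f' g,
          Measure.ae_ae_of_ae_prod (Lp.coeFn_add f f')] with a h1 h2 h3
        rw [Pi.add_apply, ← integral_add h1 h2]
        refine integral_congr_ae ?_
        filter_upwards [h3] with b hb
        rw [hb, Pi.add_apply, add_mul])
      (fun c f g => by
        rw [← MemLp.toLp_const_smul]
        refine MemLp.toLp_congr _ _ ?_
        filter_upwards [Measure.ae_ae_of_ae_prod (Lp.coeFn_smul c f)] with a h3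
        rw [Pi.smul_apply, ← integral_smul]
        refine integral_congr_ae ?_
        filter_upwards [h3] with b hb
        rw [hb, Pi.smul_apply, smul_eq_mul, smul_eq_mul, mul_assoc])
      (fun f g g' => by
        rw [← MemLp.toLp_add]
        refine MemLp.toLp_congr _ _ ?_
        filter_upwards [ae_integrable_slice Fact.out f g, ae_integrable_slice Fact.out f g'] with a h1 h2
        rw [Pi.add_apply, ← integral_add h1 h2]
        refine integral_congr_ae ?_
        filter_upwards [Lp.coeFn_add g g'] with b hb
        rw [hb, Pi.add_apply, mul_add])
      (fun c f g => by
        rw [← MemLp.toLp_const_smul]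
        refine MemLp.toLp_congr _ _ ?_
        refine Eventually.of_forall fun a => ?_
        simp only [Pi.smul_apply]
        rw [← integral_smul]
        refine integral_congr_ae ?_
        filter_upwards [Lp.coeFn_smul c g] with b hb
        rw [hb, Pi.smul_apply, smul_eq_mul, smul_eq_mul, mul_left_comm]))
    1 (fun f g => by
      simp only [LinearMap.mk₂_apply, one_mul]
      rw [Lp.norm_toLp, Lp.norm_def, Lp.norm_def, ← ENNReal.toReal_mul, mul_comm]
      exact ENNReal.toReal_mono (ENNReal.mul_ne_top (Lp.eLpNorm_ne_top _) (Lp.eLpNorm_ne_top _))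
        (eLpNorm_integral_mul_le Fact.out (Lp.stronglyMeasurable f) (Lp.memLp g).1))

theorem norm_slice_le [SFinite ν] [Fact (p ≠ ∞)] (f : Lp ℝ p (μ.prod ν)) (g : Lp ℝ q ν) :
    ‖slice μ ν f g‖ ≤ ‖f‖ * ‖g‖ := by
  have h1 : ‖slice (p := p) (q := q) μ ν‖ ≤ 1 := LinearMap.mkContinuous₂_norm_le _ zero_le_one _
  refine ((slice μ ν).le_opNorm₂ f g).trans (mul_le_mul_of_nonneg_right ?_ (norm_nonneg g))
  exact mul_le_of_le_one_left (norm_nonneg f) h1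

theorem coeFn_slice [SFinite ν] [Fact (p ≠ ∞)] (f : Lp ℝ p (μ.prod ν)) (g : Lp ℝ q ν) :
    slice μ ν f g =ᵐ[μ] fun a => ∫ b, f (a, b) * g b ∂ν :=
  (memLp_integral_mul (μ := μ) (q := q) (Fact.out : p ≠ ∞)
    (Lp.stronglyMeasurable f) (Lp.memLp f) (Lp.memLp g)).coeFn_toLp

omit [Fact (1 ≤ q)] [ENNReal.HolderConjugate p q] [Fact (1 ≤ p)] in
theorem lintegral_enorm_tensor [SFinite μ] [SFinite ν] (r : ℝ) (hr : 0 ≤ r) {φ : A → ℝ} {η : B → ℝ}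
    (hφ : AEStronglyMeasurable φ μ) (hη : AEStronglyMeasurable η ν) :
    ∫⁻ z, ‖φ z.1 * η z.2‖ₑ ^ r ∂(μ.prod ν) = (∫⁻ a, ‖φ a‖ₑ ^ r ∂μ) * ∫⁻ b, ‖η b‖ₑ ^ r ∂ν := by
  rw [← lintegral_prod_mul (hφ.enorm.pow_const _) (hη.enorm.pow_const _)]
  refine lintegral_congr fun z => ?_
  rw [enorm_mul, ENNReal.mul_rpow_of_nonneg _ _ hr]

omit [Fact (1 ≤ q)] [ENNReal.HolderConjugate p q] in
theorem eLpNorm_tensor [SFinite μ] [SFinite ν] (hp : p ≠ ∞) {φ : A → ℝ} {η : B → ℝ}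
    (hφ : AEStronglyMeasurable φ μ) (hη : AEStronglyMeasurable η ν) :
    eLpNorm (fun z : A × B => φ z.1 * η z.2) p (μ.prod ν) = eLpNorm φ p μ * eLpNorm η p ν := by
  have hp0 : p ≠ 0 := (zero_lt_one.trans_le (Fact.out : 1 ≤ p)).ne'
  have hpr := ENNReal.toReal_pos hp0 hp
  rw [eLpNorm_eq_lintegral_rpow_enorm_toReal hp0 hp, lintegral_enorm_tensor _ hpr.le hφ hη,
    ENNReal.mul_rpow_of_nonneg _ _ (by positivity), eLpNorm_eq_lintegral_rpow_enorm_toReal hp0 hp,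
    eLpNorm_eq_lintegral_rpow_enorm_toReal hp0 hp]

omit [Fact (1 ≤ q)] [ENNReal.HolderConjugate p q] in
theorem memLp_tensor [SFinite μ] [SFinite ν] (hp : p ≠ ∞) {φ : A → ℝ} {η : B → ℝ}
    (hφ : MemLp φ p μ) (hη : MemLp η p ν) :
    MemLp (fun z : A × B => φ z.1 * η z.2) p (μ.prod ν) := by
  refine ⟨hφ.1.comp_fst.mul hη.1.comp_snd, ?_⟩
  rw [eLpNorm_tensor hp hφ.1 hη.1]
  exact ENNReal.mul_lt_top hφ.eLpNorm_lt_top hη.eLpNorm_lt_top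

omit [Fact (1 ≤ q)] [ENNReal.HolderConjugate p q] in
/-- The tensor product `(φ, η) ↦ φ(a) η(b)`. -/
def tensor (p : ℝ≥0∞) [Fact (1 ≤ p)] (μ : Measure A) (ν : Measure B) [SFinite μ] [SFinite ν]
    [Fact (p ≠ ∞)] : Lp ℝ p μ →L[ℝ] Lp ℝ p ν →L[ℝ] Lp ℝ p (μ.prod ν) :=
  LinearMap.mkContinuous₂
    (LinearMap.mk₂ ℝ (fun φ η =>
        (memLp_tensor (Fact.out : p ≠ ∞) (Lp.memLp φ) (Lp.memLp η)).toLp _)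
      (fun φ φ' η => by
        rw [← MemLp.toLp_add]
        refine MemLp.toLp_congr _ _ ?_
        filter_upwards [Measure.quasiMeasurePreserving_fst.ae (Lp.coeFn_add φ φ')] with z h
        rw [h, Pi.add_apply, Pi.add_apply, add_mul])
      (fun c φ η => by
        rw [← MemLp.toLp_const_smul]
        refine MemLp.toLp_congr _ _ ?_
        filter_upwards [Measure.quasiMeasurePreserving_fst.ae (Lp.coeFn_smul c φ)] with z h
        rw [h, Pi.smul_apply, Pi.smul_apply, smul_eq_mul, smul_eq_mul, mul_assoc])
      (fun φ η η' => by
        rw [← MemLp.toLp_add]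
        refine MemLp.toLp_congr _ _ ?_
        filter_upwards [Measure.quasiMeasurePreserving_snd.ae (Lp.coeFn_add η η')] with z h
        rw [h, Pi.add_apply, Pi.add_apply, mul_add])
      (fun c φ η => by
        rw [← MemLp.toLp_const_smul]
        refine MemLp.toLp_congr _ _ ?_
        filter_upwards [Measure.quasiMeasurePreserving_snd.ae (Lp.coeFn_smul c η)] with z h
        rw [h, Pi.smul_apply, Pi.smul_apply, smul_eq_mul, smul_eq_mul, mul_left_comm]))
    1 (fun φ η => by
      simp only [LinearMap.mk₂_apply, one_mul]
      rw [Lp.norm_toLp, Lp.norm_def, Lp.norm_def, ← ENNReal.toReal_mul,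
        eLpNorm_tensor Fact.out (Lp.memLp φ).1 (Lp.memLp η).1])

omit [Fact (1 ≤ q)] [ENNReal.HolderConjugate p q] in
theorem coeFn_tensor [SFinite μ] [SFinite ν] [Fact (p ≠ ∞)] (φ : Lp ℝ p μ) (η : Lp ℝ p ν) :
    tensor p μ ν φ η =ᵐ[μ.prod ν] fun z => φ z.1 * η z.2 :=
  (memLp_tensor (Fact.out : p ≠ ∞) (Lp.memLp φ) (Lp.memLp η)).coeFn_toLp

/-- Slicing undoes the tensor product up to a scalar; for φ = 1 this says that the slices of
deterministic fields are constants. -/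
theorem slice_tensor [SFinite μ] [SFinite ν] [Fact (p ≠ ∞)] (φ : Lp ℝ p μ) (η : Lp ℝ p ν)
    (g : Lp ℝ q ν) : slice μ ν (tensor p μ ν φ η) g = pairing ν p q η g • φ := by
  rw [Lp.ext_iff]
  filter_upwards [coeFn_slice (tensor p μ ν φ η) g, Measure.ae_ae_of_ae_prod (coeFn_tensor φ η),
    Lp.coeFn_smul (pairing ν p q η g) φ] with a h1 h2 h3
  rw [h1, h3, Pi.smul_apply, pairing_apply, smul_eq_mul, ← integral_mul_const]
  refine integral_congr_ae ?_
  filter_upwards [h2] with b hb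
  rw [hb]; ring

end Slice

/-! ### Lattice cells and averaging over them -/

section Cell

variable {d : ℕ} {ε : ℝ}

theorem measurable_cell (ε : ℝ) : Measurable (cell (d := d) ε) := by
  refine measurable_pi_lambda _ fun i => Int.measurable_floor.comp ?_
  have : Measurable fun x : Space d => x i := by fun_prop
  exact (this.div_const ε).add_const _

theorem volume_cell_preimage (hε : 0 < ε) (z : Lattice d) :
    (volume : Measure (Space d)) (cell ε ⁻¹' {z}) = ENNReal.ofReal (ε ^ d) := by
  have hpre : cell ε ⁻¹' {z} = (MeasurableEquiv.toLp 2 (Fin d → ℝ)).symm ⁻¹'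
      (Set.pi univ fun i => Ico (ε * (z i - 1 / 2)) (ε * (z i + 1 / 2))) := by
    ext x
    simp only [mem_preimage, mem_singleton_iff, Set.mem_pi, mem_univ, forall_const, mem_Ico]
    rw [funext_iff]
    refine forall_congr' fun i => ?_
    change ⌊x i / ε + 1 / 2⌋ = z i ↔ ε * (z i - 1 / 2) ≤ x i ∧ x i < ε * (z i + 1 / 2)
    rw [Int.floor_eq_iff, ← sub_le_iff_le_add, le_div_iff₀ hε, ← lt_sub_iff_add_lt, div_lt_iff₀ hε,
      mul_comm, show (z i : ℝ) + 1 - 1 / 2 = z i + 1 / 2 by ring, mul_comm (z i + 1 / 2 : ℝ)]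
  rw [hpre, (EuclideanSpace.volume_preserving_symm_measurableEquiv_toLp (Fin d)).measure_preimage
    (MeasurableSet.univ_pi fun i => measurableSet_Ico).nullMeasurableSet, Real.volume_pi_Ico]
  have : ∀ i : Fin d, ε * ((z i : ℝ) + 1 / 2) - ε * (z i - 1 / 2) = ε := fun i => by ring
  simp only [this, Finset.prod_const, Finset.card_univ, Fintype.card_fin]
  rw [ENNReal.ofReal_pow hε.le]

/-- The lattice is countable and every cell has volume ε^d. Lattice integrals thereby become
Lebesgue integrals of piecewise constant functions. -/
theorem measurePreserving_cell (hε : 0 < ε) :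
    MeasurePreserving (cell (d := d) ε) volume (latticeMeasure d ε) := by
  refine ⟨measurable_cell ε, Measure.ext_of_singleton fun z => ?_⟩
  rw [Measure.map_apply (measurable_cell ε) (measurableSet_singleton z), volume_cell_preimage hε,
    latticeMeasure, Measure.smul_apply, Measure.count_singleton, smul_eq_mul, mul_one]

theorem dist_le_of_cell_eq (hε : 0 < ε) {x y : Space d} (h : cell ε x = cell ε y) :
    dist x y ≤ √d * ε := by
  rw [EuclideanSpace.dist_eq]
  have hi : ∀ i, dist (x i) (y i) ≤ ε := fun i => by
    have hc := congrFun h i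
    change ⌊x i / ε + 1 / 2⌋ = ⌊y i / ε + 1 / 2⌋ at hc
    have h1 := Int.floor_le (x i / ε + 1 / 2)
    have h2 := Int.lt_floor_add_one (x i / ε + 1 / 2)
    have h3 := Int.floor_le (y i / ε + 1 / 2)
    have h4 := Int.lt_floor_add_one (y i / ε + 1 / 2)
    rw [hc] at h1 h2
    have h5 : |x i / ε - y i / ε| ≤ 1 := by rw [abs_le]; constructor <;> linarith
    rw [Real.dist_eq]
    rw [← sub_div, abs_div, abs_of_pos hε, div_le_one hε] at h5
    exact h5
  calc √(∑ i, dist (x i) (y i) ^ 2) ≤ √(∑ _i : Fin d, ε ^ 2) := by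
        refine Real.sqrt_le_sqrt (Finset.sum_le_sum fun i _ => ?_)
        exact pow_le_pow_left₀ dist_nonneg (hi i) 2
    _ = √d * ε := by
        rw [Finset.sum_const, Finset.card_univ, Fintype.card_fin, nsmul_eq_mul,
          Real.sqrt_mul (Nat.cast_nonneg d), Real.sqrt_sq hε.le]

/-- The uniform probability measure on a lattice cell. -/
def cellMeasure (ε : ℝ) (z : Lattice d) : Measure (Space d) :=
  (ENNReal.ofReal (ε ^ d))⁻¹ • (volume : Measure (Space d)).restrict (cell ε ⁻¹' {z})

theorem isProbabilityMeasure_cellMeasure (hε : 0 < ε) (z : Lattice d) :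
    IsProbabilityMeasure (cellMeasure ε z) := by
  refine ⟨?_⟩
  rw [cellMeasure, Measure.smul_apply, Measure.restrict_apply MeasurableSet.univ, univ_inter,
    volume_cell_preimage hε, smul_eq_mul, ENNReal.inv_mul_cancel]
  · exact (ENNReal.ofReal_pos.2 (pow_pos hε d)).ne'
  · exact ENNReal.ofReal_ne_top

theorem measurableSet_cell_preimage (ε : ℝ) (z : Lattice d) :
    MeasurableSet (cell (d := d) ε ⁻¹' {z}) := measurable_cell ε (measurableSet_singleton z)

theorem ae_cellMeasure_of_ae (ε : ℝ) (z : Lattice d) {r : Space d → Prop}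
    (h : ∀ᵐ x, r x) : ∀ᵐ x ∂cellMeasure ε z, r x :=
  Measure.ae_smul_measure (ae_restrict_of_ae h) _

theorem ae_cellMeasure_mem (ε : ℝ) (z : Lattice d) : ∀ᵐ x ∂cellMeasure ε z, cell ε x = z :=
  Measure.ae_smul_measure (ae_restrict_mem (measurableSet_cell_preimage ε z)) _

theorem integral_cellMeasure (hε : 0 < ε) (z : Lattice d) (f : Space d → ℝ) :
    ∫ y, f y ∂cellMeasure ε z
      = ∫ y, f y * (cell ε ⁻¹' {z}).indicator (fun _ => (ε ^ d)⁻¹) y := by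
  rw [cellMeasure, integral_smul_measure, ← integral_indicator (measurableSet_cell_preimage ε z),
    ENNReal.toReal_inv, ENNReal.toReal_ofReal (pow_pos hε d).le, ← integral_smul]
  congr 1
  ext y
  by_cases hy : y ∈ cell ε ⁻¹' {z}
  · rw [indicator_of_mem hy, indicator_of_mem hy, smul_eq_mul, mul_comm]
  · rw [indicator_of_notMem hy, indicator_of_notMem hy, smul_zero, mul_zero]

/-- Tonelli, with the symmetry of the relation "x and y share a cell": after the swap the inner
integral is the volume of a cell times its inverse. -/
theorem lintegral_lintegral_cellMeasure (hε : 0 < ε) {g : Space d → ℝ≥0∞} (hg : AEMeasurable g) :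
    ∫⁻ x, ∫⁻ y, g y ∂cellMeasure ε (cell ε x) = ∫⁻ y, g y := by
  have hV0 : ENNReal.ofReal (ε ^ d) ≠ 0 := (ENNReal.ofReal_pos.2 (pow_pos hε d)).ne'
  have h1 : ∀ x : Space d, ∫⁻ y, g y ∂cellMeasure ε (cell ε x) = ∫⁻ y,
      {z : Space d × Space d | cell ε z.1 = cell ε z.2}.indicator
        (fun z => (ENNReal.ofReal (ε ^ d))⁻¹ * g z.2) (x, y) := fun x => by
    rw [cellMeasure, lintegral_smul_measure, ← lintegral_indicator (measurableSet_cell_preimage ε _),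
      smul_eq_mul, ← lintegral_const_mul' _ _ (ENNReal.inv_ne_top.2 hV0)]
    refine lintegral_congr fun y => ?_
    by_cases hy : cell ε x = cell ε y
    · rw [indicator_of_mem (show y ∈ cell ε ⁻¹' {cell ε x} from hy.symm),
        indicator_of_mem (show (x, y) ∈ {z : Space d × Space d | cell ε z.1 = cell ε z.2} from hy)]
    · rw [indicator_of_notMem (show y ∉ cell ε ⁻¹' {cell ε x} from fun h => hy (Eq.symm h)),
        indicator_of_notMem (show (x, y) ∉ {z : Space d × Space d | cell ε z.1 = cell ε z.2} from hy),
        mul_zero]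
  simp_rw [h1]
  have hS : MeasurableSet {z : Space d × Space d | cell ε z.1 = cell ε z.2} :=
    measurableSet_eq_fun ((measurable_cell ε).comp measurable_fst)
      ((measurable_cell ε).comp measurable_snd)
  have hG : AEMeasurable (Function.uncurry fun x y : Space d =>
      {z : Space d × Space d | cell ε z.1 = cell ε z.2}.indicator
        (fun z => (ENNReal.ofReal (ε ^ d))⁻¹ * g z.2) (x, y))
      ((volume : Measure (Space d)).prod volume) :=
    AEMeasurable.indicator
      ((hg.comp_quasiMeasurePreserving Measure.quasiMeasurePreserving_snd).const_mul _) hS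
  rw [lintegral_lintegral_swap hG]
  refine lintegral_congr fun y => ?_
  have h2 : ∀ x : Space d, {z : Space d × Space d | cell ε z.1 = cell ε z.2}.indicator
        (fun z => (ENNReal.ofReal (ε ^ d))⁻¹ * g z.2) (x, y)
      = (cell ε ⁻¹' {cell ε y}).indicator (fun _ => (ENNReal.ofReal (ε ^ d))⁻¹ * g y) x := fun x => by
    by_cases hy : cell ε x = cell ε y
    · rw [indicator_of_mem (show x ∈ cell ε ⁻¹' {cell ε y} from hy),
        indicator_of_mem (show (x, y) ∈ {z : Space d × Space d | cell ε z.1 = cell ε z.2} from hy)]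
    · rw [indicator_of_notMem (show x ∉ cell ε ⁻¹' {cell ε y} from hy),
        indicator_of_notMem (show (x, y) ∉ {z : Space d × Space d | cell ε z.1 = cell ε z.2} from hy)]
  simp_rw [h2]
  rw [lintegral_indicator_const (measurableSet_cell_preimage ε _), volume_cell_preimage hε,
    mul_right_comm, ENNReal.inv_mul_cancel hV0 ENNReal.ofReal_ne_top, one_mul]

/-- Averaging over the lattice cells. -/
def cellAvg (ε : ℝ) (f : Space d → ℝ) (x : Space d) : ℝ := ∫ y, f y ∂cellMeasure ε (cell ε x)

variable {p : ℝ≥0∞}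

theorem enorm_integral_rpow_le {α : Type*} [MeasurableSpace α] {ν : Measure α}
    [IsProbabilityMeasure ν] (hp1 : 1 ≤ p) (hp : p ≠ ∞) {f : α → ℝ}
    (hf : AEStronglyMeasurable f ν) :
    ‖∫ y, f y ∂ν‖ₑ ^ p.toReal ≤ ∫⁻ y, ‖f y‖ₑ ^ p.toReal ∂ν := by
  have hp0 : p ≠ 0 := (zero_lt_one.trans_le hp1).ne'
  rw [lintegral_rpow_eq_eLpNorm hp0 hp]
  refine ENNReal.rpow_le_rpow ?_ ENNReal.toReal_nonneg
  refine (enorm_integral_le_lintegral_enorm _).trans ?_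
  rw [← eLpNorm_one_eq_lintegral_enorm]
  exact eLpNorm_le_eLpNorm_of_exponent_le hp1 hf

theorem aestronglyMeasurable_cellMeasure {f : Space d → ℝ} (hf : AEStronglyMeasurable f volume)
    (z : Lattice d) : AEStronglyMeasurable f (cellMeasure ε z) :=
  (hf.restrict).smul_measure _

/-- Jensen on each cell, then `lintegral_lintegral_cellMeasure`. -/
theorem lintegral_cellAvg_le (hε : 0 < ε) (hp1 : 1 ≤ p) (hp : p ≠ ∞) {f : Space d → ℝ}
    (hf : AEStronglyMeasurable f volume) :
    ∫⁻ x, ‖cellAvg ε f x‖ₑ ^ p.toReal ≤ ∫⁻ x, ‖f x‖ₑ ^ p.toReal := by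
  rw [← lintegral_lintegral_cellMeasure hε (hf.enorm.pow_const p.toReal)]
  refine lintegral_mono fun x => ?_
  have := isProbabilityMeasure_cellMeasure hε (cell ε x)
  exact enorm_integral_rpow_le hp1 hp (aestronglyMeasurable_cellMeasure hf _)

theorem measurable_cellAvg (ε : ℝ) (f : Space d → ℝ) : Measurable (cellAvg ε f) :=
  (measurable_of_countable fun z => ∫ y, f y ∂cellMeasure ε z).comp (measurable_cell ε)

theorem eLpNorm_cellAvg_le (hε : 0 < ε) (hp1 : 1 ≤ p) (hp : p ≠ ∞) {f : Space d → ℝ}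
    (hf : AEStronglyMeasurable f volume) : eLpNorm (cellAvg ε f) p volume ≤ eLpNorm f p volume := by
  have := eLpNorm_le_of_lintegral_le (C := 1) (zero_lt_one.trans_le hp1).ne' hp
    ((lintegral_cellAvg_le hε hp1 hp hf).trans (by rw [ENNReal.one_rpow, one_mul]))
  rwa [one_mul] at this

theorem memLp_cellMeasure {f : Space d → ℝ} (hε : 0 < ε) (hf : MemLp f p volume) (z : Lattice d) :
    MemLp f p (cellMeasure ε z) :=
  (hf.restrict _).smul_measure (ENNReal.inv_ne_top.2 (ENNReal.ofReal_pos.2 (pow_pos hε d)).ne')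

theorem integrable_cellMeasure {f : Space d → ℝ} (hε : 0 < ε) (hp1 : 1 ≤ p)
    (hf : MemLp f p volume) (z : Lattice d) : Integrable f (cellMeasure ε z) := by
  have := isProbabilityMeasure_cellMeasure hε z
  exact (memLp_cellMeasure hε hf z).integrable hp1

theorem cellAvg_sub {f g : Space d → ℝ} (hε : 0 < ε) (hp1 : 1 ≤ p) (hf : MemLp f p volume)
    (hg : MemLp g p volume) : cellAvg ε (f - g) = cellAvg ε f - cellAvg ε g := by
  ext x
  exact integral_sub (integrable_cellMeasure hε hp1 hf _) (integrable_cellMeasure hε hp1 hg _)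

theorem tendsto_cellAvg_of_continuous {ι : Type*} {l : Filter ι} {δ : ι → ℝ} (hδ : ∀ n, 0 < δ n)
    (hδ0 : Tendsto δ l (𝓝 0)) {g : Space d → ℝ} (hg : Continuous g) (hb : ∃ M, ∀ x, ‖g x‖ ≤ M)
    (x : Space d) : Tendsto (fun n => cellAvg (δ n) g x) l (𝓝 (g x)) := by
  rw [Metric.tendsto_nhds]
  intro r hr
  obtain ⟨s, hs, hsg⟩ := Metric.continuous_iff.1 hg x (r / 2) (half_pos hr)
  have h1 : Tendsto (fun n => √d * δ n) l (𝓝 0) := by simpa using hδ0.const_mul (√d)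
  filter_upwards [h1.eventually (gt_mem_nhds hs)] with n hn
  have := isProbabilityMeasure_cellMeasure (hδ n) (cell (δ n) x)
  obtain ⟨M, hM⟩ := hb
  have hi : Integrable g (cellMeasure (δ n) (cell (δ n) x)) :=
    (integrable_const M).mono' hg.aestronglyMeasurable (Eventually.of_forall hM)
  have e : cellAvg (δ n) g x - g x = ∫ y, (g y - g x) ∂cellMeasure (δ n) (cell (δ n) x) := by
    rw [integral_sub hi (integrable_const _)]
    simp [cellAvg]
  rw [Real.dist_eq, e, ← Real.norm_eq_abs]
  refine (norm_integral_le_of_norm_le_const (C := r / 2) ?_).trans_lt ?_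
  · filter_upwards [ae_cellMeasure_mem (δ n) (cell (δ n) x)] with y hy
    exact (hsg y ((dist_le_of_cell_eq (hδ n) hy).trans_lt hn)).le
  · simp; linarith

theorem cellAvg_eq_zero (hε : 0 < ε) {g : Space d → ℝ} {R : ℝ}
    (hg : ∀ y, R < ‖y‖ → g y = 0) {x : Space d} (hx : R + √d * ε < ‖x‖) : cellAvg ε g x = 0 := by
  refine integral_eq_zero_of_ae ?_
  filter_upwards [ae_cellMeasure_mem ε (cell ε x)] with y hy
  refine hg y ?_
  have h1 := dist_le_of_cell_eq hε hy
  rw [dist_eq_norm] at h1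
  have h2 := norm_sub_norm_le x y
  rw [norm_sub_rev] at h2
  linarith

theorem norm_cellAvg_le (hε : 0 < ε) {g : Space d → ℝ} {M : ℝ} (hg : ∀ y, ‖g y‖ ≤ M)
    (x : Space d) : ‖cellAvg ε g x‖ ≤ M := by
  have := isProbabilityMeasure_cellMeasure hε (cell ε x)
  simpa [cellAvg] using norm_integral_le_of_norm_le_const (μ := cellMeasure ε (cell ε x)) (C := M)
    (Eventually.of_forall hg)

/-- Averaging is a contraction of L^p, so it suffices to approximate f by a continuous g of compact
support. For g the averages converge pointwise, are uniformly bounded and, once δ < 1, vanish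
outside the ball of radius R + √d. -/
theorem tendsto_eLpNorm_cellAvg_sub (hp1 : 1 ≤ p) (hp : p ≠ ∞) {δ : ℕ → ℝ} (hδ : ∀ n, 0 < δ n)
    (hδ0 : Tendsto δ atTop (𝓝 0)) {f : Space d → ℝ} (hf : MemLp f p volume) :
    Tendsto (fun n => eLpNorm (cellAvg (δ n) f - f) p volume) atTop (𝓝 0) := by
  rw [ENNReal.tendsto_nhds_zero]
  intro r hr
  have hr3 : r / 3 ≠ 0 := (ENNReal.div_pos hr.ne' (by simp)).ne'
  obtain ⟨g, hgs, hgr, hgc, hgm⟩ := hf.exists_hasCompactSupport_eLpNorm_sub_le hp hr3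
  obtain ⟨M, hM⟩ := hgc.bounded_above_of_compact_support hgs
  obtain ⟨R, hR⟩ := hgs.isCompact.isBounded.exists_norm_le
  have hgR : ∀ y, R < ‖y‖ → g y = 0 := fun y hy => by
    by_contra hne
    exact absurd (hR y (subset_tsupport _ hne)) (not_le.2 hy)
  have hgt : Tendsto (fun n => eLpNorm (cellAvg (δ n) g - g) p volume) atTop (𝓝 0) := by
    refine tendsto_eLpNorm_sub_of_dominated (zero_lt_one.trans_le hp1).ne' hp
      (b := (Metric.closedBall 0 (R + √d)).indicator fun _ => M)
      (fun n => (measurable_cellAvg _ _).aestronglyMeasurable) ?_ ?_ hgm.1 ?_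
      (Eventually.of_forall fun x =>
        tendsto_cellAvg_of_continuous hδ hδ0 hgc ⟨M, hM⟩ x)
    · exact memLp_indicator_const _ measurableSet_closedBall _
        (Or.inr measure_closedBall_lt_top.ne)
    · filter_upwards [hδ0.eventually (gt_mem_nhds zero_lt_one)] with n hn
      refine Eventually.of_forall fun x => ?_
      by_cases hx : x ∈ Metric.closedBall (0 : Space d) (R + √d)
      · rw [indicator_of_mem hx]; exact norm_cellAvg_le (hδ n) hM x
      · rw [indicator_of_notMem hx, cellAvg_eq_zero (hδ n) hgR, norm_zero]
        rw [mem_closedBall_zero_iff, not_le] at hx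
        have : √d * δ n ≤ √d := mul_le_of_le_one_right (Real.sqrt_nonneg _) hn.le
        linarith
    · refine Eventually.of_forall fun x => ?_
      by_cases hx : x ∈ Metric.closedBall (0 : Space d) (R + √d)
      · rw [indicator_of_mem hx]; exact hM x
      · rw [indicator_of_notMem hx, hgR, norm_zero]
        rw [mem_closedBall_zero_iff, not_le] at hx
        have := Real.sqrt_nonneg d
        linarith
  filter_upwards [(ENNReal.tendsto_nhds_zero.1 hgt) (r / 3) (pos_iff_ne_zero.2 hr3)] with n hn
  have e : cellAvg (δ n) f - f
      = cellAvg (δ n) (f - g) + ((cellAvg (δ n) g - g) + (g - f)) := by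
    rw [cellAvg_sub (hδ n) hp1 hf hgm]; abel
  have hfg := hf.sub hgm
  have h1 : eLpNorm (cellAvg (δ n) (f - g)) p volume ≤ r / 3 :=
    (eLpNorm_cellAvg_le (hδ n) hp1 hp hfg.1).trans hgr
  have h2 : eLpNorm (g - f) p volume ≤ r / 3 := by rwa [eLpNorm_sub_comm]
  rw [e]
  refine (eLpNorm_add_le (measurable_cellAvg _ _).aestronglyMeasurable
    (((measurable_cellAvg _ _).aestronglyMeasurable.sub hgm.1).add (hgm.1.sub hf.1)) hp1).trans ?_
  refine (add_le_add h1 ((eLpNorm_add_le ((measurable_cellAvg _ _).aestronglyMeasurable.sub hgm.1)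
    (hgm.1.sub hf.1) hp1).trans (add_le_add hn h2))).trans (le_of_eq ?_)
  rw [← add_assoc, ENNReal.add_thirds]

end Cell

/-! ### Density of tensors in L^p(Ω × ℝ^d) -/

section FiberAverage

variable {d : ℕ} {ε : ℝ} {Ω : Type*} [MeasurableSpace Ω] {P : Measure Ω} [SFinite P] {p q : ℝ≥0∞}

/-- Averaging over the lattice cells in the spatial variable. -/
def fiberAvg (ε : ℝ) (f : Ω × Space d → ℝ) (z : Ω × Space d) : ℝ :=
  cellAvg ε (fun y => f (z.1, y)) z.2

theorem measurable_fiberAvg (hε : 0 < ε) {f : Ω × Space d → ℝ} (hf : StronglyMeasurable f) :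
    Measurable (fiberAvg ε f) := by
  have h : Measurable fun w : Ω × Lattice d => ∫ y, f (w.1, y) ∂cellMeasure ε w.2 := by
    refine measurable_from_prod_countable_left fun z => ?_
    have := isProbabilityMeasure_cellMeasure hε z
    exact (StronglyMeasurable.integral_prod_right' (ν := cellMeasure ε z) hf).measurable
  exact h.comp (measurable_fst.prodMk ((measurable_cell ε).comp measurable_snd))

omit [SFinite P] in
theorem memLp_fiberAvg (hε : 0 < ε) (hp1 : 1 ≤ p) (hp : p ≠ ∞) {f : Ω × Space d → ℝ}
    (hf : StronglyMeasurable f) (hfp : MemLp f p (P.prod volume)) :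
    MemLp (fiberAvg ε f) p (P.prod volume) := by
  have hp0 : p ≠ 0 := (zero_lt_one.trans_le hp1).ne'
  have hm := measurable_fiberAvg hε hf
  refine ⟨hm.aestronglyMeasurable, ?_⟩
  rw [eLpNorm_lt_top_iff_lintegral_rpow_enorm_lt_top hp0 hp, lintegral_prod _
    ((hm.enorm).pow_const _).aemeasurable]
  have hsl : ∀ ω, AEStronglyMeasurable (fun y => f (ω, y)) volume := fun ω =>
    (hf.comp_measurable measurable_prodMk_left).aestronglyMeasurable
  refine lt_of_le_of_lt (lintegral_mono fun ω => lintegral_cellAvg_le hε hp1 hp (hsl ω)) ?_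
  rw [← lintegral_prod (fun z => ‖f z‖ₑ ^ p.toReal) ((hf.measurable.enorm).pow_const _).aemeasurable]
  exact (eLpNorm_lt_top_iff_lintegral_rpow_enorm_lt_top hp0 hp).1 hfp.eLpNorm_lt_top

omit [SFinite P] in
-- Convergence for almost every fixed ω, integrated over Ω by dominated convergence with majorant
-- (2‖f(ω,·)‖_p)^p.
theorem tendsto_eLpNorm_fiberAvg_sub (hp1 : 1 ≤ p) (hp : p ≠ ∞) {δ : ℕ → ℝ} (hδ : ∀ n, 0 < δ n)
    (hδ0 : Tendsto δ atTop (𝓝 0)) {f : Ω × Space d → ℝ} (hf : StronglyMeasurable f)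
    (hfp : MemLp f p (P.prod volume)) :
    Tendsto (fun n => eLpNorm (fiberAvg (δ n) f - f) p (P.prod volume)) atTop (𝓝 0) := by
  have hp0 : p ≠ 0 := (zero_lt_one.trans_le hp1).ne'
  have hpr := ENNReal.toReal_pos hp0 hp
  have hsl : ∀ ω, AEStronglyMeasurable (fun y => f (ω, y)) volume := fun ω =>
    (hf.comp_measurable measurable_prodMk_left).aestronglyMeasurable
  have key : Tendsto (fun n => ∫⁻ ω, eLpNorm (cellAvg (δ n) (fun y => f (ω, y)) - fun y => f (ω, y))
      p volume ^ p.toReal ∂P) atTop (𝓝 (∫⁻ _, 0 ∂P)) := by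
    refine tendsto_lintegral_of_dominated_convergence
      (fun ω => (2 * eLpNorm (fun y => f (ω, y)) p volume) ^ p.toReal) ?_ ?_ ?_ ?_
    · intro n
      simp_rw [← lintegral_rpow_eq_eLpNorm hp0 hp]
      exact Measurable.lintegral_prod_right'
        (f := fun z : Ω × Space d => ‖fiberAvg (δ n) f z - f z‖ₑ ^ p.toReal)
        ((((measurable_fiberAvg (hδ n) hf).sub hf.measurable).enorm).pow_const _)
    · refine fun n => Eventually.of_forall fun ω => ENNReal.rpow_le_rpow ?_ hpr.le
      rw [two_mul]
      exact (eLpNorm_sub_le (measurable_cellAvg _ _).aestronglyMeasurable (hsl ω) hp1).trans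
        (add_le_add (eLpNorm_cellAvg_le (hδ n) hp1 hp (hsl ω)) le_rfl)
    · simp_rw [ENNReal.mul_rpow_of_nonneg _ _ hpr.le]
      rw [lintegral_const_mul' _ _ (by simp), lintegral_eLpNorm_slice hp0 hp hf]
      exact ENNReal.mul_ne_top (by simp) (ENNReal.rpow_ne_top_of_nonneg hpr.le hfp.eLpNorm_ne_top)
    · filter_upwards [ae_memLp_slice hp0 hp hf hfp] with ω hω
      have := (ENNReal.continuous_rpow_const (y := p.toReal)).tendsto 0 |>.comp
        (tendsto_eLpNorm_cellAvg_sub hp1 hp hδ hδ0 hω)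
      simpa [ENNReal.zero_rpow_of_pos hpr, Function.comp_def] using this
  have h3 := (ENNReal.continuous_rpow_const (y := 1 / p.toReal)).tendsto _ |>.comp key
  rw [lintegral_zero, ENNReal.zero_rpow_of_pos (by positivity)] at h3
  refine h3.congr fun n => ?_
  have hm : StronglyMeasurable (fiberAvg (δ n) f - f) :=
    (measurable_fiberAvg (hδ n) hf).stronglyMeasurable.sub hf
  have e := lintegral_eLpNorm_slice (μ := P) (ν := volume) hp0 hp hm
  change (∫⁻ ω, eLpNorm (fun b => (fiberAvg (δ n) f - f) (ω, b)) p volume ^ p.toReal ∂P) ^ _ = _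
  rw [e, ← ENNReal.rpow_mul, mul_one_div_cancel hpr.ne', ENNReal.rpow_one]

variable [Fact (1 ≤ p)] [Fact (1 ≤ q)] [ENNReal.HolderConjugate p q] [Fact (p ≠ ∞)]

/-- The normalized indicator function of a lattice cell. -/
def cellWeight (d : ℕ) (q : ℝ≥0∞) (ε : ℝ) (z : Lattice d) : Lp ℝ q (volume : Measure (Space d)) :=
  if h : volume (cell (d := d) ε ⁻¹' {z}) ≠ ∞ then
    indicatorConstLp q (measurableSet_cell_preimage ε z) h (ε ^ d)⁻¹ else 0

/-- The indicator function of a lattice cell. -/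
def cellIndicator (d : ℕ) (p : ℝ≥0∞) (ε : ℝ) (z : Lattice d) :
    Lp ℝ p (volume : Measure (Space d)) :=
  if h : volume (cell (d := d) ε ⁻¹' {z}) ≠ ∞ then
    indicatorConstLp p (measurableSet_cell_preimage ε z) h 1 else 0

omit [Fact (1 ≤ q)] in
theorem coeFn_cellWeight (hε : 0 < ε) (z : Lattice d) :
    cellWeight d q ε z =ᵐ[volume] (cell ε ⁻¹' {z}).indicator fun _ => (ε ^ d)⁻¹ := by
  rw [cellWeight, dif_pos (by rw [volume_cell_preimage hε]; exact ENNReal.ofReal_ne_top)]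
  exact indicatorConstLp_coeFn

omit [Fact (1 ≤ p)] [Fact (p ≠ ∞)] in
theorem coeFn_cellIndicator (hε : 0 < ε) (z : Lattice d) :
    cellIndicator d p ε z =ᵐ[volume] (cell ε ⁻¹' {z}).indicator fun _ => 1 := by
  rw [cellIndicator, dif_pos (by rw [volume_cell_preimage hε]; exact ENNReal.ofReal_ne_top)]
  exact indicatorConstLp_coeFn

/-- On the cell z the spatial average of f is the slice of f against the normalized indicator of z,
so finite sums of tensors are exactly the cell averages truncated to finitely many cells. -/
theorem coeFn_sum_tensor_cell (hε : 0 < ε) (f : Lp ℝ p (P.prod (volume : Measure (Space d))))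
    (F : Finset (Lattice d)) :
    (∑ z ∈ F, tensor p P volume (slice P volume f (cellWeight d q ε z)) (cellIndicator d p ε z)
      : Lp ℝ p (P.prod volume)) =ᵐ[P.prod volume]
      {w : Ω × Space d | cell ε w.2 ∈ F}.indicator (fiberAvg ε f) := by
  have h1 : ∀ᵐ w ∂(P.prod (volume : Measure (Space d))), ∀ z, tensor p P volume
      (slice P volume f (cellWeight d q ε z)) (cellIndicator d p ε z) w
      = (∫ y, f (w.1, y) ∂cellMeasure ε z) * (cell ε ⁻¹' {z}).indicator (fun _ => 1) w.2 := by
    rw [ae_all_iff]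
    intro z
    filter_upwards [coeFn_tensor (slice P volume f (cellWeight d q ε z)) (cellIndicator d p ε z),
      Measure.quasiMeasurePreserving_fst.ae (coeFn_slice (q := q) f (cellWeight d q ε z)),
      Measure.quasiMeasurePreserving_snd.ae (coeFn_cellIndicator (p := p) hε z)] with w h1 h2 h3
    rw [h1, h2, h3, integral_cellMeasure hε]
    congr 1
    refine integral_congr_ae ?_
    filter_upwards [coeFn_cellWeight (q := q) hε z] with y hy
    rw [hy]
  filter_upwards [h1, Lp.coeFn_finsetSum F fun z => tensor p P volume
    (slice P volume f (cellWeight d q ε z)) (cellIndicator d p ε z)] with w h1 h2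
  rw [h2, Finset.sum_apply]
  simp_rw [h1]
  classical
  by_cases hw : cell ε w.2 ∈ F
  · rw [indicator_of_mem (show w ∈ {w : Ω × Space d | cell ε w.2 ∈ F} from hw),
      Finset.sum_eq_single_of_mem _ hw]
    · rw [indicator_of_mem (show w.2 ∈ cell ε ⁻¹' {cell ε w.2} from rfl), mul_one]
      rfl
    · intro z _ hz
      rw [indicator_of_notMem (show w.2 ∉ cell ε ⁻¹' {z} from fun h => hz (Eq.symm h)), mul_zero]
  · rw [indicator_of_notMem (show w ∉ {w : Ω × Space d | cell ε w.2 ∈ F} from hw)]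
    refine Finset.sum_eq_zero fun z hz => ?_
    rw [indicator_of_notMem (show w.2 ∉ cell ε ⁻¹' {z} from fun h => hw (by
      rw [show cell ε w.2 = z from h]; exact hz)), mul_zero]

theorem tendsto_sum_tensor_cell (hε : 0 < ε) (f : Lp ℝ p (P.prod (volume : Measure (Space d)))) :
    Tendsto (fun F : Finset (Lattice d) => ∑ z ∈ F, tensor p P volume
      (slice P volume f (cellWeight d q ε z)) (cellIndicator d p ε z)) atTop
      (𝓝 ((memLp_fiberAvg hε Fact.out Fact.out (Lp.stronglyMeasurable f) (Lp.memLp f)).toLp _)) := by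
  have hm := memLp_fiberAvg hε (Fact.out : 1 ≤ p) Fact.out (Lp.stronglyMeasurable f) (Lp.memLp f)
  have hS : ∀ F : Finset (Lattice d), MeasurableSet {w : Ω × Space d | cell ε w.2 ∈ F} := fun F =>
    ((measurable_cell ε).comp measurable_snd) F.measurableSet
  have e : ∀ F : Finset (Lattice d), (∑ z ∈ F, tensor p P volume
      (slice P volume f (cellWeight d q ε z)) (cellIndicator d p ε z) : Lp ℝ p (P.prod volume))
      = (hm.indicator (hS F)).toLp _ := fun F => by
    rw [Lp.ext_iff]
    filter_upwards [coeFn_sum_tensor_cell (q := q) hε f F, (hm.indicator (hS F)).coeFn_toLp]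
      with w h1 h2
    rw [h1, h2]
  simp_rw [e]
  rw [Lp.tendsto_Lp_iff_tendsto_eLpNorm'']
  refine tendsto_eLpNorm_sub_of_dominated (b := fun x => ‖fiberAvg ε f x‖)
    (zero_lt_one.trans_le (Fact.out : 1 ≤ p)).ne' Fact.out
    (fun F => (hm.indicator (hS F)).1) hm.norm
    (Eventually.of_forall fun F => Eventually.of_forall fun x => norm_indicator_le_norm_self _ _)
    hm.1 (Eventually.of_forall fun x => le_rfl) (Eventually.of_forall fun w => ?_)
  refine tendsto_const_nhds.congr' ?_
  filter_upwards [eventually_ge_atTop {cell ε w.2}] with F hF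
  rw [indicator_of_mem]
  exact hF (Finset.mem_singleton_self _)

/-- Averages over cells of size δ converge to H as δ → 0, and each of them is a limit of finite sums
of (slice of H) ⊗ (indicator of a cell). The slices lie in K by hypothesis. -/
theorem mem_closure_span_tensor {ι : Type*} [Fintype ι] {K : Submodule ℝ (ι → Lp ℝ p P)}
    {H : ι → Lp ℝ p (P.prod (volume : Measure (Space d)))}
    (h : ∀ η : Lp ℝ q (volume : Measure (Space d)), (fun i => slice P volume (H i) η) ∈ K) :
    H ∈ closure (Submodule.span ℝ {W : ι → Lp ℝ p (P.prod (volume : Measure (Space d))) |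
      ∃ ψ ∈ K, ∃ η : Lp ℝ p (volume : Measure (Space d)), ∀ i, W i = tensor p P volume (ψ i) η} :
      Set (ι → Lp ℝ p (P.prod (volume : Measure (Space d))))) := by
  let δ : ℕ → ℝ := fun n => 1 / ((n : ℝ) + 1)
  have hδ : ∀ n, 0 < δ n := fun n => Nat.one_div_pos_of_nat
  have hδ0 : Tendsto δ atTop (𝓝 0) := tendsto_one_div_add_atTop_nhds_zero_nat
  have hm := fun n i => memLp_fiberAvg (hδ n) (Fact.out : 1 ≤ p) Fact.out
    (Lp.stronglyMeasurable (H i)) (Lp.memLp (H i))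
  have hlim : Tendsto (fun n i => (hm n i).toLp _) atTop (𝓝 H) := by
    rw [tendsto_pi_nhds]
    intro i
    rw [Lp.tendsto_Lp_iff_tendsto_eLpNorm']
    refine (tendsto_eLpNorm_fiberAvg_sub Fact.out Fact.out hδ hδ0 (Lp.stronglyMeasurable (H i))
      (Lp.memLp (H i))).congr fun n => eLpNorm_congr_ae ?_
    filter_upwards [(hm n i).coeFn_toLp] with w hw
    rw [Pi.sub_apply, Pi.sub_apply, hw]
  refine isClosed_closure.mem_of_tendsto hlim (Eventually.of_forall fun n => ?_)
  have h2 : Tendsto (fun (F : Finset (Lattice d)) i => ∑ z ∈ F, tensor p P volume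
      (slice P volume (H i) (cellWeight d q (δ n) z)) (cellIndicator d p (δ n) z)) atTop
      (𝓝 fun i => (hm n i).toLp _) := by
    rw [tendsto_pi_nhds]
    exact fun i => tendsto_sum_tensor_cell (hδ n) (H i)
  refine mem_closure_of_tendsto h2 (Eventually.of_forall fun F => ?_)
  have e : (fun i => ∑ z ∈ F, tensor p P volume
      (slice P volume (H i) (cellWeight d q (δ n) z)) (cellIndicator d p (δ n) z))
      = ∑ z ∈ F, fun i => tensor p P volume
      (slice P volume (H i) (cellWeight d q (δ n) z)) (cellIndicator d p (δ n) z) := by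
    ext1 i
    rw [Finset.sum_apply]
  rw [e]
  exact Submodule.sum_mem _ fun z _ => Submodule.subset_span ⟨_, h (cellWeight d q (δ n) z), _,
    fun i => rfl⟩

/-- The slice criterion with K = 0: nothing but 0 is left in the closure. -/
theorem eq_zero_of_slice_eq_zero {H : Lp ℝ p (P.prod (volume : Measure (Space d)))}
    (h : ∀ η : Lp ℝ q (volume : Measure (Space d)), slice P volume H η = 0) : H = 0 := by
  have h1 := mem_closure_span_tensor (q := q) (K := (⊥ : Submodule ℝ (Unit → Lp ℝ p P)))
    (H := fun _ => H) (fun η => by rw [Submodule.mem_bot]; ext1; exact h η)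
  have h2 : Submodule.span ℝ {W : Unit → Lp ℝ p (P.prod (volume : Measure (Space d))) |
      ∃ ψ ∈ (⊥ : Submodule ℝ (Unit → Lp ℝ p P)), ∃ η : Lp ℝ p (volume : Measure (Space d)),
        ∀ i, W i = tensor p P volume (ψ i) η} = ⊥ := by
    rw [Submodule.span_eq_bot]
    rintro W ⟨ψ, hψ, η, hW⟩
    rw [Submodule.mem_bot] at hψ
    subst hψ
    ext1 i
    rw [hW, Pi.zero_apply, map_zero]
    rfl
  rw [h2, Submodule.bot_coe, closure_singleton, mem_singleton_iff] at h1
  exact congrFun h1 ()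

omit [Fact (1 ≤ q)] [ENNReal.HolderConjugate p q] in
-- The slice criterion with K everything: tensors span a dense subspace, and they are the continuous
-- image of a product of two separable spaces.
theorem separableSpace_Lp_prod [MeasureTheory.IsSeparable P] :
    TopologicalSpace.SeparableSpace (Lp ℝ p (P.prod (volume : Measure (Space d)))) := by
  let q := p.conjExponent
  have : Fact (1 ≤ q) := ⟨ENNReal.HolderConjugate.one_le q p⟩
  let T : Set (Lp ℝ p (P.prod (volume : Measure (Space d)))) :=
    range fun z : Lp ℝ p P × Lp ℝ p (volume : Measure (Space d)) => tensor p P volume z.1 z.2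
  have hT : TopologicalSpace.IsSeparable T := TopologicalSpace.isSeparable_range
    ((tensor p P volume).continuous₂)
  have hd : closure (Submodule.span ℝ T : Set (Lp ℝ p (P.prod (volume : Measure (Space d)))))
      = univ := by
    refine eq_univ_of_forall fun H => ?_
    have h1 := mem_closure_span_tensor (q := q) (K := (⊤ : Submodule ℝ (Unit → Lp ℝ p P)))
      (H := fun _ => H) (fun η => Submodule.mem_top)
    have hc : Continuous fun W : Unit → Lp ℝ p (P.prod (volume : Measure (Space d))) => W () :=
      continuous_apply ()
    refine closure_minimal ?_ (isClosed_closure.preimage hc) h1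
    intro W hW
    refine subset_closure ?_
    induction hW using Submodule.span_induction with
    | mem x hx =>
      obtain ⟨ψ, -, η, hx⟩ := hx
      exact Submodule.subset_span ⟨(ψ (), η), (hx ()).symm⟩
    | zero => exact Submodule.zero_mem _
    | add x y _ _ hx hy => exact Submodule.add_mem _ hx hy
    | smul c x _ hx => exact Submodule.smul_mem _ c hx
  have := (hT.span (R := ℝ)).closure
  rw [hd] at this
  exact TopologicalSpace.isSeparable_univ_iff.1 this

end FiberAverage

/-! ### The unfolding operator and discrete gradients -/

section Unfolding

variable {d : ℕ} {ε : ℝ} {Ω : Type*} [MeasurableSpace Ω] {P : Measure Ω} [IsProbabilityMeasure P]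
  [AddAction (Lattice d) Ω] [MeasurableConstVAdd (Lattice d) Ω]
  [VAddInvariantMeasure (Lattice d) Ω P] {p q : ℝ≥0∞}

instance (d : ℕ) (ε : ℝ) : SFinite (latticeMeasure d ε) := by
  unfold latticeMeasure
  infer_instance

/-- The change of variables underlying the unfolding. -/
def unfoldMap (ε : ℝ) (z : Ω × Space d) : Ω × Lattice d :=
  ((-cell ε z.2) +ᵥ z.1, cell ε z.2)

/-- A skew product over x ↦ cell of x, whose fibre maps ω ↦ T_{-z} ω preserve P. The two swaps put
the base variable first, as the skew product lemma expects. -/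
theorem measurePreserving_unfoldMap (hε : 0 < ε) :
    MeasurePreserving (unfoldMap (d := d) (Ω := Ω) ε) (P.prod volume)
      (P.prod (latticeMeasure d ε)) := by
  have hm : Measurable (Function.uncurry fun (x : Space d) (ω : Ω) => (-cell ε x) +ᵥ ω) := by
    have : Measurable fun w : Lattice d × Ω => (-w.1) +ᵥ w.2 :=
      measurable_from_prod_countable_right fun z => measurable_const_vadd (-z)
    exact this.comp (((measurable_cell ε).comp measurable_fst).prodMk measurable_snd)
  have h := (measurePreserving_cell (d := d) hε).skew_product (μc := P) (μd := P) hm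
    (Eventually.of_forall fun x => (measurePreserving_vadd (-cell ε x) P).map_eq)
  exact (Measure.measurePreserving_swap.comp h).comp Measure.measurePreserving_swap

theorem memLp_unfold (hε : 0 < ε) {u : Ω × Lattice d → ℝ}
    (hu : MemLp u p (P.prod (latticeMeasure d ε))) : MemLp (unfold ε u) p (P.prod volume) :=
  hu.comp_measurePreserving (measurePreserving_unfoldMap hε)

theorem eLpNorm_unfold (hε : 0 < ε) {u : Ω × Lattice d → ℝ}
    (hu : AEStronglyMeasurable u (P.prod (latticeMeasure d ε))) :
    eLpNorm (unfold ε u) p (P.prod volume) = eLpNorm u p (P.prod (latticeMeasure d ε)) :=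
  eLpNorm_comp_measurePreserving hu (measurePreserving_unfoldMap hε)

theorem eLpNorm_interp (hε : 0 < ε) (v : Lattice d → ℝ) :
    eLpNorm (interp ε v) p volume = eLpNorm v p (latticeMeasure d ε) :=
  eLpNorm_comp_measurePreserving (measurable_of_countable v).aestronglyMeasurable
    (measurePreserving_cell hε)

theorem measurable_interp (ε : ℝ) (v : Lattice d → ℝ) : Measurable (interp ε v) :=
  (measurable_of_countable v).comp (measurable_cell ε)

/-- The lattice direction `e_i` as a vector of `ℝ^d`. -/
abbrev basisVec {d : ℕ} (i : Fin d) : Space d := EuclideanSpace.single i 1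

theorem cell_add_basisVec (hε : 0 < ε) (x : Space d) (i : Fin d) :
    cell ε (x + ε • basisVec i) = cell ε x + latticeBasis i := by
  ext j
  simp only [cell, latticeBasis, Pi.add_apply, PiLp.add_apply, PiLp.smul_apply, smul_eq_mul]
  by_cases hj : j = i
  · subst hj
    rw [PiLp.single_apply, if_pos rfl, Pi.single_eq_same, mul_one, add_div,
      div_self hε.ne', add_right_comm, ← Int.floor_add_one]
  · rw [PiLp.single_apply, if_neg hj, Pi.single_eq_of_ne hj, mul_zero, add_zero, add_zero]

omit [MeasurableSpace Ω] [MeasurableConstVAdd (Lattice d) Ω] in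
-- At x + εe_i the unfolding uses T_{-(z+e_i)}; replacing ω by T_{e_i} ω restores T_{-z}, so both
-- values of u in the difference quotient are taken at the same realization.
theorem unfold_grad (hε : 0 < ε) (u : Ω × Lattice d → ℝ) (c : ℝ) (i : Fin d) (ω : Ω) (x : Space d) :
    unfold ε (fun z => c * discreteGrad ε u z i) (ω, x)
      = c / ε * (unfold ε u (latticeBasis i +ᵥ ω, x + ε • basisVec i) - unfold ε u (ω, x)) := by
  have h : (-(cell ε x + latticeBasis i)) +ᵥ (latticeBasis i +ᵥ ω) = (-cell ε x) +ᵥ ω := by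
    rw [vadd_vadd]; congr 1; abel
  simp only [unfold, discreteGrad, cell_add_basisVec hε, h]
  ring

section Operators

variable [Fact (1 ≤ p)]

/-- The shift `φ ↦ φ(T_x ·)` on `L^p(Ω)`. -/
def probShift (P : Measure Ω) [VAddInvariantMeasure (Lattice d) Ω P] (p : ℝ≥0∞) [Fact (1 ≤ p)]
    (x : Lattice d) : Lp ℝ p P →ₗᵢ[ℝ] Lp ℝ p P :=
  Lp.compMeasurePreservingₗᵢ ℝ (fun ω => x +ᵥ ω) (measurePreserving_vadd x P)

omit [IsProbabilityMeasure P] in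
theorem coeFn_probShift (x : Lattice d) (φ : Lp ℝ p P) :
    probShift P p x φ =ᵐ[P] fun ω => φ (x +ᵥ ω) :=
  Lp.coeFn_compMeasurePreserving φ (measurePreserving_vadd x P)

omit [IsProbabilityMeasure P] in
theorem ae_vadd (x : Lattice d) {r : Ω → Prop} (h : ∀ᵐ ω ∂P, r ω) : ∀ᵐ ω ∂P, r (x +ᵥ ω) :=
  (measurePreserving_vadd x P).quasiMeasurePreserving.ae h

omit [IsProbabilityMeasure P] in
theorem integral_probShift (x : Lattice d) (φ : Lp ℝ p P) :
    ∫ ω, probShift P p x φ ω ∂P = ∫ ω, φ ω ∂P := by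
  rw [integral_congr_ae (coeFn_probShift x φ), integral_vadd_eq_self]

/-- Translation `η ↦ η(· - h)` on `L^p(ℝ^d)`. -/
def translate (p : ℝ≥0∞) [Fact (1 ≤ p)] (h : Space d) :
    Lp ℝ p (volume : Measure (Space d)) →ₗᵢ[ℝ] Lp ℝ p (volume : Measure (Space d)) :=
  Lp.compMeasurePreservingₗᵢ ℝ (fun x => x - h) (measurePreserving_sub_right volume h)

theorem coeFn_translate (h : Space d) (η : Lp ℝ p (volume : Measure (Space d))) :
    translate p h η =ᵐ[volume] fun x => η (x - h) :=
  Lp.coeFn_compMeasurePreserving η (measurePreserving_sub_right volume h)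

variable [Fact (1 ≤ q)] [ENNReal.HolderConjugate p q] [Fact (p ≠ ∞)]

/-- Integrate `unfold_grad` against η and move the spatial translation from the unfolded field to η.
Gradients of u then appear only through shifts on Ω and translations of the weight. -/
theorem slice_unfold_grad (hε : 0 < ε) {u : Ω × Lattice d → ℝ} {c : ℝ} {i : Fin d}
    (hf : MemLp (unfold ε u) p (P.prod volume))
    (hF : MemLp (unfold ε fun z => c * discreteGrad ε u z i) p (P.prod volume))
    (η : Lp ℝ q (volume : Measure (Space d))) :
    slice P volume (hF.toLp _) η = (c / ε) • (probShift P p (latticeBasis i)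
      (slice P volume (hf.toLp _) (translate q (ε • basisVec i) η))
        - slice P volume (hf.toLp _) η) := by
  set h := ε • basisVec i with hh
  set g := hf.toLp _ with hg
  set e := latticeBasis i with he
  have h1 := Measure.ae_ae_of_ae_prod hf.coeFn_toLp
  have h2 := ae_vadd (P := P) e h1
  have h3 := ae_integrable_slice (μ := P) (ν := volume) (Fact.out : p ≠ ∞) g η
  have h4 := ae_vadd (P := P) e
    (ae_integrable_slice (μ := P) (ν := volume) (Fact.out : p ≠ ∞) g (translate q h η))
  have h5 := coeFn_slice (μ := P) (ν := volume) g η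
  have h6 := ae_vadd (P := P) e (coeFn_slice (μ := P) (ν := volume) g (translate q h η))
  have h7 := coeFn_slice (μ := P) (ν := volume) (hF.toLp _) η
  have h8 := Measure.ae_ae_of_ae_prod hF.coeFn_toLp
  have h9 := coeFn_probShift e (slice P volume g (translate q h η))
  rw [Lp.ext_iff]
  filter_upwards [h1, h2, h3, h4, h5, h6, h7, h8, h9,
    Lp.coeFn_smul (c / ε) (probShift P p e (slice P volume g (translate q h η)) - slice P volume g η),
    Lp.coeFn_sub (probShift P p e (slice P volume g (translate q h η))) (slice P volume g η)]
    with ω a1 a2 a3 a4 a5 a6 a7 a8 a9 a10 a11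
  rw [a10, Pi.smul_apply, a11, Pi.sub_apply, a9, a7, a6, a5]
  have hmp := measurePreserving_add_right (volume : Measure (Space d)) h
  have htr : (fun x => translate q h η (x + h)) =ᵐ[volume] η := by
    filter_upwards [hmp.quasiMeasurePreserving.ae (coeFn_translate h η)] with x hx
    rw [hx, add_sub_cancel_right]
  have b1 : ∫ x, g (e +ᵥ ω, x) * translate q h η x
      = ∫ x, g (e +ᵥ ω, x + h) * η x := by
    rw [← integral_add_right_eq_self (fun x => g (e +ᵥ ω, x) * translate q h η x) h]
    refine integral_congr_ae ?_
    filter_upwards [htr] with x hx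
    rw [hx]
  have b2 : Integrable (fun x => g (e +ᵥ ω, x + h) * η x) volume := by
    refine (a4.comp_add_right h).congr ?_
    filter_upwards [htr] with x hx
    rw [hx]
  rw [b1, ← integral_sub b2 a3, smul_eq_mul, ← integral_const_mul]
  refine integral_congr_ae ?_
  filter_upwards [a8, a1, hmp.quasiMeasurePreserving.ae a2] with x c1 c2 c3
  rw [c1, unfold_grad hε, ← hh, c2, c3]
  ring

end Operators

/-! ### Ergodicity -/

section Ergodic

omit [IsProbabilityMeasure P] in
theorem ae_const_of_invariant (hErg : IsErgodic d P) [IsProbabilityMeasure P]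
    {φ : Ω → ℝ} (hφ : Measurable φ) (hinv : ∀ x : Lattice d, (fun ω => φ (x +ᵥ ω)) =ᵐ[P] φ) :
    ∃ c, φ =ᵐ[P] fun _ => c := by
  refine exists_eventuallyEq_const_of_forall_separating (l := ae P) MeasurableSet fun U hU => ?_
  -- Ergodicity speaks of strictly invariant events, while φ is invariant only almost everywhere.
  -- Requiring the condition along the whole orbit gives a strictly invariant set, measurable
  -- because the lattice is countable, that agrees a.e. with the preimage of U.
  let A : Set Ω := {ω | ∀ x : Lattice d, φ (x +ᵥ ω) ∈ U}
  have hA : MeasurableSet A := by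
    have : A = ⋂ x : Lattice d, (fun ω => x +ᵥ ω) ⁻¹' (φ ⁻¹' U) := by ext; simp [A]
    rw [this]
    exact MeasurableSet.iInter fun x => measurable_const_vadd x (hφ hU)
  have hAinv : ∀ x : Lattice d, (fun ω => x +ᵥ ω) '' A = A := by
    intro x
    ext ω
    constructor
    · rintro ⟨ω', h', rfl⟩ y
      have := h' (y + x)
      rwa [← vadd_vadd] at this
    · intro h
      refine ⟨-x +ᵥ ω, fun y => ?_, vadd_neg_vadd x ω⟩
      rw [vadd_vadd]
      exact h _
  have hall : ∀ᵐ ω ∂P, ∀ x : Lattice d, φ (x +ᵥ ω) = φ ω := ae_all_iff.2 hinv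
  rcases hErg A hA hAinv with h | h
  · right
    filter_upwards [measure_eq_zero_iff_ae_notMem.1 h, hall] with ω h1 h2 h3
    exact h1 fun x => by rw [h2]; exact h3
  · left
    have : ∀ᵐ ω ∂P, ω ∈ A := (mem_ae_iff_prob_eq_one hA).2 h
    filter_upwards [this] with ω h1
    have := h1 0
    rwa [zero_vadd] at this

theorem eq_const_of_mem_invSet (hErg : IsErgodic d P) {φ : Lp ℝ p P} (hφ : φ ∈ invSet d P p) :
    φ =ᵐ[P] fun _ => ∫ ω, φ ω ∂P := by
  obtain ⟨c, hc⟩ := ae_const_of_invariant hErg (Lp.stronglyMeasurable φ).measurable hφ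
  have : ∫ ω, φ ω ∂P = c := by rw [integral_congr_ae hc]; simp
  rw [this]
  exact hc

omit [IsProbabilityMeasure P] in
-- The x that leave φ invariant form a subgroup of ℤ^d, and the e_i generate ℤ^d.
theorem mem_invSet_of_basis [Fact (1 ≤ p)] {φ : Lp ℝ p P}
    (h : ∀ i : Fin d, probShift P p (latticeBasis i) φ = φ) : φ ∈ invSet d P p := by
  let G : AddSubgroup (Lattice d) :=
    { carrier := {x | (fun ω => φ (x +ᵥ ω)) =ᵐ[P] φ}
      zero_mem' := by
        change (fun ω => φ ((0 : Lattice d) +ᵥ ω)) =ᵐ[P] φ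
        simp only [zero_vadd]
        rfl
      add_mem' := by
        intro a b ha hb
        change (fun ω => φ ((a + b) +ᵥ ω)) =ᵐ[P] φ
        filter_upwards [ae_vadd b ha, hb] with ω h1 h2
        rw [← vadd_vadd, h1, h2]
      neg_mem' := by
        intro a ha
        change (fun ω => φ ((-a) +ᵥ ω)) =ᵐ[P] φ
        filter_upwards [ae_vadd (-a) ha] with ω h1
        rw [← h1, vadd_neg_vadd] }
  have hb : ∀ i, latticeBasis i ∈ G := fun i => by
    change (fun ω => φ (latticeBasis i +ᵥ ω)) =ᵐ[P] φ
    filter_upwards [coeFn_probShift (latticeBasis i) φ] with ω hω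
    rw [← hω, h i]
  intro x
  change x ∈ G
  rw [← Finset.univ_sum_single x]
  refine G.sum_mem fun i _ => ?_
  have : Pi.single i (x i) = x i • (latticeBasis i : Lattice d) := by
    rw [latticeBasis, ← Pi.single_smul, smul_eq_mul, mul_one]
  rw [this]
  exact G.zsmul_mem (hb i) _

end Ergodic

end Unfolding

/-! ### Difference quotients of test functions -/

section TestFunctions

variable {d : ℕ} {q : ℝ≥0∞}

theorem tendsto_eLpNorm_sub_of_bounded_support (hq0 : q ≠ 0) (hq : q ≠ ∞) {g : ℕ → Space d → ℝ}
    {g₀ : Space d → ℝ} {M R : ℝ} (hm : ∀ n, AEStronglyMeasurable (g n) volume)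
    (hm₀ : AEStronglyMeasurable g₀ volume) (hM : ∀ n x, ‖g n x‖ ≤ M)
    (hR : ∀ᶠ n in atTop, ∀ x, R < ‖x‖ → g n x = 0)
    (hlim : ∀ x, Tendsto (fun n => g n x) atTop (𝓝 (g₀ x))) :
    Tendsto (fun n => eLpNorm (g n - g₀) q volume) atTop (𝓝 0) := by
  have hb : ∀ᶠ n in atTop, ∀ x, ‖g n x‖ ≤ (Metric.closedBall (0 : Space d) R).indicator
      (fun _ => M) x := by
    filter_upwards [hR] with n hn x
    by_cases hx : x ∈ Metric.closedBall (0 : Space d) R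
    · rw [indicator_of_mem hx]; exact hM n x
    · rw [indicator_of_notMem hx, hn x, norm_zero]
      rwa [mem_closedBall_zero_iff, not_le] at hx
  refine tendsto_eLpNorm_sub_of_dominated hq0 hq (b := (Metric.closedBall 0 R).indicator fun _ => M)
    hm (memLp_indicator_const _ measurableSet_closedBall _ (Or.inr measure_closedBall_lt_top.ne))
    (hb.mono fun n hn => Eventually.of_forall hn) hm₀ (Eventually.of_forall fun x => ?_)
    (Eventually.of_forall hlim)
  exact le_of_tendsto (hlim x).norm (hb.mono fun n hn => hn x)

theorem IsTestFunction.continuous {η : Space d → ℝ} (hη : IsTestFunction η) : Continuous η :=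
  hη.1.continuous

theorem IsTestFunction.memLp {η : Space d → ℝ} (hη : IsTestFunction η) : MemLp η q volume :=
  hη.continuous.memLp_of_hasCompactSupport hη.2

theorem IsTestFunction.exists_bound {η : Space d → ℝ} (hη : IsTestFunction η) :
    ∃ M, ∀ x, ‖η x‖ ≤ M := hη.continuous.bounded_above_of_compact_support hη.2

theorem exists_radius_of_hasCompactSupport {η : Space d → ℝ} (hη : HasCompactSupport η) :
    ∃ R, ∀ x, R < ‖x‖ → η x = 0 := by
  obtain ⟨R, hR⟩ := hη.isCompact.isBounded.exists_norm_le
  refine ⟨R, fun y hy => ?_⟩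
  by_contra hne
  exact absurd (hR y (subset_tsupport _ hne)) (not_le.2 hy)

/-- The partial derivative `∂_i η`. -/
def partialDeriv (i : Fin d) (η : Space d → ℝ) (x : Space d) : ℝ := fderiv ℝ η x (basisVec i)

theorem IsTestFunction.continuous_partialDeriv {η : Space d → ℝ} (hη : IsTestFunction η)
    (i : Fin d) : Continuous (partialDeriv i η) :=
  (hη.1.continuous_fderiv (by simp)).clm_apply continuous_const

theorem IsTestFunction.memLp_partialDeriv {η : Space d → ℝ} (hη : IsTestFunction η) (i : Fin d) :
    MemLp (partialDeriv i η) q volume :=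
  (hη.continuous_partialDeriv i).memLp_of_hasCompactSupport
    (hη.2.fderiv_apply (𝕜 := ℝ) (basisVec i))

variable [Fact (1 ≤ q)]

theorem translate_toLp {η : Space d → ℝ} (hη : MemLp η q volume) (h : Space d) :
    translate q h (hη.toLp η) =
      (hη.comp_measurePreserving (measurePreserving_sub_right volume h)).toLp _ :=
  Lp.toLp_compMeasurePreserving hη (measurePreserving_sub_right volume h)

variable {ε : ℕ → ℝ}

/-- The quotients are bounded by the Lipschitz constant of η and, once ε < 1, supported in a ball of
radius R + 1; dominated convergence does the rest. The limit is negative because η is evaluated at x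
- εe_i. -/
theorem IsTestFunction.tendsto_quotient (hq : q ≠ ∞) (hε : ∀ n, 0 < ε n)
    (hε0 : Tendsto ε atTop (𝓝 0)) {η : Space d → ℝ} (hη : IsTestFunction η) (i : Fin d) :
    Tendsto (fun n => (ε n)⁻¹ • (translate q (ε n • basisVec i) (hη.memLp.toLp η) - hη.memLp.toLp η))
      atTop (𝓝 (-(hη.memLp_partialDeriv i).toLp _)) := by
  have hm : ∀ n, MemLp ((ε n)⁻¹ • ((η ∘ fun x => x - ε n • basisVec i) - η)) q volume := fun n =>
    ((hη.memLp.comp_measurePreserving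
      (measurePreserving_sub_right volume (ε n • basisVec i))).sub hη.memLp).const_smul _
  have e : ∀ n, (ε n)⁻¹ • (translate q (ε n • basisVec i) (hη.memLp.toLp η) - hη.memLp.toLp η)
      = (hm n).toLp _ := fun n => by
    rw [translate_toLp, ← MemLp.toLp_sub, ← MemLp.toLp_const_smul]
  simp_rw [e]
  rw [← MemLp.toLp_neg, Lp.tendsto_Lp_iff_tendsto_eLpNorm'']
  obtain ⟨R, hR⟩ := exists_radius_of_hasCompactSupport hη.2
  obtain ⟨L, hL⟩ := hη.1.lipschitzWith_of_hasCompactSupport hη.2 (by simp)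
  have hbv : ‖(basisVec i : Space d)‖ = 1 := by simp
  refine tendsto_eLpNorm_sub_of_bounded_support (M := L) (R := R + 1)
    (zero_lt_one.trans_le (Fact.out : 1 ≤ q)).ne' hq (fun n => (hm n).1)
    (hη.memLp_partialDeriv (q := q) i).neg.1 ?_ ?_ ?_
  · intro n x
    rw [Pi.smul_apply, Pi.sub_apply, Function.comp_apply, norm_smul, norm_inv, Real.norm_eq_abs,
      abs_of_pos (hε n), inv_mul_le_iff₀ (hε n)]
    have := hL.dist_le_mul (x - ε n • basisVec i) x
    rw [dist_eq_norm, dist_eq_norm, sub_sub_cancel_left, norm_neg, norm_smul, hbv, mul_one,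
      Real.norm_eq_abs (ε n), abs_of_pos (hε n)] at this
    linarith
  · filter_upwards [hε0.eventually (gt_mem_nhds zero_lt_one)] with n hn x hx
    have h1 : ‖ε n • (basisVec i : Space d)‖ = ε n := by
      rw [norm_smul, hbv, mul_one, Real.norm_eq_abs, abs_of_pos (hε n)]
    have h2 := norm_sub_norm_le x (ε n • basisVec i)
    rw [Pi.smul_apply, Pi.sub_apply, Function.comp_apply, hR x (by linarith), hR _ (by linarith),
      sub_zero, smul_zero]
  · intro x
    have hd : HasFDerivAt η (fderiv ℝ η x) x :=
      ((hη.1.differentiable (by simp)) x).hasFDerivAt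
    have hl : HasDerivAt (fun t : ℝ => η (x + t • basisVec i)) (partialDeriv i η x) 0 := by
      have h1 : HasDerivAt (fun t : ℝ => x + t • (basisVec i : Space d)) (basisVec i) 0 := by
        simpa using ((hasDerivAt_id (0 : ℝ)).smul_const (basisVec i : Space d)).const_add x
      have h2 : HasFDerivAt η (fderiv ℝ η x) (x + (0 : ℝ) • (basisVec i : Space d)) := by
        simpa using hd
      exact h2.comp_hasDerivAt 0 h1
    have hs := hl.tendsto_slope
    -- The slope of t ↦ η(x + te_i) at 0 is taken along t = -ε, matching the backward translation.
    have hne : Tendsto (fun n => -ε n) atTop (𝓝[≠] 0) := by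
      refine tendsto_nhdsWithin_iff.2 ⟨by simpa using hε0.neg, Eventually.of_forall fun n => ?_⟩
      simpa using (hε n).ne'
    refine ((hs.comp hne).neg).congr fun n => ?_
    simp only [Function.comp_apply, slope_def_field, Pi.smul_apply, Pi.sub_apply, smul_eq_mul,
      zero_smul, add_zero, sub_zero, neg_smul, ← sub_eq_add_neg]
    rw [div_neg, neg_neg, div_eq_inv_mul]

theorem IsTestFunction.tendsto_translate (hq : q ≠ ∞) (hε : ∀ n, 0 < ε n)
    (hε0 : Tendsto ε atTop (𝓝 0)) {η : Space d → ℝ} (hη : IsTestFunction η) (i : Fin d) :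
    Tendsto (fun n => translate q (ε n • basisVec i) (hη.memLp.toLp η)) atTop
      (𝓝 (hη.memLp.toLp η)) := by
  have h := (hε0.smul (hη.tendsto_quotient hq hε hε0 i)).add_const (hη.memLp.toLp η)
  rw [zero_smul, zero_add] at h
  refine h.congr fun n => ?_
  rw [smul_smul, mul_inv_cancel₀ (hε n).ne', one_smul, sub_add_cancel]

/-- Test functions are dense in L^q; this carries closed conditions from test functions to all
weights. -/
theorem mem_of_forall_testFunction (hq : q ≠ ∞) {S : Set (Lp ℝ q (volume : Measure (Space d)))}
    (hS : IsClosed S) (h : ∀ (η : Space d → ℝ) (hη : IsTestFunction η), hη.memLp.toLp η ∈ S)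
    (g : Lp ℝ q (volume : Measure (Space d))) : g ∈ S := by
  have hd := Lp.dense_hasCompactSupport_contDiff (E := Space d) (F := ℝ)
    (μ := (volume : Measure (Space d))) hq
  refine closure_minimal ?_ hS (hd g)
  rintro f ⟨η, hf, hc, hsm⟩
  have hη : IsTestFunction η := ⟨hsm, hc⟩
  have : f = hη.memLp.toLp η := by
    rw [Lp.ext_iff]
    exact hf.trans hη.memLp.coeFn_toLp.symm
  rw [this]
  exact h η hη

end TestFunctions

/-! ### Potential fields on Ω -/

section Potential

variable {d : ℕ} {Ω : Type*} [MeasurableSpace Ω] {P : Measure Ω} [IsProbabilityMeasure P]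
  [AddAction (Lattice d) Ω] [MeasurableConstVAdd (Lattice d) Ω]
  [VAddInvariantMeasure (Lattice d) Ω P] {p q : ℝ≥0∞} [Fact (1 ≤ p)]

/-- The horizontal derivative `φ ↦ (φ ∘ T_{e_i} - φ)_i`. -/
def horizontalGrad (P : Measure Ω) [VAddInvariantMeasure (Lattice d) Ω P] (p : ℝ≥0∞)
    [Fact (1 ≤ p)] : Lp ℝ p P →ₗ[ℝ] (Fin d → Lp ℝ p P) :=
  LinearMap.pi fun i => (probShift P p (latticeBasis i)).toLinearMap - LinearMap.id

theorem horizontalGrad_apply (φ : Lp ℝ p P) (i : Fin d) :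
    horizontalGrad P p φ i = probShift P p (latticeBasis i) φ - φ := rfl

/-- The potential fields as a closed subspace. -/
def potSubmodule (P : Measure Ω) [VAddInvariantMeasure (Lattice d) Ω P] (p : ℝ≥0∞)
    [Fact (1 ≤ p)] : Submodule ℝ (Fin d → Lp ℝ p P) :=
  (LinearMap.range (horizontalGrad P p)).topologicalClosure

theorem coe_potSubmodule : (potSubmodule (d := d) P p : Set (Fin d → Lp ℝ p P)) = potSet d P p := by
  rw [potSubmodule, Submodule.topologicalClosure_coe, potSet]
  congr 1
  ext ψ
  simp only [SetLike.mem_coe, LinearMap.mem_range, mem_ofPred_eq]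
  refine exists_congr fun φ => ?_
  rw [funext_iff]
  refine forall_congr' fun i => ?_
  rw [horizontalGrad_apply, eq_comm, Lp.ext_iff]
  have h : (probShift P p (latticeBasis i) φ - φ : Lp ℝ p P) =ᵐ[P]
      fun ω => φ (latticeBasis i +ᵥ ω) - φ ω := by
    filter_upwards [Lp.coeFn_sub (probShift P p (latticeBasis i) φ) φ,
      coeFn_probShift (latticeBasis i) φ] with ω h1 h2
    rw [h1, Pi.sub_apply, h2]
  exact ⟨fun h' => h'.trans h, fun h' => h'.trans h.symm⟩

/-- The expectation as a continuous linear functional on `L^p(Ω)`. -/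
def expectL (P : Measure Ω) [IsProbabilityMeasure P] (p : ℝ≥0∞) [Fact (1 ≤ p)] :
    Lp ℝ p P →L[ℝ] ℝ :=
  LinearMap.mkContinuous
    { toFun := fun φ => ∫ ω, φ ω ∂P
      map_add' := fun φ ψ => by
        rw [← integral_add ((Lp.memLp φ).integrable Fact.out) ((Lp.memLp ψ).integrable Fact.out)]
        exact integral_congr_ae (Lp.coeFn_add φ ψ)
      map_smul' := fun c φ => by
        rw [RingHom.id_apply, ← integral_smul]
        exact integral_congr_ae (Lp.coeFn_smul c φ) }
    1 fun φ => by
      rw [one_mul]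
      change ‖∫ ω, φ ω ∂P‖ ≤ _
      refine (norm_integral_le_integral_norm _).trans ?_
      rw [Lp.norm_def]
      have h1 : eLpNorm φ 1 P ≤ eLpNorm φ p P :=
        eLpNorm_le_eLpNorm_of_exponent_le Fact.out (Lp.memLp φ).1
      rw [integral_norm_eq_lintegral_enorm (Lp.memLp φ).1, ← eLpNorm_one_eq_lintegral_enorm]
      exact ENNReal.toReal_mono (Lp.eLpNorm_ne_top φ) h1

theorem expectL_apply (φ : Lp ℝ p P) : expectL P p φ = ∫ ω, φ ω ∂P := rfl

/-- Shifts preserve P, so S_i φ - φ has mean zero, and this persists in the closure. -/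
theorem expectL_eq_zero_of_mem_pot {ψ : Fin d → Lp ℝ p P} (hψ : ψ ∈ potSubmodule P p) (i : Fin d) :
    expectL P p (ψ i) = 0 := by
  have hc : IsClosed {ψ : Fin d → Lp ℝ p P | expectL P p (ψ i) = 0} :=
    isClosed_eq ((expectL P p).continuous.comp (continuous_apply i)) continuous_const
  refine closure_minimal ?_ hc hψ
  rintro _ ⟨φ, rfl⟩
  rw [mem_ofPred_eq, horizontalGrad_apply, map_sub, expectL_apply, expectL_apply, integral_probShift,
    sub_self]

end Potential

/-! ### Passing to the limit in the gradient identity -/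

section WeakLimits

variable {d : ℕ} {Ω : Type*} [MeasurableSpace Ω] {P : Measure Ω} [IsProbabilityMeasure P]
  [AddAction (Lattice d) Ω] [MeasurableConstVAdd (Lattice d) Ω]
  [VAddInvariantMeasure (Lattice d) Ω P] {p q : ℝ≥0∞} [Fact (1 ≤ p)] [Fact (1 ≤ q)]
  [ENNReal.HolderConjugate p q] [Fact (p ≠ ∞)] {ε : ℕ → ℝ}

theorem WeakTendsto.slice_tendsto {f : ℕ → FieldLp d P p} {U : FieldLp d P p} (h : WeakTendsto f U)
    {g : ℕ → Lp ℝ q (volume : Measure (Space d))} {g₀ : Lp ℝ q (volume : Measure (Space d))}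
    (hg : Tendsto g atTop (𝓝 g₀)) :
    WeakTendsto (fun n => slice P volume (f n) (g n)) (slice P volume U g₀) :=
  h.bilin (slice P volume) hg

variable {u : ℕ → Ω × Lattice d → ℝ} {γ : ℝ}

/-- In `slice_unfold_grad` multiplied by ε^(1-γ) the gradient term tends to 0 by boundedness, while
the right side converges weakly to S_i ∫ U η - ∫ U η. -/
theorem slice_mem_invSet (hε : ∀ n, 0 < ε n) (hε0 : Tendsto ε atTop (𝓝 0)) (hγ : γ < 1)
    (hq : q ≠ ∞)
    (hf : ∀ n, MemLp (unfold (ε n) (u n)) p (P.prod volume)) {U : FieldLp d P p}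
    (hU : WeakTendsto (fun n => ((hf n).toLp _ : FieldLp d P p)) U)
    (hF : ∀ i n, MemLp (unfold (ε n) fun z => ε n ^ γ * discreteGrad (ε n) (u n) z i) p
      (P.prod volume)) {C : ℝ} (hC : ∀ i n, ‖((hF i n).toLp _ : FieldLp d P p)‖ ≤ C)
    (g : Lp ℝ q (volume : Measure (Space d))) : slice P volume U g ∈ invSet d P p := by
  refine mem_invSet_of_basis fun i => ?_
  refine mem_of_forall_testFunction hq (S := {g | probShift P p (latticeBasis i)
    (slice P volume U g) = slice P volume U g}) (isClosed_eq ((probShift P p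
      (latticeBasis i)).continuous.comp (slice P volume U).continuous)
      (slice P volume U).continuous) (fun η hη => ?_) g
  have hc : Tendsto (fun n => ε n ^ (1 - γ)) atTop (𝓝 0) := by
    have := ((Real.continuousAt_rpow_const 0 (1 - γ) (Or.inr (by linarith))).tendsto).comp hε0
    rwa [Real.zero_rpow (by linarith)] at this
  have h1 : Tendsto (fun n => ε n ^ (1 - γ) • slice P volume ((hF i n).toLp _)
      ((hη.memLp (q := q)).toLp η)) atTop (𝓝 0) := by
    have h3 : Tendsto (fun n => ε n ^ (1 - γ) * (C * ‖(hη.memLp (q := q)).toLp η‖)) atTop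
        (𝓝 0) := by
      simpa using hc.mul_const (C * ‖(hη.memLp (q := q)).toLp η‖)
    refine squeeze_zero_norm (fun n => ?_) h3
    rw [norm_smul, Real.norm_eq_abs, abs_of_nonneg (Real.rpow_nonneg (hε n).le _)]
    exact mul_le_mul_of_nonneg_left ((norm_slice_le _ _).trans
      (mul_le_mul_of_nonneg_right (hC i n) (norm_nonneg _))) (Real.rpow_nonneg (hε n).le _)
  have h2 := ((hU.slice_tendsto (hη.tendsto_translate hq hε hε0 i)).map
    (probShift P p (latticeBasis i)).toContinuousLinearMap).sub
    (hU.map ((slice P volume).flip ((hη.memLp (q := q)).toLp η)))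
  have h3 := h1.weakTendsto.unique (y := probShift P p (latticeBasis i)
    (slice P volume U ((hη.memLp (q := q)).toLp η)) - slice P volume U ((hη.memLp (q := q)).toLp η)) (by
      refine Eq.subst (motive := fun f => WeakTendsto f _) (funext fun n => ?_) h2
      rw [slice_unfold_grad (hε n) (hf n) (hF i n), smul_smul]
      have : ε n ^ (1 - γ) * (ε n ^ γ / ε n) = 1 := by
        rw [← mul_div_assoc, ← Real.rpow_add (hε n), sub_add_cancel, Real.rpow_one,
          div_self (hε n).ne']
      rw [this, one_smul]
      rfl)
  exact (sub_eq_zero.1 h3.symm)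

/-- Splitting η(· - εe_i) = η + ε · quotient in `slice_unfold_grad` exhibits the i-th slice of the
rescaled gradient as (S_i - 1)φ_n plus ε^γ S_i applied to a slice against the quotient. The
gradients of φ_n converge weakly, and their limit stays in the closed subspace. -/
theorem slice_add_mem_potSubmodule (hε : ∀ n, 0 < ε n) (hε0 : Tendsto ε atTop (𝓝 0))
    (hq : q ≠ ∞) {κ : ℝ} (hκ : Tendsto (fun n => ε n ^ γ) atTop (𝓝 κ))
    (hf : ∀ n, MemLp (unfold (ε n) (u n)) p (P.prod volume)) {U : FieldLp d P p}
    (hU : WeakTendsto (fun n => ((hf n).toLp _ : FieldLp d P p)) U)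
    (hF : ∀ i n, MemLp (unfold (ε n) fun z => ε n ^ γ * discreteGrad (ε n) (u n) z i) p
      (P.prod volume)) {V : Fin d → FieldLp d P p}
    (hV : ∀ i, WeakTendsto (fun n => ((hF i n).toLp _ : FieldLp d P p)) (V i))
    {η : Space d → ℝ} (hη : IsTestFunction η) :
    (fun i => slice P volume (V i) ((hη.memLp (q := q)).toLp η) + κ • probShift P p (latticeBasis i)
      (slice P volume U ((hη.memLp_partialDeriv (q := q) i).toLp _))) ∈ potSubmodule P p := by
  -- For γ < 1 the scalar ε^(γ-1) blows up, so no bound on φ_n is available; only its horizontal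
  -- gradient needs to converge.
  let φ : ℕ → Lp ℝ p P := fun n =>
    (ε n ^ γ / ε n) • slice P volume ((hf n).toLp _) ((hη.memLp (q := q)).toLp η)
  refine WeakTendsto.mem_of_isClosed (f := fun n => horizontalGrad P p (φ n))
    (Submodule.isClosed_topologicalClosure _) (WeakTendsto.pi fun i => ?_)
    fun n => Submodule.le_topologicalClosure _ ⟨φ n, rfl⟩
  have h1 := ((hU.slice_tendsto (hη.tendsto_quotient hq hε hε0 i)).map
    (probShift P p (latticeBasis i)).toContinuousLinearMap).smul hκ
  have h2 := ((hV i).map ((slice P volume).flip ((hη.memLp (q := q)).toLp η))).sub h1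
  convert h2 using 1
  · ext1 n
    simp only [ContinuousLinearMap.flip_apply, LinearIsometry.coe_toContinuousLinearMap]
    rw [slice_unfold_grad (hε n) (hf n) (hF i n), horizontalGrad_apply]
    simp only [φ, map_smul, map_sub]
    module
  · simp only [ContinuousLinearMap.flip_apply, LinearIsometry.coe_toContinuousLinearMap, map_neg]
    module

end WeakLimits

/-! ### Expectation, deterministic fields and the tensor spaces -/

section Mean

variable {d : ℕ} {Ω : Type*} [MeasurableSpace Ω] {P : Measure Ω} [IsProbabilityMeasure P]
  {p q : ℝ≥0∞} [Fact (1 ≤ p)] [Fact (1 ≤ q)] [ENNReal.HolderConjugate p q] [Fact (p ≠ ∞)]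

/-- The expectation as an operator from `L^p(Ω × ℝ^d)` to `L^p(ℝ^d)`. -/
def meanL (d : ℕ) (P : Measure Ω) [IsProbabilityMeasure P] (p q : ℝ≥0∞) [Fact (1 ≤ p)]
    [Fact (1 ≤ q)] [ENNReal.HolderConjugate p q] [Fact (p ≠ ∞)] :
    FieldLp d P p →L[ℝ] Lp ℝ p (volume : Measure (Space d)) :=
  ((slice volume P).flip (Lp.const q P (1 : ℝ))) ∘L
    (Lp.compMeasurePreservingₗᵢ ℝ Prod.swap
      (Measure.measurePreserving_swap (μ := (volume : Measure (Space d))) (ν := P)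
        )).toContinuousLinearMap

theorem coeFn_meanL (U : FieldLp d P p) :
    meanL d P p q U =ᵐ[volume] fun x => ∫ ω, U (ω, x) ∂P := by
  have hsw := Measure.measurePreserving_swap (μ := (volume : Measure (Space d))) (ν := P)
  have h1 := coeFn_slice (μ := (volume : Measure (Space d))) (ν := P)
    (Lp.compMeasurePreservingₗᵢ ℝ Prod.swap hsw U) (Lp.const q P (1 : ℝ))
  have h2 : (Lp.compMeasurePreservingₗᵢ ℝ Prod.swap hsw U : Lp ℝ p (volume.prod P))
      =ᵐ[volume.prod P] U ∘ Prod.swap := Lp.coeFn_compMeasurePreserving U hsw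
  filter_upwards [h1, Measure.ae_ae_of_ae_prod h2] with x a1 a2
  change slice volume P (Lp.compMeasurePreservingₗᵢ ℝ Prod.swap hsw U) (Lp.const q P (1 : ℝ)) x = _
  rw [a1]
  refine integral_congr_ae ?_
  filter_upwards [a2, Lp.coeFn_const (p := q) (μ := P) (1 : ℝ)] with ω b1 b2
  rw [b1, b2]
  simp

theorem coeFn_meanL_toLp {f : Ω × Space d → ℝ} (hf : MemLp f p (P.prod volume)) :
    meanL d P p q (hf.toLp f) =ᵐ[volume] fun x => ∫ ω, f (ω, x) ∂P := by
  have h : ∀ᵐ z ∂((volume : Measure (Space d)).prod P), hf.toLp f z.swap = f z.swap :=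
    Measure.measurePreserving_swap.quasiMeasurePreserving.ae hf.coeFn_toLp
  filter_upwards [coeFn_meanL (q := q) (hf.toLp f), Measure.ae_ae_of_ae_prod h] with x h1 h2
  rw [h1]
  exact integral_congr_ae h2

/-- Deterministic fields in `L^p(Ω × ℝ^d)`. -/
def determL (d : ℕ) (P : Measure Ω) [IsProbabilityMeasure P] (p : ℝ≥0∞) [Fact (1 ≤ p)]
    [Fact (p ≠ ∞)] : Lp ℝ p (volume : Measure (Space d)) →L[ℝ] FieldLp d P p :=
  tensor p P volume (Lp.const p P (1 : ℝ))

theorem coeFn_determL (η : Lp ℝ p (volume : Measure (Space d))) :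
    determL d P p η =ᵐ[P.prod volume] fun z => η z.2 := by
  filter_upwards [coeFn_tensor (Lp.const p P (1 : ℝ)) η,
    Measure.quasiMeasurePreserving_fst.ae (Lp.coeFn_const (p := p) (μ := P) (1 : ℝ))] with z h1 h2
  change tensor p P volume (Lp.const p P (1 : ℝ)) η z = _
  rw [h1, h2]
  simp

theorem meanL_determL (η : Lp ℝ p (volume : Measure (Space d))) :
    meanL d P p q (determL d P p η) = η := by
  have h : ∀ᵐ z ∂((volume : Measure (Space d)).prod P), determL d P p η z.swap = η z.1 :=
    Measure.measurePreserving_swap.quasiMeasurePreserving.ae (coeFn_determL η)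
  rw [Lp.ext_iff]
  filter_upwards [coeFn_meanL (q := q) (determL d P p η), Measure.ae_ae_of_ae_prod h] with x h1 h2
  have h3 : ∫ ω, determL d P p η (ω, x) ∂P = ∫ _, η x ∂P := integral_congr_ae h2
  rw [h1, h3]
  simp

theorem pairing_meanL (U : FieldLp d P p) (g : Lp ℝ q (volume : Measure (Space d))) :
    pairing volume p q (meanL d P p q U) g = expectL P p (slice P volume U g) := by
  rw [pairing_apply, expectL_apply, integral_congr_ae (coeFn_slice U g)]
  have hint : Integrable (fun z : Ω × Space d => U z * g z.2) (P.prod volume) :=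
    (Lp.memLp U).integrable_mul
      ((Lp.memLp g).comp_measurePreserving (measurePreserving_snd (μ := P)))
  rw [integral_integral_swap (f := fun ω x => U (ω, x) * g x) hint]
  refine integral_congr_ae ?_
  filter_upwards [coeFn_meanL (q := q) U] with x hx
  rw [hx, integral_mul_const]

theorem slice_determL (η : Lp ℝ p (volume : Measure (Space d)))
    (g : Lp ℝ q (volume : Measure (Space d))) :
    slice P volume (determL d P p η) g = pairing volume p q η g • Lp.const p P (1 : ℝ) :=
  slice_tensor _ _ _

variable [AddAction (Lattice d) Ω] [MeasurableConstVAdd (Lattice d) Ω]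
  [VAddInvariantMeasure (Lattice d) Ω P]

theorem eq_smul_const_of_mem_invSet (hErg : IsErgodic d P) {φ : Lp ℝ p P}
    (hφ : φ ∈ invSet d P p) : φ = expectL P p φ • Lp.const p P (1 : ℝ) := by
  rw [Lp.ext_iff]
  filter_upwards [eq_const_of_mem_invSet hErg hφ, Lp.coeFn_smul (expectL P p φ)
    (Lp.const p P (1 : ℝ)), Lp.coeFn_const (p := p) (μ := P) (1 : ℝ)] with ω h1 h2 h3
  rw [h1, h2, Pi.smul_apply, h3, expectL_apply]
  simp

theorem const_mem_invSet : Lp.const p P (1 : ℝ) ∈ invSet d P p := by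
  intro x
  have h := Lp.coeFn_const (p := p) (μ := P) (1 : ℝ)
  filter_upwards [h, ae_vadd x h] with ω h1 h2
  rw [h1, h2]
  rfl

theorem probShift_const (x : Lattice d) :
    probShift P p x (Lp.const p P (1 : ℝ)) = Lp.const p P (1 : ℝ) := by
  rw [Lp.ext_iff]
  exact (coeFn_probShift x _).trans (const_mem_invSet x)

/-- Each slice is constant by ergodicity and equals its mean, which is the pairing of ⟨U⟩ with the
weight. So U and ⟨U⟩ have the same slices. -/
theorem eq_determL_of_slice_mem_invSet (hErg : IsErgodic d P) {U : FieldLp d P p}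
    (h : ∀ g : Lp ℝ q (volume : Measure (Space d)), slice P volume U g ∈ invSet d P p) :
    U = determL d P p (meanL d P p q U) := by
  rw [← sub_eq_zero]
  refine eq_zero_of_slice_eq_zero (q := q) fun g => ?_
  rw [map_sub, sub_apply, slice_determL, pairing_meanL,
    ← eq_smul_const_of_mem_invSet hErg (h g), sub_self]

theorem mem_potTensorLp_of_slice (hq : q ≠ ∞) {W : Fin d → FieldLp d P p}
    (h : ∀ (η : Space d → ℝ) (hη : IsTestFunction η),
      (fun i => slice P volume (W i) ((hη.memLp (q := q)).toLp η)) ∈ potSubmodule P p) :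
    W ∈ potTensorLp d P p := by
  have hall : ∀ g : Lp ℝ q (volume : Measure (Space d)),
      (fun i => slice P volume (W i) g) ∈ potSubmodule P p := fun g => by
    refine mem_of_forall_testFunction hq
      (S := {g | (fun i => slice P volume (W i) g) ∈ potSubmodule P p}) ?_ h g
    exact (Submodule.isClosed_topologicalClosure _).preimage
      (continuous_pi fun i => (slice P volume (W i)).continuous)
  have h1 := mem_closure_span_tensor (q := q) hall
  rw [potTensorLp]
  refine closure_mono (Submodule.span_mono ?_) h1
  rintro V ⟨ψ, hψ, η, hV⟩
  refine ⟨ψ, by rw [← coe_potSubmodule]; exact hψ, η, fun i => ?_⟩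
  rw [hV i]
  exact coeFn_tensor _ _

/-- The fields whose i-th component has mean zero form a closed subspace; it contains the generators
because potential fields on Ω have mean zero. -/
theorem meanL_eq_zero_of_mem_potTensorLp {χ : Fin d → FieldLp d P p} (h : χ ∈ potTensorLp d P p)
    (i : Fin d) : meanL d P p q (χ i) = 0 := by
  let S : Submodule ℝ (Fin d → FieldLp d P p) :=
    { carrier := {W | meanL d P p q (W i) = 0}
      zero_mem' := map_zero (meanL d P p q)
      add_mem' := fun {a b} (ha : meanL d P p q (a i) = 0) (hb : meanL d P p q (b i) = 0) =>
        (map_add (meanL d P p q) (a i) (b i)).trans (by rw [ha, hb, add_zero])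
      smul_mem' := fun c a (ha : meanL d P p q (a i) = 0) =>
        (map_smul (meanL d P p q) c (a i)).trans (by rw [ha, smul_zero]) }
  have hS : IsClosed (S : Set (Fin d → FieldLp d P p)) :=
    isClosed_eq ((meanL d P p q).continuous.comp (continuous_apply i)) continuous_const
  refine closure_minimal ?_ hS h
  refine Submodule.span_le.2 ?_
  rintro W ⟨ψ, hψ, η, hW⟩
  rw [← coe_potSubmodule, SetLike.mem_coe] at hψ
  change meanL d P p q (W i) = 0
  have h0 := expectL_eq_zero_of_mem_pot hψ i
  have hsw : ∀ᵐ z ∂((volume : Measure (Space d)).prod P), W i z.swap = ψ i z.2 * η z.1 :=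
    Measure.measurePreserving_swap.quasiMeasurePreserving.ae (hW i)
  have hz : meanL d P p q (W i) =ᵐ[volume] fun _ => (0 : ℝ) := by
    filter_upwards [coeFn_meanL (q := q) (W i), Measure.ae_ae_of_ae_prod hsw] with x h1 h2
    have h3 : ∫ ω, W i (ω, x) ∂P = ∫ ω, ψ i ω * η x ∂P := integral_congr_ae h2
    rw [h1, h3, integral_mul_const, ← expectL_apply, h0, zero_mul]
  exact Lp.ext (hz.trans (Lp.coeFn_zero ℝ p volume).symm)

/-- Being deterministic and satisfying the weak derivative identity are closed linear conditions on
(U, G), so they need checking only on generators φ ⊗ (η, ∇η). There ergodicity turns φ into a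
constant. -/
theorem exists_sobolev_of_mem_invTensorW1p (hErg : IsErgodic d P)
    {U : FieldLp d P p} {G : Fin d → FieldLp d P p} (h : (U, G) ∈ invTensorW1p d P p) :
    HasSobolevGradient p (meanL d P p q U) (fun i => meanL d P p q (G i)) ∧
      U = determL d P p (meanL d P p q U) ∧ ∀ i, G i = determL d P p (meanL d P p q (G i)) := by
  let M := meanL d P p q
  let J := determL d P p
  let S : Submodule ℝ (FieldLp d P p × (Fin d → FieldLp d P p)) :=
    { carrier := {W | (W.1 = J (M W.1) ∧ ∀ i, W.2 i = J (M (W.2 i))) ∧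
        ∀ (i : Fin d) (ζ : Space d → ℝ) (hζ : IsTestFunction ζ),
          pairing volume p q (M W.1) ((hζ.memLp_partialDeriv i).toLp _)
            + pairing volume p q (M (W.2 i)) (hζ.memLp.toLp _) = 0}
      zero_mem' := by simp
      add_mem' := by
        rintro a b ⟨⟨ha1, ha2⟩, ha3⟩ ⟨⟨hb1, hb2⟩, hb3⟩
        refine ⟨⟨?_, fun i => ?_⟩, fun i ζ hζ => ?_⟩
        · simp only [Prod.fst_add, map_add]; rw [← ha1, ← hb1]
        · simp only [Prod.snd_add, Pi.add_apply, map_add]; rw [← ha2, ← hb2]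
        · have h1 := ha3 i ζ hζ
          have h2 := hb3 i ζ hζ
          simp only [Prod.fst_add, Prod.snd_add, Pi.add_apply, map_add,
            add_apply]
          linarith
      smul_mem' := by
        rintro c a ⟨⟨ha1, ha2⟩, ha3⟩
        refine ⟨⟨?_, fun i => ?_⟩, fun i ζ hζ => ?_⟩
        · simp only [Prod.smul_fst, map_smul]; rw [← ha1]
        · simp only [Prod.smul_snd, Pi.smul_apply, map_smul]; rw [← ha2]
        · have h1 := ha3 i ζ hζ
          simp only [Prod.smul_fst, Prod.smul_snd, Pi.smul_apply, map_smul,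
            smul_apply, smul_eq_mul]
          rw [← mul_add, h1, mul_zero] }
  have hS : IsClosed (S : Set (FieldLp d P p × (Fin d → FieldLp d P p))) := by
    have e : (S : Set (FieldLp d P p × (Fin d → FieldLp d P p))) =
        ({W | W.1 = J (M W.1)} ∩ ⋂ i, {W | W.2 i = J (M (W.2 i))}) ∩
          ⋂ (i : Fin d) (ζ : Space d → ℝ) (hζ : IsTestFunction ζ),
            {W | pairing volume p q (M W.1) ((hζ.memLp_partialDeriv i).toLp _)
              + pairing volume p q (M (W.2 i)) (hζ.memLp.toLp _) = 0} := by
      ext W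
      simp only [mem_inter_iff, mem_iInter]
      rfl
    rw [e]
    have hMc := M.continuous
    have hJc := J.continuous
    refine IsClosed.inter (IsClosed.inter (isClosed_eq continuous_fst
      (hJc.comp (hMc.comp continuous_fst))) (isClosed_iInter fun i => ?_))
      (isClosed_iInter fun i => isClosed_iInter fun ζ => isClosed_iInter fun hζ => ?_)
    · have hi : Continuous fun W : FieldLp d P p × (Fin d → FieldLp d P p) => W.2 i :=
        (continuous_apply i).comp continuous_snd
      exact isClosed_eq hi (hJc.comp (hMc.comp hi))
    · have hi : Continuous fun W : FieldLp d P p × (Fin d → FieldLp d P p) => W.2 i :=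
        (continuous_apply i).comp continuous_snd
      have c1 := ((pairing (volume : Measure (Space d)) p q).flip
        ((hζ.memLp_partialDeriv i).toLp _)).continuous.comp (hMc.comp
          (continuous_fst (X := FieldLp d P p) (Y := Fin d → FieldLp d P p)))
      have c2 := ((pairing (volume : Measure (Space d)) p q).flip
        (hζ.memLp.toLp ζ)).continuous.comp (hMc.comp hi)
      exact isClosed_eq (c1.add c2) continuous_const
  have hgen : (U, G) ∈ S := by
    refine closure_minimal ?_ hS h
    refine Submodule.span_le.2 ?_
    rintro W ⟨φ, hφ, η, g, hηg, hW1, hW2⟩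
    have hconst := eq_const_of_mem_invSet hErg hφ
    set c := ∫ ω, φ ω ∂P with hc
    have key : ∀ (V : FieldLp d P p) (v : Space d → ℝ) (hv : MemLp v p volume),
        V =ᵐ[P.prod volume] (fun z => φ z.1 * v z.2) → V = J (c • hv.toLp v) := by
      intro V v hv hV
      rw [Lp.ext_iff]
      filter_upwards [hV, coeFn_determL (P := P) (c • hv.toLp v),
        Measure.quasiMeasurePreserving_fst.ae hconst, Measure.quasiMeasurePreserving_snd.ae
          (Lp.coeFn_smul c (hv.toLp v)), Measure.quasiMeasurePreserving_snd.ae hv.coeFn_toLp]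
        with z h1 h2 h3 h4 h5
      rw [h1, h2, h3, h4, Pi.smul_apply, h5, smul_eq_mul]
    have k1 := key W.1 η hηg.memLp hW1
    have k2 := fun i => key (W.2 i) (g i) (hηg.memLp_grad i) (hW2 i)
    have m1 : M W.1 = c • hηg.memLp.toLp η := by rw [k1]; exact meanL_determL _
    have m2 : ∀ i, M (W.2 i) = c • (hηg.memLp_grad i).toLp (g i) := fun i => by
      rw [k2 i]; exact meanL_determL _
    refine ⟨⟨by rw [m1]; exact k1, fun i => by rw [m2]; exact k2 i⟩, fun i ζ hζ => ?_⟩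
    rw [m1, m2, map_smul, map_smul, smul_apply, smul_apply,
      ← smul_add, pairing_apply, pairing_apply]
    have i1 : ∫ x, hηg.memLp.toLp η x * (hζ.memLp_partialDeriv (q := q) i).toLp _ x
        = ∫ x, η x * fderiv ℝ ζ x (EuclideanSpace.single i 1) := by
      refine integral_congr_ae ?_
      filter_upwards [hηg.memLp.coeFn_toLp, (hζ.memLp_partialDeriv (q := q) i).coeFn_toLp]
        with x h1 h2
      rw [h1, h2]
      rfl
    have i2 : ∫ x, (hηg.memLp_grad i).toLp (g i) x * (hζ.memLp (q := q)).toLp _ x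
        = ∫ x, g i x * ζ x := by
      refine integral_congr_ae ?_
      filter_upwards [(hηg.memLp_grad i).coeFn_toLp, (hζ.memLp (q := q)).coeFn_toLp] with x h1 h2
      rw [h1, h2]
    rw [i1, i2, hηg.integral_eq i ζ hζ, neg_add_cancel, smul_zero]
  obtain ⟨⟨h1, h2⟩, h3⟩ := hgen
  refine ⟨⟨Lp.memLp _, fun i => Lp.memLp _, fun i ζ hζ => ?_⟩, h1, h2⟩
  have h4 := h3 i ζ hζ
  rw [pairing_apply, pairing_apply] at h4
  have i1 : ∫ x, M U x * (hζ.memLp_partialDeriv (q := q) i).toLp _ x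
      = ∫ x, M U x * fderiv ℝ ζ x (EuclideanSpace.single i 1) := by
    refine integral_congr_ae ?_
    filter_upwards [(hζ.memLp_partialDeriv (q := q) i).coeFn_toLp] with x h2
    rw [h2]
    rfl
  have i2 : ∫ x, M (G i) x * (hζ.memLp (q := q)).toLp _ x = ∫ x, M (G i) x * ζ x := by
    refine integral_congr_ae ?_
    filter_upwards [(hζ.memLp (q := q)).coeFn_toLp] with x h2
    rw [h2]
  rw [← i1, ← i2]
  linarith

end Mean

/-! ### Sampling test functions at lattice points -/

section CellCenter

variable {d : ℕ} {q : ℝ≥0∞} [Fact (1 ≤ q)] {ε : ℕ → ℝ}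

theorem cell_latticePoint {ε : ℝ} (hε : 0 < ε) (z : Lattice d) : cell ε (latticePoint ε z) = z := by
  ext i
  change ⌊ε * (z i : ℝ) / ε + 1 / 2⌋ = z i
  rw [mul_div_cancel_left₀ _ hε.ne', Int.floor_intCast_add]
  norm_num

/-- Sampling of a function at the centers of the cells. -/
def sample (ε : ℝ) (η : Space d → ℝ) : Space d → ℝ := interp ε fun z => η (latticePoint ε z)

theorem dist_center_le {ε : ℝ} (hε : 0 < ε) (x : Space d) :
    dist (latticePoint ε (cell ε x)) x ≤ √d * ε :=
  dist_le_of_cell_eq hε (cell_latticePoint hε _)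

theorem tendsto_center (hε : ∀ n, 0 < ε n) (hε0 : Tendsto ε atTop (𝓝 0)) (x : Space d) :
    Tendsto (fun n => latticePoint (ε n) (cell (ε n) x)) atTop (𝓝 x) := by
  rw [tendsto_iff_dist_tendsto_zero]
  refine squeeze_zero (fun _ => dist_nonneg) (fun n => dist_center_le (hε n) x) ?_
  simpa using hε0.const_mul (√d)

theorem IsTestFunction.memLp_sample {η : Space d → ℝ} (hη : IsTestFunction η) {ε : ℝ} (hε : 0 < ε) :
    MemLp (sample ε η) q volume := by
  obtain ⟨M, hM⟩ := hη.exists_bound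
  obtain ⟨R, hR⟩ := exists_radius_of_hasCompactSupport hη.2
  refine (memLp_indicator_const q (measurableSet_closedBall (x := (0 : Space d)) (ε := R + √d * ε))
    M (Or.inr measure_closedBall_lt_top.ne)).mono (measurable_interp ε _).aestronglyMeasurable
    (Eventually.of_forall fun x => ?_)
  by_cases hx : x ∈ Metric.closedBall (0 : Space d) (R + √d * ε)
  · rw [indicator_of_mem hx]
    exact (hM _).trans (le_abs_self M)
  · rw [indicator_of_notMem hx, norm_zero]
    rw [mem_closedBall_zero_iff, not_le] at hx
    have h1 := dist_center_le hε x
    rw [dist_comm, dist_eq_norm] at h1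
    have h2 := norm_sub_norm_le x (latticePoint ε (cell ε x))
    change ‖η (latticePoint ε (cell ε x))‖ ≤ 0
    rw [hR _ (by linarith), norm_zero]

theorem IsTestFunction.tendsto_sample (hq : q ≠ ∞) (hε : ∀ n, 0 < ε n)
    (hε0 : Tendsto ε atTop (𝓝 0)) {η : Space d → ℝ} (hη : IsTestFunction η) :
    Tendsto (fun n => (hη.memLp_sample (q := q) (hε n)).toLp _) atTop (𝓝 (hη.memLp.toLp η)) := by
  obtain ⟨M, hM⟩ := hη.exists_bound
  obtain ⟨R, hR⟩ := exists_radius_of_hasCompactSupport hη.2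
  rw [Lp.tendsto_Lp_iff_tendsto_eLpNorm'']
  have hd0 : Tendsto (fun n => √d * ε n) atTop (𝓝 0) := by simpa using hε0.const_mul (√d)
  refine tendsto_eLpNorm_sub_of_bounded_support (M := M) (R := R + 1)
    (zero_lt_one.trans_le (Fact.out : 1 ≤ q)).ne' hq
    (fun n => (measurable_interp (ε n) _).aestronglyMeasurable) hη.continuous.aestronglyMeasurable
    (fun n x => hM _) ?_ fun x => (hη.continuous.tendsto x).comp (tendsto_center hε hε0 x)
  filter_upwards [hd0.eventually (gt_mem_nhds zero_lt_one)] with n hn x hx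
  have h1 := dist_center_le (hε n) x
  rw [dist_comm, dist_eq_norm] at h1
  have h2 := norm_sub_norm_le x (latticePoint (ε n) (cell (ε n) x))
  exact hR _ (by linarith)

end CellCenter

/-! ### From two-scale limits to limits of expectations -/

section LatticeLimits

variable {d : ℕ} {Ω : Type*} [MeasurableSpace Ω] {P : Measure Ω} [IsProbabilityMeasure P]
  [AddAction (Lattice d) Ω] [MeasurableConstVAdd (Lattice d) Ω]
  [VAddInvariantMeasure (Lattice d) Ω P] {p q : ℝ≥0∞} [Fact (1 ≤ p)] [Fact (1 ≤ q)]
  [ENNReal.HolderConjugate p q] [Fact (p ≠ ∞)]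

/-- On each cell the unfolding shifts ω by a fixed T_{-z}, which does not change the expectation. -/
theorem coeFn_meanL_unfold {ε : ℝ} {w : Ω × Lattice d → ℝ}
    (hw : MemLp (unfold ε w) p (P.prod volume)) :
    meanL d P p q (hw.toLp _) =ᵐ[volume] interp ε (expect P w) := by
  filter_upwards [coeFn_meanL_toLp (q := q) hw] with x hx
  rw [hx]
  exact integral_vadd_eq_self (μ := P) (g := -cell ε x) fun ω => w (ω, cell ε x)

theorem interp_expect_memLp {ε : ℝ} {w : Ω × Lattice d → ℝ} (q : ℝ≥0∞) [Fact (1 ≤ q)]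
    [ENNReal.HolderConjugate p q] (hw : MemLp (unfold ε w) p (P.prod volume)) :
    MemLp (interp ε (expect P w)) p volume :=
  (memLp_congr_ae (coeFn_meanL_unfold (q := q) hw)).1 (Lp.memLp _)

theorem memLp_latticeMeasure_of_interp {ε : ℝ} (hε : 0 < ε) {v : Lattice d → ℝ}
    (hv : MemLp (interp ε v) p volume) : MemLp v p (latticeMeasure d ε) :=
  ⟨(measurable_of_countable v).aestronglyMeasurable, (eLpNorm_interp hε v).symm.trans_lt hv.2⟩

theorem integral_lattice_mul {ε : ℝ} (hε : 0 < ε) (v : Lattice d → ℝ) (η : Space d → ℝ) :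
    ∫ z, v z * η (latticePoint ε z) ∂latticeMeasure d ε = ∫ x, interp ε v x * sample ε η x := by
  rw [← (measurePreserving_cell hε).map_eq, integral_map (measurable_cell ε).aemeasurable
    (measurable_of_countable _).aestronglyMeasurable]
  rfl

/-- Weak convergence of the interpolations implies weak convergence of lattice functions. -/
theorem latticeTendstoWeak_of_interp (hq : q ≠ ∞) {ε : ℕ → ℝ} (hε : ∀ n, 0 < ε n)
    (hε0 : Tendsto ε atTop (𝓝 0)) {v : ℕ → Lattice d → ℝ} {V : ℕ → Lp ℝ p (volume : Measure (Space d))}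
    (hv : ∀ n, V n =ᵐ[volume] interp (ε n) (v n)) {W : Lp ℝ p (volume : Measure (Space d))}
    (hW : WeakTendsto V W) {W₀ : Space d → ℝ} (h0 : W =ᵐ[volume] W₀) :
    LatticeTendstoWeak p ε v W₀ := by
  have hm : ∀ n, MemLp (interp (ε n) (v n)) p volume := fun n =>
    (memLp_congr_ae (hv n)).1 (Lp.memLp _)
  refine ⟨fun n => memLp_latticeMeasure_of_interp (hε n) (hm n),
    (memLp_congr_ae h0).1 (Lp.memLp _), ?_, fun η hη => ?_⟩
  · obtain ⟨C, hC⟩ := hW.exists_norm_le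
    refine lt_of_le_of_lt (limsup_le_of_le (a := ENNReal.ofReal C)
      (h := Eventually.of_forall fun n => ?_)) ENNReal.ofReal_lt_top
    rw [← eLpNorm_interp (hε n), ← eLpNorm_congr_ae (hv n), ← Lp.enorm_def, ← ofReal_norm]
    exact ENNReal.ofReal_le_ofReal (hC n)
  -- Samples of η converge strongly in L^q, so their pairings with the weakly convergent V converge;
  -- the identity functional turns weak convergence in ℝ into ordinary convergence.
  · have h1 := ((hW.bilin (pairing volume p q) (hη.tendsto_sample hq hε hε0))
      (ContinuousLinearMap.id ℝ ℝ))
    simp only [ContinuousLinearMap.id_apply, pairing_apply] at h1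
    convert h1 using 2
    · rename_i n
      rw [integral_lattice_mul (hε n)]
      refine integral_congr_ae ?_
      filter_upwards [hv n, (hη.memLp_sample (q := q) (hε n)).coeFn_toLp] with x h2 h3
      rw [h2, h3]
    · refine integral_congr_ae ?_
      filter_upwards [h0, (hη.memLp (q := q)).coeFn_toLp] with x h2 h3
      rw [h2, h3]

theorem latticeTendstoWeak_expect (hq : q ≠ ∞) {ε : ℕ → ℝ} (hε : ∀ n, 0 < ε n)
    (hε0 : Tendsto ε atTop (𝓝 0)) {w : ℕ → Ω × Lattice d → ℝ}
    (hw : ∀ n, MemLp (unfold (ε n) (w n)) p (P.prod volume)) {W : FieldLp d P p}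
    (hW : WeakTendsto (fun n => ((hw n).toLp _ : FieldLp d P p)) W) {W₀ : Space d → ℝ}
    (h0 : meanL d P p q W =ᵐ[volume] W₀) :
    LatticeTendstoWeak p ε (fun n => expect P (w n)) W₀ :=
  latticeTendstoWeak_of_interp hq hε hε0 (fun n => coeFn_meanL_unfold (hw n))
    (hW.map (meanL d P p q)) h0

/-- The fluctuation `u - ⟨u⟩` converges weakly to zero if the weak limit is deterministic. -/
theorem twoScaleWeak_fluctuation {ε : ℕ → ℝ} {w : ℕ → Ω × Lattice d → ℝ}
    (hw : ∀ n, MemLp (unfold (ε n) (w n)) p (P.prod volume)) {W : FieldLp d P p}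
    (hW : WeakTendsto (fun n => ((hw n).toLp _ : FieldLp d P p)) W)
    (h0 : W = determL d P p (meanL d P p q W)) :
    TwoScaleWeak P p ε (fun n z => w n z - expect P (w n) z.2) 0 := by
  have hm : ∀ n, MemLp (fun z : Ω × Space d => interp (ε n) (expect P (w n)) z.2) p
      (P.prod volume) := fun n =>
    (interp_expect_memLp q (hw n)).comp_measurePreserving (measurePreserving_snd (μ := P))
  refine ⟨fun n => (hw n).sub (hm n), weakTendsto_iff.1 ?_⟩
  have h1 := hW.sub ((hW.map (meanL d P p q)).map (determL d P p))
  rw [← h0, sub_self] at h1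
  refine Eq.subst (motive := fun f => WeakTendsto f _) (funext fun n => ?_) h1
  -- The unfolding of ⟨w⟩ is the deterministic extension of the mean of the unfolding, a bounded
  -- linear image of the unfolded field.
  have h2 : determL d P p (meanL d P p q ((hw n).toLp _)) = (hm n).toLp _ := by
    refine Lp.ext ?_
    filter_upwards [coeFn_determL (P := P) (meanL d P p q ((hw n).toLp _)), (hm n).coeFn_toLp,
      Measure.quasiMeasurePreserving_snd.ae (coeFn_meanL_unfold (q := q) (hw n))] with z h1 h2 h3
    rw [h1, h2, h3]
  rw [h2, ← MemLp.toLp_sub]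
  rfl

section GradientLimits

variable {ε : ℕ → ℝ} {u : ℕ → Ω × Lattice d → ℝ} {γ : ℝ}

/-- Taking expectations of the potential field from `slice_add_mem_potSubmodule` gives 0 and removes
the shift: this is ⟨V_i⟩ = κ ∂_i ⟨U⟩ tested against η. -/
theorem pairing_meanL_grad (hε : ∀ n, 0 < ε n) (hε0 : Tendsto ε atTop (𝓝 0))
    (hq : q ≠ ∞) {κ : ℝ} (hκ : Tendsto (fun n => ε n ^ γ) atTop (𝓝 κ))
    (hf : ∀ n, MemLp (unfold (ε n) (u n)) p (P.prod volume)) {U : FieldLp d P p}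
    (hU : WeakTendsto (fun n => ((hf n).toLp _ : FieldLp d P p)) U)
    (hF : ∀ i n, MemLp (unfold (ε n) fun z => ε n ^ γ * discreteGrad (ε n) (u n) z i) p
      (P.prod volume)) {V : Fin d → FieldLp d P p}
    (hV : ∀ i, WeakTendsto (fun n => ((hF i n).toLp _ : FieldLp d P p)) (V i))
    {η : Space d → ℝ} (hη : IsTestFunction η) (i : Fin d) :
    pairing volume p q (meanL d P p q (V i)) (hη.memLp.toLp η)
      + κ * pairing volume p q (meanL d P p q U) ((hη.memLp_partialDeriv i).toLp _) = 0 := by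
  have h := expectL_eq_zero_of_mem_pot
    (slice_add_mem_potSubmodule (q := q) hε hε0 hq hκ hf hU hF hV hη) i
  rw [map_add, map_smul, expectL_apply (probShift P p _ _), integral_probShift, ← expectL_apply,
    smul_eq_mul] at h
  rw [pairing_meanL, pairing_meanL]
  exact h

theorem hasSobolevGradient_meanL (hε : ∀ n, 0 < ε n) (hε0 : Tendsto ε atTop (𝓝 0))
    (hq : q ≠ ∞) (hκ : Tendsto (fun n => ε n ^ γ) atTop (𝓝 1))
    (hf : ∀ n, MemLp (unfold (ε n) (u n)) p (P.prod volume)) {U : FieldLp d P p}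
    (hU : WeakTendsto (fun n => ((hf n).toLp _ : FieldLp d P p)) U)
    (hF : ∀ i n, MemLp (unfold (ε n) fun z => ε n ^ γ * discreteGrad (ε n) (u n) z i) p
      (P.prod volume)) {V : Fin d → FieldLp d P p}
    (hV : ∀ i, WeakTendsto (fun n => ((hF i n).toLp _ : FieldLp d P p)) (V i)) :
    HasSobolevGradient p (meanL d P p q U) (fun i => meanL d P p q (V i)) := by
  refine ⟨Lp.memLp _, fun i => Lp.memLp _, fun i ζ hζ => ?_⟩
  have h := pairing_meanL_grad (q := q) hε hε0 hq hκ hf hU hF hV hζ i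
  rw [pairing_apply, pairing_apply, one_mul] at h
  have i1 : ∫ x, meanL d P p q U x * (hζ.memLp_partialDeriv (q := q) i).toLp _ x
      = ∫ x, meanL d P p q U x * fderiv ℝ ζ x (EuclideanSpace.single i 1) := by
    refine integral_congr_ae ?_
    filter_upwards [(hζ.memLp_partialDeriv (q := q) i).coeFn_toLp] with x h2
    rw [h2]
    rfl
  have i2 : ∫ x, meanL d P p q (V i) x * (hζ.memLp (q := q)).toLp _ x
      = ∫ x, meanL d P p q (V i) x * ζ x := by
    refine integral_congr_ae ?_
    filter_upwards [(hζ.memLp (q := q)).coeFn_toLp] with x h2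
    rw [h2]
  rw [← i1, ← i2]
  linarith

/-- The fluctuating part of the limit of the gradients is a potential field. -/
theorem sub_determL_mem_potTensorLp (hε : ∀ n, 0 < ε n) (hε0 : Tendsto ε atTop (𝓝 0))
    (hq : q ≠ ∞) {κ : ℝ} (hκ : Tendsto (fun n => ε n ^ γ) atTop (𝓝 κ))
    (hf : ∀ n, MemLp (unfold (ε n) (u n)) p (P.prod volume)) {U : FieldLp d P p}
    (hU : WeakTendsto (fun n => ((hf n).toLp _ : FieldLp d P p)) U)
    (hF : ∀ i n, MemLp (unfold (ε n) fun z => ε n ^ γ * discreteGrad (ε n) (u n) z i) p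
      (P.prod volume)) {V : Fin d → FieldLp d P p}
    (hV : ∀ i, WeakTendsto (fun n => ((hF i n).toLp _ : FieldLp d P p)) (V i))
    (hdet : U = determL d P p (meanL d P p q U)) :
    (fun i => V i - determL d P p (meanL d P p q (V i))) ∈ potTensorLp d P p := by
  refine mem_potTensorLp_of_slice (q := q) hq fun η hη => ?_
  have h := slice_add_mem_potSubmodule (q := q) hε hε0 hq hκ hf hU hF hV hη
  refine Eq.subst (motive := (· ∈ potSubmodule P p)) (funext fun i => ?_) h
  have h1 := pairing_meanL_grad (q := q) hε hε0 hq hκ hf hU hF hV hη i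
  -- As U is deterministic this slice is a constant, which S_i fixes and which `pairing_meanL_grad`
  -- identifies with the mean of V_i up to sign.
  have h2 : slice P volume U ((hη.memLp_partialDeriv (q := q) i).toLp _)
      = pairing volume p q (meanL d P p q U) ((hη.memLp_partialDeriv i).toLp _) •
        Lp.const p P (1 : ℝ) := by
    rw [← slice_determL, ← hdet]
  rw [h2, map_smul, probShift_const, smul_smul, map_sub, sub_apply, slice_determL,
    eq_neg_of_add_eq_zero_left h1, neg_smul, sub_neg_eq_add]

theorem mem_potTensorLp_of_tendsto (hε : ∀ n, 0 < ε n) (hε0 : Tendsto ε atTop (𝓝 0))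
    (hq : q ≠ ∞) (hκ : Tendsto (fun n => ε n ^ γ) atTop (𝓝 0))
    (hf : ∀ n, MemLp (unfold (ε n) (u n)) p (P.prod volume)) {U : FieldLp d P p}
    (hU : WeakTendsto (fun n => ((hf n).toLp _ : FieldLp d P p)) U)
    (hF : ∀ i n, MemLp (unfold (ε n) fun z => ε n ^ γ * discreteGrad (ε n) (u n) z i) p
      (P.prod volume)) {V : Fin d → FieldLp d P p}
    (hV : ∀ i, WeakTendsto (fun n => ((hF i n).toLp _ : FieldLp d P p)) (V i)) :
    V ∈ potTensorLp d P p := by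
  refine mem_potTensorLp_of_slice (q := q) hq fun η hη => ?_
  simpa only [zero_smul, add_zero] using
    slice_add_mem_potSubmodule (q := q) hε hε0 hq hκ hf hU hF hV hη

end GradientLimits

theorem determL_mem_invTensorLp (η : Lp ℝ p (volume : Measure (Space d))) :
    determL d P p η ∈ invTensorLp d P p :=
  subset_closure (Submodule.subset_span ⟨_, const_mem_invSet, η, coeFn_tensor _ η⟩)

theorem determL_mem_invTensorW1p {U : Lp ℝ p (volume : Measure (Space d))}
    {G : Fin d → Lp ℝ p (volume : Measure (Space d))}
    (h : HasSobolevGradient p U fun i => G i) :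
    (determL d P p U, fun i => determL d P p (G i)) ∈ invTensorW1p d P p :=
  subset_closure (Submodule.subset_span
    ⟨_, const_mem_invSet, U, fun i => G i, h, coeFn_tensor _ U, fun i => coeFn_tensor _ (G i)⟩)

end LatticeLimits

/-! ### Translation estimates for piecewise constant functions -/

section Translation

variable {d : ℕ} {p : ℝ≥0∞} {w : Space d → ℝ}

/-- The `L^p`-modulus of continuity of `w` at the translation `h`. -/
def translationNorm (p : ℝ≥0∞) (w : Space d → ℝ) (h : Space d) : ℝ≥0∞ :=
  eLpNorm (fun x => w (x + h) - w x) p volume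

theorem translationNorm_zero : translationNorm p w 0 = 0 := by
  simp [translationNorm]

theorem translationNorm_add (hp1 : 1 ≤ p) (hw : Measurable w) (h k : Space d) :
    translationNorm p w (h + k) ≤ translationNorm p w h + translationNorm p w k := by
  have hs : ∀ a : Space d, AEStronglyMeasurable (fun x => w (x + a) - w x) volume := fun a =>
    ((hw.comp (measurable_add_const a)).sub hw).aestronglyMeasurable
  have h1 : translationNorm p w h
      = eLpNorm ((fun x => w (x + h) - w x) ∘ fun x => x + k) p volume :=
    (eLpNorm_comp_measurePreserving (hs h) (measurePreserving_add_right volume k)).symm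
  rw [h1, translationNorm]
  refine le_trans (le_of_eq ?_) (eLpNorm_add_le ((hs h).comp_measurePreserving
    (measurePreserving_add_right volume k)) (hs k) hp1)
  congr 1
  ext x
  simp only [Function.comp_apply, Pi.add_apply, add_assoc, add_comm k h, sub_add_sub_cancel]

theorem translationNorm_neg (hw : Measurable w) (h : Space d) :
    translationNorm p w (-h) = translationNorm p w h := by
  have hs : AEStronglyMeasurable (fun x => w (x + h) - w x) volume :=
    ((hw.comp (measurable_add_const h)).sub hw).aestronglyMeasurable
  rw [translationNorm, translationNorm,
    ← eLpNorm_comp_measurePreserving hs (measurePreserving_add_right volume (-h)),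
    ← eLpNorm_neg]
  congr 1
  ext x
  simp

theorem translationNorm_nsmul (hp1 : 1 ≤ p) (hw : Measurable w) (h : Space d) (m : ℕ) :
    translationNorm p w (m • h) ≤ m * translationNorm p w h := by
  induction m with
  | zero => simp [translationNorm_zero]
  | succ m ih =>
    rw [add_smul, one_smul, Nat.cast_add, Nat.cast_one, add_mul, one_mul]
    exact (translationNorm_add hp1 hw _ _).trans (add_le_add ih le_rfl)

theorem translationNorm_sum (hp1 : 1 ≤ p) (hw : Measurable w) {ι : Type*} (s : Finset ι)
    (h : ι → Space d) :
    translationNorm p w (∑ i ∈ s, h i) ≤ ∑ i ∈ s, translationNorm p w (h i) := by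
  classical
  induction s using Finset.induction_on with
  | empty => simp [translationNorm_zero]
  | insert a s ha ih =>
    rw [Finset.sum_insert ha, Finset.sum_insert ha]
    exact (translationNorm_add hp1 hw _ _).trans (add_le_add le_rfl ih)

variable {ε : ℝ} {v : Lattice d → ℝ}

/-- For 0 ≤ s < ε the point x + se_i lies in the cell of x or in that of x + εe_i, so the estimate
already holds pointwise. -/
theorem translationNorm_interp_le (hε : 0 < ε) (i : Fin d) {s : ℝ} (hs0 : 0 ≤ s) (hs : s < ε) :
    translationNorm p (interp ε v) (s • basisVec i)
      ≤ translationNorm p (interp ε v) (ε • basisVec i) := by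
  refine eLpNorm_mono fun x => ?_
  have h : cell ε (x + s • basisVec i) = cell ε x
      ∨ cell ε (x + s • basisVec i) = cell ε (x + ε • basisVec i) := by
    have hj : ∀ j, j ≠ i → ∀ t : ℝ, cell ε (x + t • basisVec i) j = cell ε x j := by
      intro j hj t
      simp only [cell, PiLp.add_apply, PiLp.smul_apply, PiLp.single_apply, if_neg hj, smul_zero,
        add_zero]
    have hi : ∀ t : ℝ, cell ε (x + t • basisVec i) i = ⌊(x i + t) / ε + 1 / 2⌋ := by
      intro t
      simp [cell]
    have h1 : ⌊(x i + s) / ε + 1 / 2⌋ = ⌊x i / ε + 1 / 2⌋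
        ∨ ⌊(x i + s) / ε + 1 / 2⌋ = ⌊(x i + ε) / ε + 1 / 2⌋ := by
      have e1 : (x i + ε) / ε + 1 / 2 = (x i / ε + 1 / 2) + 1 := by field_simp; ring
      have e2 : (x i + s) / ε + 1 / 2 = (x i / ε + 1 / 2) + s / ε := by ring
      have hs1 : s / ε < 1 := (div_lt_one hε).2 hs
      have hs2 : 0 ≤ s / ε := div_nonneg hs0 hε.le
      rw [e1, e2, Int.floor_add_one]
      have h3 : ⌊x i / ε + 1 / 2⌋ ≤ ⌊x i / ε + 1 / 2 + s / ε⌋ := Int.floor_le_floor (by linarith)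
      have h4 : ⌊x i / ε + 1 / 2 + s / ε⌋ < ⌊x i / ε + 1 / 2⌋ + 2 := by
        rw [Int.floor_lt]
        push_cast
        linarith [Int.lt_floor_add_one (x i / ε + 1 / 2)]
      omega
    rcases h1 with h1 | h1
    · left
      ext j
      by_cases hji : j = i
      · subst hji
        rw [hi, h1]
        rfl
      · exact hj j hji s
    · right
      ext j
      by_cases hji : j = i
      · subst hji
        rw [hi, h1, hi]
      · rw [hj j hji s, hj j hji ε]
  simp only [interp]
  rcases h with h | h
  · rw [h, sub_self, norm_zero]
    exact norm_nonneg _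
  · rw [h]

/-- Write |t| as m steps of length ε and a remainder below ε: the cost is at most (m + 1)εC, and mε
≤ |t|. -/
theorem translationNorm_interp_axis (hp1 : 1 ≤ p) (hε : 0 < ε) {C : ℝ} (i : Fin d)
    (hC : translationNorm p (interp ε v) (ε • basisVec i) ≤ ENNReal.ofReal (ε * C)) (hC0 : 0 ≤ C)
    (t : ℝ) :
    translationNorm p (interp ε v) (t • basisVec i) ≤ ENNReal.ofReal ((|t| + ε) * C) := by
  have hw := measurable_interp ε v
  wlog ht : 0 ≤ t generalizing t
  · have := this (-t) (by linarith)
    rwa [neg_smul, translationNorm_neg hw, abs_neg] at this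
  rw [abs_of_nonneg ht]
  set m := ⌊t / ε⌋₊ with hm
  have h1 : (m : ℝ) ≤ t / ε := Nat.floor_le (div_nonneg ht hε.le)
  have h2 : t / ε < m + 1 := Nat.lt_floor_add_one _
  rw [le_div_iff₀ hε] at h1
  rw [div_lt_iff₀ hε] at h2
  have e : t • (basisVec i : Space d) = m • (ε • basisVec i) + (t - m * ε) • basisVec i := by
    rw [← Nat.cast_smul_eq_nsmul ℝ, smul_smul, ← add_smul]
    congr 1
    ring
  rw [e]
  refine (translationNorm_add hp1 hw _ _).trans ((add_le_add (translationNorm_nsmul hp1 hw _ m)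
    (translationNorm_interp_le hε i (by linarith) (by linarith))).trans ?_)
  refine (add_le_add (mul_le_mul_right hC _) hC).trans ?_
  rw [← ENNReal.ofReal_natCast, ← ENNReal.ofReal_mul (Nat.cast_nonneg m), ← ENNReal.ofReal_add
    (by positivity) (by positivity)]
  refine ENNReal.ofReal_le_ofReal ?_
  nlinarith

theorem translationNorm_interp_bound (hp1 : 1 ≤ p) (hε : 0 < ε) {C : ℝ}
    (hC : ∀ i, translationNorm p (interp ε v) (ε • basisVec i) ≤ ENNReal.ofReal (ε * C))
    (hC0 : 0 ≤ C) {δ : ℝ} {h : Space d} (hh : ∀ i, |h i| ≤ δ) :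
    translationNorm p (interp ε v) h ≤ d * ENNReal.ofReal ((δ + ε) * C) := by
  have e : h = ∑ i, h i • (basisVec i : Space d) := by
    ext j
    simp [Pi.single_apply]
  rw [e]
  refine (translationNorm_sum hp1 (measurable_interp ε v) _ _).trans ?_
  refine (Finset.sum_le_card_nsmul _ _ (ENNReal.ofReal ((δ + ε) * C)) fun i _ => ?_).trans ?_
  · refine (translationNorm_interp_axis hp1 hε i (hC i) hC0 (h i)).trans
      (ENNReal.ofReal_le_ofReal ?_)
    gcongr
    exact hh i
  · simp

/-- Averaging over cells of size `δ` is controlled by the translations of size at most `δ`. -/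
theorem eLpNorm_sub_cellAvg_le (hp1 : 1 ≤ p) (hp : p ≠ ∞) {δ : ℝ} (hδ : 0 < δ) (hw : Measurable w)
    (hwp : MemLp w p volume) {K : ℝ≥0∞}
    (hK : ∀ h : Space d, (∀ i, |h i| ≤ δ) → translationNorm p w h ≤ K) :
    eLpNorm (w - cellAvg δ w) p volume ≤ 2 ^ (d / p.toReal) * K := by
  have hp0 : p ≠ 0 := (zero_lt_one.trans_le hp1).ne'
  have hpr := ENNReal.toReal_pos hp0 hp
  have hV0 : ENNReal.ofReal (δ ^ d) ≠ 0 := (ENNReal.ofReal_pos.2 (pow_pos hδ d)).ne'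
  -- This is the box [-δ, δ)^d, which contains all differences of points of a common δ-cell. Its
  -- volume relative to a cell is 2^d, whence the constant 2^(d/p).
  let B : Set (Space d) := cell (2 * δ) ⁻¹' {0}
  have hB : MeasurableSet B := measurableSet_cell_preimage _ _
  have hmem : ∀ h : Space d, h ∈ B → ∀ i, |h i| ≤ δ := by
    intro h hh i
    have h1 : ⌊h i / (2 * δ) + 1 / 2⌋ = 0 := congrFun hh i
    rw [Int.floor_eq_zero_iff] at h1
    have h2 := h1.1
    have h3 := h1.2
    have e : h i / (2 * δ) * (2 * δ) = h i := div_mul_cancel₀ _ (by positivity)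
    rw [abs_le]
    constructor <;> nlinarith
  have hdiff : ∀ x y : Space d, cell δ x = cell δ y → y - x ∈ B := by
    intro x y hxy
    change cell (2 * δ) (y - x) = 0
    ext i
    have h0 := congrFun hxy i
    change ⌊x i / δ + 1 / 2⌋ = ⌊y i / δ + 1 / 2⌋ at h0
    change ⌊(y i - x i) / (2 * δ) + 1 / 2⌋ = 0
    have h1 := Int.abs_sub_lt_one_of_floor_eq_floor h0
    rw [abs_lt] at h1
    have e : (y i - x i) / (2 * δ) = (y i / δ - x i / δ) / 2 := by field_simp
    rw [Int.floor_eq_zero_iff, e]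
    constructor <;> linarith [h1.1, h1.2]
  have hF : Measurable fun z : Space d × Space d => ‖w z.1 - w (z.1 + z.2)‖ₑ ^ p.toReal :=
    ((hw.comp measurable_fst).sub (hw.comp (measurable_fst.add measurable_snd))).enorm.pow_const _
  have key : ∫⁻ x, ‖(w - cellAvg δ w) x‖ₑ ^ p.toReal ≤ (ENNReal.ofReal (δ ^ d))⁻¹ *
      ∫⁻ x, ∫⁻ h in B, ‖w x - w (x + h)‖ₑ ^ p.toReal := by
    rw [← lintegral_const_mul _ (hF.lintegral_prod_right' (ν := volume.restrict B))]
    refine lintegral_mono fun x => ?_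
    have := isProbabilityMeasure_cellMeasure hδ (cell δ x)
    have e : (w - cellAvg δ w) x = ∫ y, (w x - w y) ∂cellMeasure δ (cell δ x) := by
      rw [integral_sub (integrable_const _) (integrable_cellMeasure hδ hp1 hwp _)]
      simp [cellAvg]
    rw [e]
    refine (enorm_integral_rpow_le hp1 hp
      (measurable_const.sub hw).aestronglyMeasurable).trans ?_
    rw [cellMeasure, lintegral_smul_measure, smul_eq_mul]
    refine mul_le_mul_right ?_ _
    -- Substituting y = x + h replaces the cell around x by the fixed box B, so that the integrals
    -- over x and h can be exchanged.
    rw [← lintegral_indicator (measurableSet_cell_preimage δ _), ← lintegral_indicator hB,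
      ← lintegral_add_left_eq_self _ x]
    refine lintegral_mono fun h => ?_
    by_cases hx : x + h ∈ cell δ ⁻¹' {cell δ x}
    · have hb : h ∈ B := by
        have := hdiff x (x + h) (Eq.symm hx)
        rwa [add_sub_cancel_left] at this
      rw [indicator_of_mem hx, indicator_of_mem hb]
      rfl
    · rw [indicator_of_notMem hx]
      exact zero_le
  have key2 : ∫⁻ x, ∫⁻ h in B, ‖w x - w (x + h)‖ₑ ^ p.toReal
      ≤ K ^ p.toReal * ENNReal.ofReal ((2 * δ) ^ d) := by
    rw [lintegral_lintegral_swap hF.aemeasurable, ← volume_cell_preimage (by positivity) 0,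
      ← setLIntegral_const]
    refine setLIntegral_mono measurable_const fun h hh => ?_
    refine le_trans (le_of_eq ?_) (ENNReal.rpow_le_rpow (hK h (hmem h hh)) hpr.le)
    rw [translationNorm, ← lintegral_rpow_eq_eLpNorm hp0 hp]
    refine lintegral_congr fun x => ?_
    rw [← enorm_neg, neg_sub]
  rw [eLpNorm_eq_lintegral_rpow_enorm_toReal hp0 hp]
  refine (ENNReal.rpow_le_rpow (key.trans (mul_le_mul_right key2 _)) (by positivity)).trans
    (le_of_eq ?_)
  have e : (ENNReal.ofReal (δ ^ d))⁻¹ * (K ^ p.toReal * ENNReal.ofReal ((2 * δ) ^ d))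
      = 2 ^ d * K ^ p.toReal := by
    rw [mul_pow, ENNReal.ofReal_mul (by positivity), mul_comm (K ^ p.toReal), mul_comm
      (ENNReal.ofReal (2 ^ d)), ← mul_assoc, ← mul_assoc, ENNReal.inv_mul_cancel hV0
      ENNReal.ofReal_ne_top, one_mul, ENNReal.ofReal_pow zero_le_two]
    simp
  rw [e, ENNReal.mul_rpow_of_nonneg _ _ (by positivity), ← ENNReal.rpow_natCast,
    ← ENNReal.rpow_mul, ← ENNReal.rpow_mul, mul_one_div, mul_one_div_cancel hpr.ne',
    ENNReal.rpow_one]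

theorem enorm_cellAvg_rpow_le (hp1 : 1 ≤ p) (hp : p ≠ ∞) {δ : ℝ} (hδ : 0 < δ)
    (hw : AEStronglyMeasurable w volume) (x : Space d) :
    ‖cellAvg δ w x‖ₑ ^ p.toReal
      ≤ (ENNReal.ofReal (δ ^ d))⁻¹ * eLpNorm w p volume ^ p.toReal := by
  have := isProbabilityMeasure_cellMeasure hδ (cell δ x)
  refine (enorm_integral_rpow_le hp1 hp (aestronglyMeasurable_cellMeasure hw _)).trans ?_
  rw [cellMeasure, lintegral_smul_measure, smul_eq_mul,
    ← lintegral_rpow_eq_eLpNorm (zero_lt_one.trans_le hp1).ne' hp]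
  exact mul_le_mul_right (setLIntegral_le_lintegral _ _) _

end Translation

/-! ### Discrete Rellich compactness -/

section Compactness

variable {d : ℕ} {p q : ℝ≥0∞} [Fact (1 ≤ p)] [Fact (1 ≤ q)] [ENNReal.HolderConjugate p q]
  {ε : ℕ → ℝ} {V : ℕ → Lp ℝ p (volume : Measure (Space d))}
  {W : Lp ℝ p (volume : Measure (Space d))}

theorem cellAvg_congr {δ : ℝ} {f g : Space d → ℝ} (h : f =ᵐ[volume] g) :
    cellAvg δ f = cellAvg δ g :=
  funext fun _ => integral_congr_ae (ae_cellMeasure_of_ae δ _ h)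

theorem cellAvg_eq_pairing {δ : ℝ} (hδ : 0 < δ) (f : Lp ℝ p (volume : Measure (Space d)))
    (x : Space d) : cellAvg δ f x = pairing volume p q f (cellWeight d q δ (cell δ x)) := by
  rw [cellAvg, integral_cellMeasure hδ, pairing_apply]
  refine integral_congr_ae ?_
  filter_upwards [coeFn_cellWeight (q := q) hδ (cell δ x)] with y hy
  rw [hy]

/-- For fixed δ a cell average is a pairing with a fixed element of L^q, so weak convergence gives
pointwise convergence. The averages are uniformly bounded and Q has finite measure. -/
theorem tendsto_eLpNorm_cellAvg_of_weak (q : ℝ≥0∞) [Fact (1 ≤ q)] [ENNReal.HolderConjugate p q]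
    (hp : p ≠ ∞) (hW : WeakTendsto V W) {δ : ℝ} (hδ : 0 < δ) {Q : Set (Space d)}
    (hQ : Bornology.IsBounded Q) :
    Tendsto (fun n => eLpNorm (cellAvg δ (V n) - cellAvg δ W) p (volume.restrict Q)) atTop
      (𝓝 0) := by
  have hp1 : 1 ≤ p := Fact.out
  have hp0 : p ≠ 0 := (zero_lt_one.trans_le hp1).ne'
  have hpr := ENNReal.toReal_pos hp0 hp
  have hfin : IsFiniteMeasure (volume.restrict Q : Measure (Space d)) :=
    ⟨by rw [Measure.restrict_apply_univ]; exact hQ.measure_lt_top⟩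
  obtain ⟨C, hC⟩ := hW.exists_norm_le
  set M : ℝ≥0∞ := ((ENNReal.ofReal (δ ^ d))⁻¹ * ENNReal.ofReal C ^ p.toReal) ^ p.toReal⁻¹
    with hM
  have hMtop : M ≠ ∞ := by
    refine ENNReal.rpow_ne_top_of_nonneg (by positivity) (ENNReal.mul_ne_top
      (ENNReal.inv_ne_top.2 (ENNReal.ofReal_pos.2 (pow_pos hδ d)).ne')
      (ENNReal.rpow_ne_top_of_nonneg hpr.le ENNReal.ofReal_ne_top))
  have hb : ∀ n x, ‖cellAvg δ (V n) x‖ ≤ M.toReal := fun n x => by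
    have h1 := enorm_cellAvg_rpow_le hp1 hp hδ (Lp.aestronglyMeasurable (V n)) x
    have h2 : eLpNorm (V n) p volume ≤ ENNReal.ofReal C := by
      rw [← Lp.enorm_def, ← ofReal_norm]
      exact ENNReal.ofReal_le_ofReal (hC n)
    have h3 := h1.trans (mul_le_mul_right (ENNReal.rpow_le_rpow h2 hpr.le) _)
    rw [← ENNReal.le_rpow_inv_iff hpr] at h3
    rw [← toReal_enorm]
    exact ENNReal.toReal_mono hMtop h3
  have hlim : ∀ x, Tendsto (fun n => cellAvg δ (V n) x) atTop (𝓝 (cellAvg δ W x)) := fun x => by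
    simp_rw [cellAvg_eq_pairing (q := q) hδ]
    exact hW ((pairing volume p q).flip (cellWeight d q δ (cell δ x)))
  exact tendsto_eLpNorm_sub_of_dominated hp0 hp
    (fun n => (measurable_cellAvg δ _).aestronglyMeasurable) (memLp_const M.toReal)
    (Eventually.of_forall fun n => Eventually.of_forall (hb n))
    (measurable_cellAvg δ _).aestronglyMeasurable
    (Eventually.of_forall fun x => le_of_tendsto (hlim x).norm (Eventually.of_forall fun n => hb n x))
    (Eventually.of_forall hlim)

/-- A discrete Rellich theorem: weak convergence together with a bound on the discrete gradients
gives strong convergence on bounded sets. -/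
theorem tendsto_eLpNorm_restrict_of_weak (q : ℝ≥0∞) [Fact (1 ≤ q)] [ENNReal.HolderConjugate p q]
    (hp : p ≠ ∞) (hε : ∀ n, 0 < ε n) (hε0 : Tendsto ε atTop (𝓝 0)) {v : ℕ → Lattice d → ℝ}
    (hv : ∀ n, V n =ᵐ[volume] interp (ε n) (v n)) (hW : WeakTendsto V W) {C : ℝ} (hC0 : 0 ≤ C)
    (hC : ∀ i n, translationNorm p (interp (ε n) (v n)) (ε n • basisVec i)
      ≤ ENNReal.ofReal (ε n * C)) {W₀ : Space d → ℝ} (h0 : W =ᵐ[volume] W₀) {Q : Set (Space d)}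
    (hQ : Bornology.IsBounded Q) :
    Tendsto (fun n => eLpNorm (fun x => interp (ε n) (v n) x - W₀ x) p (volume.restrict Q)) atTop
      (𝓝 0) := by
  have hp1 : 1 ≤ p := Fact.out
  let δ : ℕ → ℝ := fun k => 1 / ((k : ℝ) + 1)
  have hδ : ∀ k, 0 < δ k := fun k => Nat.one_div_pos_of_nat
  have hδ0 : Tendsto δ atTop (𝓝 0) := tendsto_one_div_add_atTop_nhds_zero_nat
  -- The translation bound involves δ + ε; for fixed k, eventually ε ≤ δ_k, which explains δ_k +
  -- δ_k. The scale k is fixed first and n is taken large afterwards.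
  have t1 : Tendsto (fun k => (2 : ℝ≥0∞) ^ (d / p.toReal) * (d * ENNReal.ofReal ((δ k + δ k) * C)))
      atTop (𝓝 0) := by
    have h1 : Tendsto (fun k => (δ k + δ k) * C) atTop (𝓝 0) := by
      simpa using (hδ0.add hδ0).mul_const C
    have h2 := ENNReal.tendsto_ofReal h1
    rw [ENNReal.ofReal_zero] at h2
    have h3 := ENNReal.Tendsto.const_mul (a := (d : ℝ≥0∞)) h2 (Or.inr (ENNReal.natCast_ne_top d))
    have h4 := ENNReal.Tendsto.const_mul (a := (2 : ℝ≥0∞) ^ (d / p.toReal)) h3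
      (Or.inr (ENNReal.rpow_ne_top_of_nonneg (by positivity) ENNReal.ofNat_ne_top))
    simpa using h4
  have t3 := tendsto_eLpNorm_cellAvg_sub hp1 hp hδ hδ0 (Lp.memLp W)
  rw [ENNReal.tendsto_nhds_zero]
  intro r hr
  have hr3 : 0 < r / 3 := ENNReal.div_pos hr.ne' (by simp)
  obtain ⟨k, hk1, hk3⟩ := ((ENNReal.tendsto_nhds_zero.1 t1 _ hr3).and
    (ENNReal.tendsto_nhds_zero.1 t3 _ hr3)).exists
  have t2 := tendsto_eLpNorm_cellAvg_of_weak q hp hW (hδ k) hQ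
  filter_upwards [ENNReal.tendsto_nhds_zero.1 t2 _ hr3, hε0.eventually (gt_mem_nhds (hδ k))]
    with n hn2 hn
  set w := interp (ε n) (v n) with hw
  have hwm : Measurable w := measurable_interp _ _
  have hwp : MemLp w p volume := (memLp_congr_ae (hv n)).1 (Lp.memLp _)
  have hA : cellAvg (δ k) (V n) = cellAvg (δ k) w := cellAvg_congr (hv n)
  have e1 : eLpNorm (w - cellAvg (δ k) w) p volume ≤ r / 3 := by
    refine (eLpNorm_sub_cellAvg_le hp1 hp (hδ k) hwm hwp fun h hh => ?_).trans hk1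
    refine (translationNorm_interp_bound hp1 (hε n) (fun i => hC i n) hC0 hh).trans ?_
    gcongr
  have e0 : eLpNorm (fun x => w x - W₀ x) p (volume.restrict Q) = eLpNorm ((w - cellAvg (δ k) w) +
      (cellAvg (δ k) (V n) - cellAvg (δ k) W) + (cellAvg (δ k) W - ⇑W)) p (volume.restrict Q) := by
    refine eLpNorm_congr_ae (ae_restrict_of_ae ?_)
    filter_upwards [h0] with x hx
    simp only [Pi.add_apply, Pi.sub_apply, hA, hx]
    ring
  have m1 := (hwm.sub (measurable_cellAvg (δ k) w)).aestronglyMeasurable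
    (μ := volume.restrict Q)
  have m2 := ((measurable_cellAvg (δ k) (V n)).sub (measurable_cellAvg (δ k) W)).aestronglyMeasurable
    (μ := volume.restrict Q)
  have m3 : AEStronglyMeasurable (cellAvg (δ k) W - ⇑W) (volume.restrict Q) :=
    ((measurable_cellAvg (δ k) W).aestronglyMeasurable.sub (Lp.aestronglyMeasurable W)).restrict
  rw [e0]
  refine (eLpNorm_add_le (m1.add m2) m3 hp1).trans ((add_le_add (eLpNorm_add_le m1 m2 hp1)
    le_rfl).trans ?_)
  refine (add_le_add (add_le_add ((eLpNorm_mono_measure _ Measure.restrict_le_self).trans e1) hn2)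
    ((eLpNorm_mono_measure _ Measure.restrict_le_self).trans hk3)).trans ?_
  rw [ENNReal.add_thirds]

end Compactness

/-! ### Bounds from the energy -/

section Energy

variable {d : ℕ} {Ω : Type*} [MeasurableSpace Ω] {P : Measure Ω} [IsProbabilityMeasure P]
  {p : ℝ≥0∞} {γ ε : ℝ} {u : Ω × Lattice d → ℝ}

theorem measurePreserving_latticeShift (P : Measure Ω) [IsProbabilityMeasure P] (ε : ℝ)
    (k : Lattice d) :
    MeasurePreserving (fun z : Ω × Lattice d => (z.1, z.2 + k)) (P.prod (latticeMeasure d ε))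
      (P.prod (latticeMeasure d ε)) := by
  have : (latticeMeasure d ε).IsAddRightInvariant := by unfold latticeMeasure; infer_instance
  exact (MeasurePreserving.id P).prod (measurePreserving_add_right (latticeMeasure d ε) k)

theorem memLp_discreteGrad (hu : MemLp u p (P.prod (latticeMeasure d ε))) (c : ℝ) (i : Fin d) :
    MemLp (fun z => c * discreteGrad ε u z i) p (P.prod (latticeMeasure d ε)) := by
  have h := ((hu.comp_measurePreserving (measurePreserving_latticeShift P ε
    (latticeBasis i))).sub hu).const_mul (c / ε)
  refine (memLp_congr_ae (Eventually.of_forall fun z => ?_)).1 h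
  simp only [discreteGrad, Pi.sub_apply, Function.comp_apply]
  ring

theorem enorm_rpow_eq_ofReal (x : ℝ) {r : ℝ} (hr : 0 ≤ r) :
    ‖x‖ₑ ^ r = ENNReal.ofReal (|x| ^ r) := by
  rw [← ofReal_norm, Real.norm_eq_abs, ENNReal.ofReal_rpow_of_nonneg (abs_nonneg x) hr]

theorem eLpNorm_rpow_le_fieldEnergy (hp0 : p ≠ 0) (hp : p ≠ ∞) (hε : 0 < ε) :
    eLpNorm u p (P.prod (latticeMeasure d ε)) ^ p.toReal ≤ fieldEnergy P p γ ε u := by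
  have hpr := ENNReal.toReal_pos hp0 hp
  rw [← lintegral_rpow_eq_eLpNorm hp0 hp]
  refine lintegral_mono fun z => ?_
  rw [enorm_rpow_eq_ofReal _ hpr.le]
  exact ENNReal.ofReal_le_ofReal (le_add_of_nonneg_right (by positivity))

theorem eLpNorm_grad_rpow_le_fieldEnergy (hp0 : p ≠ 0) (hp : p ≠ ∞) (hε : 0 < ε) (i : Fin d) :
    eLpNorm (fun z => ε ^ γ * discreteGrad ε u z i) p (P.prod (latticeMeasure d ε)) ^ p.toReal
      ≤ fieldEnergy P p γ ε u := by
  have hpr := ENNReal.toReal_pos hp0 hp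
  rw [← lintegral_rpow_eq_eLpNorm hp0 hp]
  refine lintegral_mono fun z => ?_
  rw [enorm_rpow_eq_ofReal _ hpr.le]
  refine ENNReal.ofReal_le_ofReal (le_add_of_nonneg_of_le (by positivity) ?_)
  rw [abs_mul, abs_of_pos (Real.rpow_pos_of_pos hε γ), Real.mul_rpow (by positivity)
    (abs_nonneg _), ← Real.rpow_mul hε.le]
  gcongr
  exact PiLp.norm_apply_le (discreteGrad ε u z) i

end Energy

/-! ### Bounded sequences and their limits -/

section Main

variable {d : ℕ} {Ω : Type*} [MeasurableSpace Ω] {P : Measure Ω} [IsProbabilityMeasure P]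
  [AddAction (Lattice d) Ω] [MeasurableConstVAdd (Lattice d) Ω]
  [VAddInvariantMeasure (Lattice d) Ω P] {p q : ℝ≥0∞} [Fact (1 ≤ p)] [Fact (1 ≤ q)]
  [ENNReal.HolderConjugate p q] [Fact (p ≠ ∞)] {γ : ℝ} {ε : ℕ → ℝ} {u : ℕ → Ω × Lattice d → ℝ}

theorem memLp_unfold_grad (hε : ∀ n, 0 < ε n)
    (hu : ∀ n, MemLp (u n) p (P.prod (latticeMeasure d (ε n)))) (γ : ℝ) (i : Fin d) (n : ℕ) :
    MemLp (unfold (ε n) fun z => ε n ^ γ * discreteGrad (ε n) (u n) z i) p (P.prod volume) :=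
  memLp_unfold (hε n) (memLp_discreteGrad (hu n) _ i)

theorem twoScaleWeak_iff (hf : ∀ n, MemLp (unfold (ε n) (u n)) p (P.prod volume))
    {U : FieldLp d P p} :
    TwoScaleWeak P p ε u U ↔ WeakTendsto (fun n => ((hf n).toLp _ : FieldLp d P p)) U := by
  rw [weakTendsto_iff]
  exact ⟨fun ⟨_, h⟩ => h, fun h => ⟨hf, h⟩⟩

theorem norm_toLp_unfold_le (hp0 : p ≠ 0) (hp : p ≠ ∞) {ε : ℝ} (hε : 0 < ε)
    {w : Ω × Lattice d → ℝ} (hw : MemLp w p (P.prod (latticeMeasure d ε))) {E : ℝ≥0∞} (hE : E ≠ ∞)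
    (h : eLpNorm w p (P.prod (latticeMeasure d ε)) ^ p.toReal ≤ E) :
    ‖((memLp_unfold hε hw).toLp _ : FieldLp d P p)‖ ≤ (E ^ p.toReal⁻¹).toReal := by
  have hpr := ENNReal.toReal_pos hp0 hp
  rw [Lp.norm_toLp, eLpNorm_unfold hε hw.1]
  refine ENNReal.toReal_mono (ENNReal.rpow_ne_top_of_nonneg (by positivity) hE) ?_
  rwa [ENNReal.le_rpow_inv_iff hpr]

theorem exists_norm_bound (hp : p ≠ ∞) (hε : ∀ n, 0 < ε n)
    (hu : ∀ n, MemLp (u n) p (P.prod (latticeMeasure d (ε n))))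
    (hbound : limsup (fun n => fieldEnergy P p γ (ε n) (u n)) atTop < ∞) :
    ∃ C, (∀ n, ‖((memLp_unfold (hε n) (hu n)).toLp _ : FieldLp d P p)‖ ≤ C) ∧
      ∀ i n, ‖((memLp_unfold_grad hε hu γ i n).toLp _ : FieldLp d P p)‖ ≤ C := by
  have hp0 : p ≠ 0 := (zero_lt_one.trans_le (Fact.out : 1 ≤ p)).ne'
  obtain ⟨E, hE1, hE2⟩ := exists_between hbound
  have hev := eventually_lt_of_limsup_lt hE1
  -- The index `none` stands for u and `some i` for its i-th gradient. The limsup bounds only a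
  -- tail; the finitely many earlier norms are finite anyway.
  have key : ∀ o : Option (Fin d), ∃ C, ∀ n, (o.elim
      ‖((memLp_unfold (hε n) (hu n)).toLp _ : FieldLp d P p)‖
      fun i => ‖((memLp_unfold_grad hε hu γ i n).toLp _ : FieldLp d P p)‖) ≤ C := by
    intro o
    have : IsBoundedUnder (· ≤ ·) atTop fun n => (o.elim
      ‖((memLp_unfold (hε n) (hu n)).toLp _ : FieldLp d P p)‖
      fun i => ‖((memLp_unfold_grad hε hu γ i n).toLp _ : FieldLp d P p)‖) := by
      refine ⟨(E ^ p.toReal⁻¹).toReal, eventually_map.2 ?_⟩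
      filter_upwards [hev] with n hn
      cases o with
      | none =>
        exact norm_toLp_unfold_le hp0 hp (hε n) (hu n) hE2.ne
          ((eLpNorm_rpow_le_fieldEnergy hp0 hp (hε n)).trans hn.le)
      | some i =>
        exact norm_toLp_unfold_le hp0 hp (hε n) (memLp_discreteGrad (hu n) _ i) hE2.ne
          ((eLpNorm_grad_rpow_le_fieldEnergy hp0 hp (hε n) i).trans hn.le)
    obtain ⟨C, hC⟩ := this.bddAbove_range
    exact ⟨C, fun n => hC ⟨n, rfl⟩⟩
  choose C hC using key
  obtain ⟨M, hM⟩ := (Set.finite_range C).bddAbove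
  exact ⟨M, fun n => (hC none n).trans (hM ⟨_, rfl⟩),
    fun i n => (hC (some i) n).trans (hM ⟨_, rfl⟩)⟩

theorem exists_limits (hp1 : 1 < p) (hp : p ≠ ∞) [IsSeparable P] (hq : q ≠ ∞) (hε : ∀ n, 0 < ε n)
    (hu : ∀ n, MemLp (u n) p (P.prod (latticeMeasure d (ε n)))) {C : ℝ}
    (hC : ∀ n, ‖((memLp_unfold (hε n) (hu n)).toLp _ : FieldLp d P p)‖ ≤ C)
    (hC' : ∀ i n, ‖((memLp_unfold_grad hε hu γ i n).toLp _ : FieldLp d P p)‖ ≤ C) :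
    ∃ σ : ℕ → ℕ, StrictMono σ ∧ ∃ (U : FieldLp d P p) (V : Fin d → FieldLp d P p),
      WeakTendsto (fun n => ((memLp_unfold (hε (σ n)) (hu (σ n))).toLp _ : FieldLp d P p)) U ∧
      ∀ i, WeakTendsto (fun n => ((memLp_unfold_grad hε hu γ i (σ n)).toLp _ : FieldLp d P p))
        (V i) := by
  have : ENNReal.HolderConjugate q p := ENNReal.HolderConjugate.symm
  have : Fact (q ≠ ∞) := ⟨hq⟩
  have hsep : TopologicalSpace.SeparableSpace (FieldLp d P q) := separableSpace_Lp_prod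
  obtain ⟨σ, hσ, h⟩ := exists_weakTendsto_subseq_finite (q := q) hp1 hp
    (μ := P.prod (volume : Measure (Space d))) (Finset.univ : Finset (Option (Fin d)))
    (f := fun o n => o.elim ((memLp_unfold (hε n) (hu n)).toLp _ : FieldLp d P p)
      fun i => (memLp_unfold_grad hε hu γ i n).toLp _) (C := fun _ => C)
    (fun o n => by
      cases o with
      | none => exact hC n
      | some i => exact hC' i n)
  choose W hW using h
  exact ⟨σ, hσ, W none (Finset.mem_univ _), fun i => W (some i) (Finset.mem_univ _),
    hW none (Finset.mem_univ _), fun i => hW (some i) (Finset.mem_univ _)⟩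

theorem eq_determL_of_bound (q : ℝ≥0∞) [Fact (1 ≤ q)] [ENNReal.HolderConjugate p q]
    (hErg : IsErgodic d P) (hq : q ≠ ∞) (hγ : γ < 1) (hε : ∀ n, 0 < ε n)
    (hε0 : Tendsto ε atTop (𝓝 0)) (hu : ∀ n, MemLp (u n) p (P.prod (latticeMeasure d (ε n))))
    {C : ℝ} (hC : ∀ i n, ‖((memLp_unfold_grad hε hu γ i n).toLp _ : FieldLp d P p)‖ ≤ C)
    {U : FieldLp d P p}
    (hU : WeakTendsto (fun n => ((memLp_unfold (hε n) (hu n)).toLp _ : FieldLp d P p)) U) :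
    U = determL d P p (meanL d P p q U) :=
  eq_determL_of_slice_mem_invSet hErg fun g => slice_mem_invSet (q := q) hε hε0 hγ hq
    (fun n => memLp_unfold (hε n) (hu n)) hU (fun i n => memLp_unfold_grad hε hu γ i n) hC g

/-- Every lattice point has positive mass, so a property holding for almost every lattice point
holds at each of them. -/
theorem integrable_slice_lattice {ε : ℝ} (hε : 0 < ε) {w : Ω × Lattice d → ℝ} (hp : p ≠ ∞)
    (hw : MemLp w p (P.prod (latticeMeasure d ε))) (z : Lattice d) :
    Integrable (fun ω => w (ω, z)) P := by
  have hp0 : p ≠ 0 := (zero_lt_one.trans_le (Fact.out : 1 ≤ p)).ne'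
  have hsw := Measure.measurePreserving_swap (μ := latticeMeasure d ε) (ν := P)
  have h1 := hw.comp_measurePreserving hsw
  obtain ⟨g, hg, hgw⟩ := h1.1
  have h2 := ae_memLp_slice hp0 hp hg ((memLp_congr_ae hgw).1 h1)
  have h3 := Measure.ae_ae_of_ae_prod hgw
  have hz : latticeMeasure d ε {z} ≠ 0 := by
    rw [latticeMeasure, Measure.smul_apply, Measure.count_singleton, smul_eq_mul, mul_one]
    exact (ENNReal.ofReal_pos.2 (pow_pos hε d)).ne'
  have h4 := h2.and h3
  obtain ⟨z', hz', h5, h6⟩ : ∃ z' ∈ ({z} : Set (Lattice d)), MemLp (fun b => g (z', b)) p P ∧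
      ∀ᵐ b ∂P, (w ∘ Prod.swap) (z', b) = g (z', b) := by
    by_contra hcon
    refine hz (measure_mono_null (fun z' hz' => ?_) h4)
    intro h
    exact hcon ⟨z', hz', h.1, h.2⟩
  rw [mem_singleton_iff] at hz'
  subst hz'
  exact ((memLp_congr_ae h6).2 h5).integrable Fact.out

/-- Translating the interpolated mean by one lattice step changes it by ε times the interpolated
mean gradient, whose norm is that of the mean of the unfolded gradient. -/
theorem translationNorm_interp_expect {ε : ℝ} (hε : 0 < ε) {w : Ω × Lattice d → ℝ} (hp : p ≠ ∞)
    (hw : MemLp w p (P.prod (latticeMeasure d ε))) (i : Fin d)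
    (hF : MemLp (unfold ε fun z => discreteGrad ε w z i) p (P.prod volume)) {C : ℝ}
    (hC : ‖meanL d P p q (hF.toLp _)‖ ≤ C) :
    translationNorm p (interp ε (expect P w)) (ε • basisVec i) ≤ ENNReal.ofReal (ε * C) := by
  have h1 : (fun x => interp ε (expect P w) (x + ε • basisVec i) - interp ε (expect P w) x)
      = ε • interp ε (expect P fun z => discreteGrad ε w z i) := by
    ext x
    simp only [interp, cell_add_basisVec hε, expect, Pi.smul_apply, discreteGrad, smul_eq_mul]
    rw [integral_div, integral_sub (integrable_slice_lattice hε hp hw _)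
      (integrable_slice_lattice hε hp hw _), mul_div_cancel₀ _ hε.ne']
  rw [translationNorm, h1, eLpNorm_const_smul, ← eLpNorm_congr_ae (coeFn_meanL_unfold (q := q) hF),
    ← Lp.enorm_def, ENNReal.ofReal_mul hε.le, Real.enorm_eq_ofReal hε.le, ← ofReal_norm]
  exact mul_le_mul_right (ENNReal.ofReal_le_ofReal hC) _

end Main

/-! ### Identification of the limits in each regime -/

section Limits

variable {d : ℕ} {Ω : Type*} [MeasurableSpace Ω] {P : Measure Ω} [IsProbabilityMeasure P]
  [AddAction (Lattice d) Ω] [MeasurableConstVAdd (Lattice d) Ω]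
  [VAddInvariantMeasure (Lattice d) Ω P] {p : ℝ≥0∞} [Fact (1 ≤ p)]
  [Fact (p ≠ ∞)] {γ : ℝ} {ε : ℕ → ℝ} {u : ℕ → Ω × Lattice d → ℝ}

theorem ae_eq_of_eq_determL {U : FieldLp d P p} {U₀ : Lp ℝ p (volume : Measure (Space d))}
    (h : U = determL d P p U₀) : U =ᵐ[P.prod volume] fun z => U₀ z.2 := by
  subst h
  exact coeFn_determL U₀

theorem twoScaleWeak_rpow_zero {i : Fin d} {W : FieldLp d P p} :
    TwoScaleWeak P p ε (fun n z => ε n ^ (0 : ℝ) * discreteGrad (ε n) (u n) z i) W ↔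
      TwoScaleWeak P p ε (fun n z => discreteGrad (ε n) (u n) z i) W := by
  simp only [Real.rpow_zero, one_mul]

/-- The weak limit V of the gradients is split into its mean ⟨V⟩ = ∇U and the fluctuation χ = V -
⟨V⟩, which is potential. -/
theorem isLimitZero_of_weakTendsto (q : ℝ≥0∞) [Fact (1 ≤ q)] [ENNReal.HolderConjugate p q]
    (hErg : IsErgodic d P) (hq : q ≠ ∞) (hε : ∀ n, 0 < ε n) (hε0 : Tendsto ε atTop (𝓝 0))
    (hu : ∀ n, MemLp (u n) p (P.prod (latticeMeasure d (ε n)))) {C : ℝ}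
    (hC : ∀ i n, ‖((memLp_unfold_grad hε hu 0 i n).toLp _ : FieldLp d P p)‖ ≤ C)
    {U : FieldLp d P p} {V : Fin d → FieldLp d P p}
    (hU : WeakTendsto (fun n => ((memLp_unfold (hε n) (hu n)).toLp _ : FieldLp d P p)) U)
    (hV : ∀ i, WeakTendsto (fun n => ((memLp_unfold_grad hε hu 0 i n).toLp _ : FieldLp d P p))
      (V i)) :
    IsLimitZero P p ε u U (fun i => determL d P p (meanL d P p q (V i)))
      (fun i => V i - determL d P p (meanL d P p q (V i))) := by
  have hκ : Tendsto (fun n => ε n ^ (0 : ℝ)) atTop (𝓝 1) := by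
    simpa only [Real.rpow_zero] using tendsto_const_nhds
  have hdet := eq_determL_of_bound q hErg hq zero_lt_one hε hε0 hu hC hU
  refine ⟨?_, ?_, (twoScaleWeak_iff fun n => memLp_unfold (hε n) (hu n)).2 hU, fun i => ?_⟩
  · have h := determL_mem_invTensorW1p (P := P)
      (hasSobolevGradient_meanL (q := q) hε hε0 hq hκ _ hU _ hV)
    rwa [← hdet] at h
  · exact sub_determL_mem_potTensorLp (q := q) hε hε0 hq hκ _ hU _ hV hdet
  · rw [add_sub_cancel, ← twoScaleWeak_rpow_zero]
    exact (twoScaleWeak_iff fun n => memLp_unfold_grad hε hu 0 i n).2 (hV i)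

theorem isLimitPos_of_weakTendsto (q : ℝ≥0∞) [Fact (1 ≤ q)] [ENNReal.HolderConjugate p q]
    (hErg : IsErgodic d P) (hq : q ≠ ∞) (hγ0 : 0 < γ) (hγ : γ < 1) (hε : ∀ n, 0 < ε n)
    (hε0 : Tendsto ε atTop (𝓝 0))
    (hu : ∀ n, MemLp (u n) p (P.prod (latticeMeasure d (ε n)))) {C : ℝ}
    (hC : ∀ i n, ‖((memLp_unfold_grad hε hu γ i n).toLp _ : FieldLp d P p)‖ ≤ C)
    {U : FieldLp d P p} {V : Fin d → FieldLp d P p}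
    (hU : WeakTendsto (fun n => ((memLp_unfold (hε n) (hu n)).toLp _ : FieldLp d P p)) U)
    (hV : ∀ i, WeakTendsto (fun n => ((memLp_unfold_grad hε hu γ i n).toLp _ : FieldLp d P p))
      (V i)) :
    IsLimitPos P p γ ε u U V := by
  have hκ : Tendsto (fun n => ε n ^ γ) atTop (𝓝 0) := by
    have := ((Real.continuousAt_rpow_const 0 γ (Or.inr hγ0.le)).tendsto).comp hε0
    rwa [Real.zero_rpow hγ0.ne'] at this
  refine ⟨?_, mem_potTensorLp_of_tendsto (q := q) hε hε0 hq hκ _ hU _ hV,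
    (twoScaleWeak_iff fun n => memLp_unfold (hε n) (hu n)).2 hU,
    fun i => (twoScaleWeak_iff fun n => memLp_unfold_grad hε hu γ i n).2 (hV i)⟩
  rw [eq_determL_of_bound q hErg hq hγ hε hε0 hu hC hU]
  exact determL_mem_invTensorLp _

/-- Ergodicity makes the pair (U, G) deterministic through its membership in the tensor space. The
gradient bound for the Rellich argument comes from weak convergence of the gradients themselves, and
χ drops out on taking means. -/
theorem IsLimitZero.exists_deterministic (q : ℝ≥0∞) [Fact (1 ≤ q)] [ENNReal.HolderConjugate p q]
    (hErg : IsErgodic d P) (hq : q ≠ ∞) (hε : ∀ n, 0 < ε n) (hε0 : Tendsto ε atTop (𝓝 0))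
    (hu : ∀ n, MemLp (u n) p (P.prod (latticeMeasure d (ε n))))
    {U : FieldLp d P p} {G χ : Fin d → FieldLp d P p} (h : IsLimitZero P p ε u U G χ) :
    ∃ (U₀ : Space d → ℝ) (G₀ : Fin d → Space d → ℝ),
      HasSobolevGradient p U₀ G₀ ∧
      (U =ᵐ[P.prod volume] fun q => U₀ q.2) ∧
      (∀ i, G i =ᵐ[P.prod volume] fun q => G₀ i q.2) ∧
      LatticeTendstoWeak p ε (fun n => expect P (u n)) U₀ ∧
      (∀ i, LatticeTendstoWeak p ε
        (fun n => expect P fun q => discreteGrad (ε n) (u n) q i) (G₀ i)) ∧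
      TwoScaleWeak P p ε (fun n q => u n q - expect P (u n) q.2) 0 ∧
      ∀ Q : Set (Space d), Bornology.IsBounded Q → Tendsto (fun n => eLpNorm
        (fun x => interp (ε n) (expect P (u n)) x - U₀ x) p (volume.restrict Q)) atTop (𝓝 0) := by
  have hp : p ≠ ∞ := Fact.out
  obtain ⟨hs, hU, hG⟩ := exists_sobolev_of_mem_invTensorW1p (q := q) hErg h.mem_inv
  have hf : ∀ n, MemLp (unfold (ε n) (u n)) p (P.prod volume) := fun n =>
    memLp_unfold (hε n) (hu n)
  have hF : ∀ i n, MemLp (unfold (ε n) fun z => discreteGrad (ε n) (u n) z i) p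
      (P.prod volume) := fun i => (h.tendsto_grad i).choose
  have tU := (twoScaleWeak_iff hf).1 h.tendsto
  have tG := fun i => (twoScaleWeak_iff (hF i)).1 (h.tendsto_grad i)
  have hmean : ∀ i, meanL d P p q (G i + χ i) = meanL d P p q (G i) := fun i => by
    rw [map_add, meanL_eq_zero_of_mem_potTensorLp h.mem_pot i, add_zero]
  have hbd : ∀ i, ∃ C, ∀ n, ‖meanL d P p q ((hF i n).toLp _)‖ ≤ C := fun i =>
    ((tG i).map (meanL d P p q)).exists_norm_le
  choose C hC using hbd
  obtain ⟨M, hM⟩ := (Set.finite_range C).bddAbove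
  refine ⟨meanL d P p q U, fun i => meanL d P p q (G i), hs, ?_, fun i => ?_,
    latticeTendstoWeak_expect (q := q) hq hε hε0 hf tU EventuallyEq.rfl,
    fun i => latticeTendstoWeak_expect (q := q) hq hε hε0 (hF i) (tG i) (by rw [hmean i]),
    twoScaleWeak_fluctuation (q := q) hf tU hU, fun Q hQ => ?_⟩
  · exact ae_eq_of_eq_determL hU
  · exact ae_eq_of_eq_determL (hG i)
  · exact tendsto_eLpNorm_restrict_of_weak q hp hε hε0
      (fun n => coeFn_meanL_unfold (q := q) (hf n)) (tU.map (meanL d P p q))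
      (le_max_right M 0) (fun i n => translationNorm_interp_expect (q := q) (hε n) hp (hu n) i (hF i n)
        (((hC i n).trans (hM ⟨i, rfl⟩)).trans (le_max_left M 0))) EventuallyEq.rfl hQ

/-- Weak convergence of ε^γ∇u bounds it, and since γ < 1 this bound alone forces U to be
deterministic. The mean of χ vanishes because χ is potential. -/
theorem IsLimitPos.exists_deterministic (q : ℝ≥0∞) [Fact (1 ≤ q)] [ENNReal.HolderConjugate p q]
    (hErg : IsErgodic d P) (hq : q ≠ ∞) (hγ : γ < 1) (hε : ∀ n, 0 < ε n)
    (hε0 : Tendsto ε atTop (𝓝 0)) (hu : ∀ n, MemLp (u n) p (P.prod (latticeMeasure d (ε n))))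
    {U : FieldLp d P p} {χ : Fin d → FieldLp d P p} (h : IsLimitPos P p γ ε u U χ) :
    ∃ U₀ : Space d → ℝ,
      (U =ᵐ[P.prod volume] fun q => U₀ q.2) ∧
      LatticeTendstoWeak p ε (fun n => expect P (u n)) U₀ ∧
      (∀ i, LatticeTendstoWeak p ε
        (fun n => expect P fun q => ε n ^ γ * discreteGrad (ε n) (u n) q i) 0) ∧
      TwoScaleWeak P p ε (fun n q => u n q - expect P (u n) q.2) 0 := by
  have hf : ∀ n, MemLp (unfold (ε n) (u n)) p (P.prod volume) := fun n =>
    memLp_unfold (hε n) (hu n)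
  have tU := (twoScaleWeak_iff hf).1 h.tendsto
  have tV := fun i => (twoScaleWeak_iff fun n => memLp_unfold_grad hε hu γ i n).1 (h.tendsto_grad i)
  choose C hC using fun i => (tV i).exists_norm_le
  obtain ⟨M, hM⟩ := (Set.finite_range C).bddAbove
  have hU := eq_determL_of_bound q hErg hq hγ hε hε0 hu
    (fun i n => (hC i n).trans (hM ⟨i, rfl⟩)) tU
  refine ⟨meanL d P p q U, ?_,
    latticeTendstoWeak_expect (q := q) hq hε hε0 hf tU EventuallyEq.rfl,
    fun i => latticeTendstoWeak_expect (q := q) hq hε hε0 _ (tV i) ?_,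
    twoScaleWeak_fluctuation (q := q) hf tU hU⟩
  · exact ae_eq_of_eq_determL hU
  · rw [meanL_eq_zero_of_mem_potTensorLp h.mem_pot i]
    exact Lp.coeFn_zero ℝ p volume

theorem memLp_mul_bounded {α : Type*} [MeasurableSpace α] {μ : Measure α} {f g : α → ℝ}
    (hf : MemLp f p μ) (hg : AEStronglyMeasurable g μ) {M : ℝ} (hM : ∀ᵐ x ∂μ, ‖g x‖ ≤ M) :
    MemLp (fun x => f x * g x) p μ ∧
      eLpNorm (fun x => f x * g x) p μ ≤ ENNReal.ofReal M * eLpNorm f p μ := by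
  have h : ∀ᵐ x ∂μ, ‖f x * g x‖ ≤ M * ‖f x‖ := by
    filter_upwards [hM] with x hx
    rw [norm_mul, mul_comm]
    exact mul_le_mul_of_nonneg_right hx (norm_nonneg _)
  exact ⟨hf.of_le_mul (hf.1.mul hg) h, eLpNorm_le_mul_eLpNorm_of_ae_le_mul h p⟩

/-- The unfolding of uφ differs from U₀ψ_n by at most ‖φ‖_∞ times the distance of 𝒯u from U₀, which
tends to 0. Taking means then gives norm convergence to ⟨φ⟩U₀. -/
theorem latticeTendstoStrong_expect_mul (q : ℝ≥0∞) [Fact (1 ≤ q)] [ENNReal.HolderConjugate p q]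
    (hq : q ≠ ∞) (hε : ∀ n, 0 < ε n)
    (hε0 : Tendsto ε atTop (𝓝 0)) (hu : ∀ n, MemLp (u n) p (P.prod (latticeMeasure d (ε n))))
    {U₀ : Lp ℝ p (volume : Measure (Space d))}
    (hU : Tendsto (fun n => ((memLp_unfold (hε n) (hu n)).toLp _ : FieldLp d P p)) atTop
      (𝓝 (determL d P p U₀))) {φ : Ω → ℝ} (hφ : MemLp φ ∞ P) :
    LatticeTendstoStrong p ε (fun n => expect P fun z => u n z * φ z.1)
      (fun x => (∫ ω, φ ω ∂P) * U₀ x) := by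
  set c := ∫ ω, φ ω ∂P with hc
  obtain ⟨M, hMdef⟩ : ∃ M, M = (eLpNorm φ ∞ P).toReal := ⟨_, rfl⟩
  have hM0 : 0 ≤ M := hMdef ▸ ENNReal.toReal_nonneg
  have hM : ∀ᵐ ω ∂P, ‖φ ω‖ ≤ M := by
    filter_upwards [ae_le_eLpNormEssSup (f := φ) (μ := P)] with ω hω
    rw [← toReal_enorm, hMdef]
    exact ENNReal.toReal_mono hφ.eLpNorm_ne_top (by rwa [eLpNorm_exponent_top])
  have hwm : ∀ n, MemLp (fun z : Ω × Lattice d => u n z * φ z.1) p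
      (P.prod (latticeMeasure d (ε n))) := fun n =>
    (memLp_mul_bounded (hu n) hφ.1.comp_fst (Measure.quasiMeasurePreserving_fst.ae hM)).1
  -- The unfolding of φ. It depends on the cell of x and need not converge, but its mean is ⟨φ⟩ for
  -- every x and n.
  let ψ : ℕ → Ω × Space d → ℝ := fun n z => φ (unfoldMap (ε n) z).1
  have hmp : ∀ n, Measure.QuasiMeasurePreserving (fun z : Ω × Space d => (unfoldMap (ε n) z).1)
      (P.prod volume) P := fun n =>
    Measure.quasiMeasurePreserving_fst.comp
      (measurePreserving_unfoldMap (P := P) (hε n)).quasiMeasurePreserving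
  have hψm : ∀ n, AEStronglyMeasurable (ψ n) (P.prod volume) := fun n =>
    hφ.1.comp_quasiMeasurePreserving (hmp n)
  have hψM : ∀ n, ∀ᵐ z ∂P.prod (volume : Measure (Space d)), ‖ψ n z‖ ≤ M := fun n =>
    (hmp n).ae hM
  have hfm : ∀ n, MemLp (unfold (ε n) fun z => u n z * φ z.1) p (P.prod volume) := fun n =>
    memLp_unfold (hε n) (hwm n)
  have hΨ : ∀ n, MemLp (fun z => U₀ z.2 * ψ n z) p (P.prod volume) := fun n =>
    (memLp_mul_bounded ((Lp.memLp U₀).comp_measurePreserving (measurePreserving_snd (μ := P)))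
      (hψm n) (hψM n)).1
  have hmean : ∀ n, meanL d P p q ((hΨ n).toLp _) = c • U₀ := fun n => by
    refine Lp.ext ?_
    filter_upwards [coeFn_meanL_toLp (q := q) (hΨ n), Lp.coeFn_smul c U₀] with x h1 h2
    rw [h1, h2, Pi.smul_apply, smul_eq_mul, integral_const_mul, mul_comm]
    congr 1
    exact integral_vadd_eq_self (μ := P) (g := -cell (ε n) x) φ
  have hdiff : ∀ n, ‖((hfm n).toLp _ : FieldLp d P p) - (hΨ n).toLp _‖
      ≤ M * ‖((memLp_unfold (hε n) (hu n)).toLp _ : FieldLp d P p) - determL d P p U₀‖ := fun n => by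
    have hsub := (memLp_unfold (hε n) (hu n)).sub
      ((Lp.memLp U₀).comp_measurePreserving (measurePreserving_snd (μ := P)))
    have e1 : determL d P p U₀ = ((Lp.memLp U₀).comp_measurePreserving
        (measurePreserving_snd (μ := P))).toLp _ :=
      Lp.ext ((coeFn_determL U₀).trans (MemLp.coeFn_toLp _).symm)
    have h1 := (memLp_mul_bounded hsub (hψm n) (hψM n)).2
    have e2 : (unfold (ε n) fun z => u n z * φ z.1) - (fun z => U₀ z.2 * ψ n z)
        = fun z => (unfold (ε n) (u n) - (⇑U₀ ∘ Prod.snd : Ω × Space d → ℝ)) z * ψ n z := by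
      ext z
      simp only [Pi.sub_apply, unfold, unfoldMap, ψ, Function.comp_apply]
      ring
    rw [e1, ← MemLp.toLp_sub, ← MemLp.toLp_sub, Lp.norm_toLp, Lp.norm_toLp, e2,
      ← ENNReal.toReal_ofReal hM0, ← ENNReal.toReal_mul]
    exact ENNReal.toReal_mono (ENNReal.mul_ne_top ENNReal.ofReal_ne_top hsub.eLpNorm_ne_top) h1
  have hlim : Tendsto (fun n => meanL d P p q ((hfm n).toLp _)) atTop (𝓝 (c • U₀)) := by
    have h1 : Tendsto (fun n => ((hfm n).toLp _ : FieldLp d P p) - (hΨ n).toLp _) atTop (𝓝 0) := by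
      refine squeeze_zero_norm hdiff ?_
      simpa using (tendsto_iff_norm_sub_tendsto_zero.1 hU).const_mul M
    have h2 := (((meanL d P p q).continuous.tendsto 0).comp h1).add_const (c • U₀)
    rw [map_zero, zero_add] at h2
    refine h2.congr fun n => ?_
    rw [Function.comp_apply, map_sub, hmean, sub_add_cancel]
  have h0 : (c • U₀ : Lp ℝ p (volume : Measure (Space d))) =ᵐ[volume] fun x => c * U₀ x :=
    Lp.coeFn_smul c U₀
  refine ⟨latticeTendstoWeak_of_interp (q := q) hq hε hε0
    (fun n => coeFn_meanL_unfold (q := q) (hfm n)) hlim.weakTendsto h0, ?_⟩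
  rw [← eLpNorm_congr_ae h0, ← Lp.enorm_def]
  refine hlim.enorm.congr fun n => ?_
  rw [Lp.enorm_def, eLpNorm_congr_ae (coeFn_meanL_unfold (q := q) (hfm n)), eLpNorm_interp (hε n)]

end Limits

end StochUnfold

end

/-! ### Assembly of the three cases -/

theorem corollary3p7 {d : ℕ} {Ω : Type*} [MeasurableSpace Ω]
    (P : Measure Ω) [IsProbabilityMeasure P] [MeasureTheory.IsSeparable P]
    [AddAction (Lattice d) Ω] [MeasurableConstVAdd (Lattice d) Ω]
    [VAddInvariantMeasure (Lattice d) Ω P] (hErg : IsErgodic d P)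
    (p : ℝ≥0∞) [Fact (1 ≤ p)] (hp1 : 1 < p) (hp : p < ∞)
    (γ : ℝ) (hγ0 : 0 ≤ γ) (hγ1 : γ < 1)
    (ε : ℕ → ℝ) (hε : ∀ n, 0 < ε n) (hε0 : Tendsto ε atTop (𝓝 0))
    (u : ℕ → Ω × Lattice d → ℝ)
    (hu : ∀ n, MemLp (u n) p (P.prod (latticeMeasure d (ε n))))
    (hbound : limsup (fun n => fieldEnergy P p γ (ε n) (u n)) atTop < ∞) :
    -- the case `γ = 0`
    (γ = 0 →
      (∃ σ : ℕ → ℕ, StrictMono σ ∧ ∃ (U : FieldLp d P p) (G χ : Fin d → FieldLp d P p),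
        IsLimitZero P p (ε ∘ σ) (u ∘ σ) U G χ) ∧
      ∀ σ : ℕ → ℕ, StrictMono σ → ∀ (U : FieldLp d P p) (G χ : Fin d → FieldLp d P p),
        IsLimitZero P p (ε ∘ σ) (u ∘ σ) U G χ →
        ∃ (U₀ : Space d → ℝ) (G₀ : Fin d → Space d → ℝ),
          HasSobolevGradient p U₀ G₀ ∧
          (U =ᵐ[P.prod volume] fun q => U₀ q.2) ∧
          (∀ i, G i =ᵐ[P.prod volume] fun q => G₀ i q.2) ∧
          LatticeTendstoWeak p (ε ∘ σ) (fun n => expect P (u (σ n))) U₀ ∧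
          (∀ i, LatticeTendstoWeak p (ε ∘ σ)
            (fun n => expect P fun q => discreteGrad (ε (σ n)) (u (σ n)) q i) (G₀ i)) ∧
          TwoScaleWeak P p (ε ∘ σ) (fun n q => u (σ n) q - expect P (u (σ n)) q.2) 0 ∧
          ∀ Q : Set (Space d), IsOpen Q → Bornology.IsBounded Q → HasLipschitzBoundary Q →
            Tendsto (fun n => eLpNorm
              (fun x => interp (ε (σ n)) (expect P (u (σ n))) x - U₀ x) p (volume.restrict Q))
              atTop (𝓝 0)) ∧
    -- the case `0 < γ < 1`
    (0 < γ →
      (∃ σ : ℕ → ℕ, StrictMono σ ∧ ∃ (U : FieldLp d P p) (χ : Fin d → FieldLp d P p),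
        IsLimitPos P p γ (ε ∘ σ) (u ∘ σ) U χ) ∧
      ∀ σ : ℕ → ℕ, StrictMono σ → ∀ (U : FieldLp d P p) (χ : Fin d → FieldLp d P p),
        IsLimitPos P p γ (ε ∘ σ) (u ∘ σ) U χ →
        ∃ U₀ : Space d → ℝ,
          (U =ᵐ[P.prod volume] fun q => U₀ q.2) ∧
          LatticeTendstoWeak p (ε ∘ σ) (fun n => expect P (u (σ n))) U₀ ∧
          (∀ i, LatticeTendstoWeak p (ε ∘ σ)
            (fun n => expect P fun q =>
              ε (σ n) ^ γ * discreteGrad (ε (σ n)) (u (σ n)) q i) 0) ∧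
          TwoScaleWeak P p (ε ∘ σ) (fun n q => u (σ n) q - expect P (u (σ n)) q.2) 0) ∧
    -- strong two-scale convergence, `0 ≤ γ < 1`
    (∀ σ : ℕ → ℕ, StrictMono σ → ∀ U : FieldLp d P p,
      TwoScaleStrong P p (ε ∘ σ) (u ∘ σ) U →
      ∃ U₀ : Space d → ℝ,
        (U =ᵐ[P.prod volume] fun q => U₀ q.2) ∧
        ∀ φ : Ω → ℝ, MemLp φ ∞ P →
          LatticeTendstoStrong p (ε ∘ σ)
            (fun n => expect P fun q => u (σ n) q * φ q.1)
            (fun x => (∫ ω, φ ω ∂P) * U₀ x)) := by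
  have hp' : p ≠ ∞ := hp.ne
  have hpt : Fact (p ≠ ∞) := ⟨hp'⟩
  let q := p.conjExponent
  have hq1 : Fact (1 ≤ q) := ⟨ENNReal.HolderConjugate.one_le q p⟩
  have hq : q ≠ ∞ := ((ENNReal.HolderConjugate.lt_top_iff_one_lt q p).2 hp1).ne
  obtain ⟨C, hC, hC'⟩ := exists_norm_bound hp' hε hu hbound
  have hsub : ∀ {σ : ℕ → ℕ}, StrictMono σ → Tendsto (ε ∘ σ) atTop (𝓝 0) := fun hσ =>
    hε0.comp hσ.tendsto_atTop
  refine ⟨fun h0 => ⟨?_, fun σ hσ U G χ h => ?_⟩, fun h0 => ⟨?_, fun σ hσ U χ h => ?_⟩,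
    fun σ hσ U h => ?_⟩
  · subst h0
    obtain ⟨σ, hσ, U, V, hU, hV⟩ := exists_limits (q := q) hp1 hp' hq hε hu hC hC'
    exact ⟨σ, hσ, U, _, _, isLimitZero_of_weakTendsto q hErg hq (fun n => hε (σ n)) (hsub hσ)
      (fun n => hu (σ n)) (fun i n => hC' i (σ n)) hU hV⟩
  · obtain ⟨U₀, G₀, h1, h2, h3, h4, h5, h6, h7⟩ := h.exists_deterministic q hErg hq
      (fun n => hε (σ n)) (hsub hσ) (fun n => hu (σ n))
    exact ⟨U₀, G₀, h1, h2, h3, h4, h5, h6, fun Q _ hQ _ => h7 Q hQ⟩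
  · obtain ⟨σ, hσ, U, V, hU, hV⟩ := exists_limits (q := q) hp1 hp' hq hε hu hC hC'
    exact ⟨σ, hσ, U, V, isLimitPos_of_weakTendsto q hErg hq h0 hγ1 (fun n => hε (σ n)) (hsub hσ)
      (fun n => hu (σ n)) (fun i n => hC' i (σ n)) hU hV⟩
  · exact h.exists_deterministic q hErg hq hγ1 (fun n => hε (σ n)) (hsub hσ) (fun n => hu (σ n))
  · obtain ⟨hf, h⟩ := h
    -- No limit of the gradients is assumed here; their bound from the energy suffices to make U
    -- deterministic.
    have hU := eq_determL_of_bound q hErg hq hγ1 (fun n => hε (σ n)) (hsub hσ)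
      (fun n => hu (σ n)) (fun i n => hC' i (σ n)) h.weakTendsto
    rw [hU] at h
    exact ⟨meanL d P p q U, ae_eq_of_eq_determL hU, fun φ hφ =>
      latticeTendstoStrong_expect_mul q hq (fun n => hε (σ n)) (hsub hσ) (fun n => hu (σ n)) h hφ⟩
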